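/- Let $p\in(2,\infty)$, let $\mathbb R^2_+=\{x\in\mathbb R^2: x_1>0\}$, and write $\partial_\theta=x_1\partial_{x_2}-x_2\partial_{x_1}$. Let $$H^+=\Bigl\{u\in H^1_0(\mathbb R^2_+)\;:\;\int_{\mathbb R^2_+}|\partial_\theta u|^2\,dx<\infty\Bigr\},\qquad \|u\|_{H^+}^2=\int_{\mathbb R^2_+}\bigl(|\nabla u|^2+|\partial_\theta u|^2+u^2\bigr)\,dx .$$ For $\lambda>0$ and $q\in\{0,1\}$ consider the problem $$(P_{\lambda,q})\qquad -\Delta u-\frac1{\lambda^2}\,\partial_\theta^2u+q\,u=|u|^{p-2}u\ \text{ on }\mathbb R^2_+,\qquad u=0\ \text{ on }\partial\mathbb R^2_+ .$$ A (weak) solution of $(P_{\lambda,q})$ is a function $u\in H^+$ such that $$\int_{\mathbb R^2_+}\Bigl(\nabla u\cdot\nabla\varphi+\frac1{\lambda^2}\,\partial_\theta u\,\partial_\theta\varphi+q\,u\varphi\Bigr)dx=\int_{\mathbb R^2_+}|u|^{p-2}u\,\varphi\,dx\qquad\text{for all }\varphi\in H^+ .$$ A least energy solution of $(P_{\lambda,q})$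 is a nontrivial solution that minimizes $$E_{\lambda,q}(u)=\frac12\int_{\mathbb R^2_+}\Bigl(|\nabla u|^2+\frac1{\lambda^2}|\partial_\theta u|^2+q\,u^2\Bigr)dx-\frac1p\int_{\mathbb R^2_+}|u|^p\,dx$$ among all nontrivial solutions of $(P_{\lambda,q})$; it is called positive if it is positive almost everywhere on $\mathbb R^2_+$. **Theorem.** Let $(\lambda_k)_{k\in\mathbb N}$ be a sequence with $0<\lambda_k\le 1$ and $\lambda_k\to0$ as $k\to\infty$. For every $k$ let $u_k\in H^+$ be a positive least energy solution of $(P_{\lambda_k,1})$, and define $v_k(x)=\lambda_k^{2/(p-2)}\,u_k(\lambda_kx)$ for $x\in\mathbb R^2_+$. Then $v_k\in H^+$ for all $k$ and, after passing to a subsequence, $v_k\to v^*$ strongly in $H^+$, where $v^*$ is a positive least energy solution of $(P_{1,0})$, that is, of $$-\Delta v^*-\partial_\theta^2v^*=|v^*|^{p-2}v^*\ \text{ on }\mathbb R^2_+,\qquad v^*=0\ \text{ on }\partial\mathbb R^2_+ .$$ -/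

import Mathlib

open Filter Topology MeasureTheory
open scoped ContDiff

namespace HalfPlaneNLS

/-- The Euclidean plane; coordinates `x 0`, `x 1` are the usual `x₁`, `x₂`. -/
abbrev Plane : Type := EuclideanSpace ℝ (Fin 2)

/-- The open half-plane `{x₁ > 0}`. -/
def halfPlane : Set Plane := {x | 0 < x 0}

/-- Lebesgue measure on the half-plane. -/
noncomputable def halfVolume : Measure Plane := volume.restrict halfPlane

/-- The classical partial derivative in the `i`-th coordinate direction. -/
noncomputable def partialDeriv (i : Fin 2) (φ : Plane → ℝ) (x : Plane) : ℝ :=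
  fderiv ℝ φ x (EuclideanSpace.single i 1)

/-- Test functions: smooth with compact support contained in the open half-plane. -/
def IsTestFunction (φ : Plane → ℝ) : Prop :=
  ContDiff ℝ ∞ φ ∧ HasCompactSupport φ ∧ tsupport φ ⊆ halfPlane

/-- `g` is a weak `i`-th partial derivative of `u` in the half-plane. -/
def IsWeakPartial (i : Fin 2) (u g : Plane → ℝ) : Prop :=
  LocallyIntegrableOn u halfPlane ∧ LocallyIntegrableOn g halfPlane ∧
    ∀ φ : Plane → ℝ, IsTestFunction φ →
      ∫ x, u x * partialDeriv i φ x ∂halfVolume = -∫ x, g x * φ x ∂halfVolume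

open Classical in
/-- The weak `i`-th partial derivative (a representative of its a.e. class, which is unique
on the half-plane); by convention `0` if there is none. -/
noncomputable def weakPartial (i : Fin 2) (u : Plane → ℝ) : Plane → ℝ :=
  if h : ∃ g, IsWeakPartial i u g then h.choose else 0

/-- The angular derivative `∂_θ u = x₁ ∂₂u - x₂ ∂₁u`, in the weak sense. -/
noncomputable def angularDeriv (u : Plane → ℝ) (x : Plane) : ℝ :=
  x 0 * weakPartial 1 u x - x 1 * weakPartial 0 u x

/-- `u ∈ H¹(ℝ²₊)`: `u` is square integrable and has square integrable weak partial derivatives. -/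
def MemH1 (u : Plane → ℝ) : Prop :=
  MemLp u 2 halfVolume ∧
    ∀ i, (∃ g, IsWeakPartial i u g) ∧ MemLp (weakPartial i u) 2 halfVolume

/-- `u ∈ H¹₀(ℝ²₊)`: `u ∈ H¹(ℝ²₊)` is a limit of test functions in the `H¹`-norm. -/
def MemH10 (u : Plane → ℝ) : Prop :=
  MemH1 u ∧ ∃ φ : ℕ → Plane → ℝ, (∀ n, IsTestFunction (φ n)) ∧
    Tendsto (fun n => eLpNorm (fun x => φ n x - u x) 2 halfVolume) atTop (𝓝 0) ∧
    ∀ i, Tendsto (fun n =>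
      eLpNorm (fun x => partialDeriv i (φ n) x - weakPartial i u x) 2 halfVolume) atTop (𝓝 0)

/-- `u ∈ H⁺`: `u ∈ H¹₀(ℝ²₊)` and `∂_θ u` is square integrable over the half-plane. -/
def MemHPlus (u : Plane → ℝ) : Prop :=
  MemH10 u ∧ MemLp (angularDeriv u) 2 halfVolume

/-- The scalar product
`⟨u,v⟩_{λ,q} = ∫ ∇u·∇v + λ⁻² (∂_θ u)(∂_θ v) + q u v` over the half-plane. -/
noncomputable def form (lam q : ℝ) (u v : Plane → ℝ) : ℝ :=
  ∫ x, (weakPartial 0 u x * weakPartial 0 v x + weakPartial 1 u x * weakPartial 1 v x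
    + 1 / lam ^ 2 * (angularDeriv u x * angularDeriv v x) + q * (u x * v x)) ∂halfVolume

/-- The norm `‖u‖_{λ,q}`. -/
noncomputable def formNorm (lam q : ℝ) (u : Plane → ℝ) : ℝ :=
  Real.sqrt (form lam q u u)

/-- Convergence of a sequence in `H⁺`: all members lie in `H⁺` and the differences tend to `0` in
the norm `‖u‖_{1,1}² = ∫ |∇u|² + |∂_θ u|² + u²`. -/
def TendstoHPlus (v : ℕ → Plane → ℝ) (w : Plane → ℝ) : Prop :=
  (∀ k, MemHPlus (v k)) ∧ MemHPlus w ∧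
    Tendsto (fun k => formNorm 1 1 (fun x => v k x - w x)) atTop (𝓝 0)

/-- The energy functional
`½ ∫ (|∇u|² + λ⁻² |∂_θ u|² + q u²) - (1/p) ∫ |u|^p` over the half-plane. -/
noncomputable def energy (p lam q : ℝ) (u : Plane → ℝ) : ℝ :=
  1 / 2 * form lam q u u - 1 / p * ∫ x, |u x| ^ p ∂halfVolume

/-- `u` is a weak solution in `H⁺` of
`-Δu - λ⁻² ∂_θ² u + q u = |u|^{p-2} u` on the half-plane with zero Dirichlet boundary values. -/
def IsWeakSolution (p lam q : ℝ) (u : Plane → ℝ) : Prop :=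
  MemHPlus u ∧ ∀ φ : Plane → ℝ, MemHPlus φ →
    form lam q u φ = ∫ x, |u x| ^ (p - 2) * u x * φ x ∂halfVolume

/-- `u` is a weak solution that is not a.e. zero. -/
def IsNontrivialSolution (p lam q : ℝ) (u : Plane → ℝ) : Prop :=
  IsWeakSolution p lam q u ∧ ¬ u =ᵐ[halfVolume] 0

/-- `u` minimizes the energy among all nontrivial weak solutions. -/
def IsLeastEnergySolution (p lam q : ℝ) (u : Plane → ℝ) : Prop :=
  IsNontrivialSolution p lam q u ∧
    ∀ w : Plane → ℝ, IsNontrivialSolution p lam q w → energy p lam q u ≤ energy p lam q w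

/-- A least energy solution that is positive (a.e.) on the half-plane. -/
def IsPositiveLeastEnergySolution (p lam q : ℝ) (u : Plane → ℝ) : Prop :=
  IsLeastEnergySolution p lam q u ∧ ∀ᵐ x ∂halfVolume, 0 < u x

/-- The rescaled function `x ↦ λ^{2/(p-2)} u(λ x)`. -/
noncomputable def rescale (p lam : ℝ) (u : Plane → ℝ) (x : Plane) : ℝ :=
  lam ^ (2 / (p - 2)) * u (lam • x)

end HalfPlaneNLS

open HalfPlaneNLS

namespace HalfPlaneNLS

open scoped ENNReal

/-! ### Convergence in `L²` -/

section General

variable {α : Type*} [MeasurableSpace α] {μ : Measure α}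

/-! The rescaling turns a least energy solution for the parameters (λ, 1) into one for (1, λ²). What
has to be shown is therefore that least energy solutions depend continuously on the coefficient q =
λ² as it tends to 0. At q = 0 two things could fail: the form might no longer control the L² norm,
and mass might escape to infinity. The angular derivative prevents both.

Extended by zero, u vanishes on the left half of every circle about the origin. Integrating along
circles gives ‖u‖₂ ≤ 4π ‖∂_θ u‖₂ (`IsTestFunction.poincare`), so the form is coercive even for q = 0
(`exists_coercive`). On a circle u² is bounded by an integral over the angle, and on a ray w(r) u²
is bounded by an integral over the radius, where w grows linearly. Multiplying the two bounds gives
a weighted L⁴ estimate (`IsTestFunction.lintegral_tailWeight_le`), hence tightness. With a local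
Rellich argument on small squares this makes the embedding of H⁺ into Lᵖ compact for every p > 2
(`exists_subseq_tendsto_lpEmb`).

All nontrivial solutions lie on the Nehari manifold, where the energy is (1/2 - 1/p) ‖u‖_p^p. Least
energy solutions are thus the suitably normalized minimizers of the quotient of the form by ‖·‖_p²
(`IsMinimizer.isLeastEnergySolution`, `IsLeastEnergySolution.isMinimizer`). Once a minimizing
sequence converges in Lᵖ, the parallelogram law makes it Cauchy for the form, so strong convergence
follows without weak limits (`exists_tendsto_of_minimizing`). This argument tolerates a varying q
and yields the limit v* (`exists_tendsto_isMinimizer`).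

The limit is nonnegative and a supersolution of -Δv - ∂_θ²v = 0. A logarithmic Caccioppoli
inequality together with Poincaré on rectangles shows that such a function is zero or positive
almost everywhere (`IsSupersolution.pos`).

Throughout, an element of H⁺ is handled as its jet (u, ∂₁u, ∂₂u, ∂_θ u), a point of the closed
subspace `jetSpace` of (L²)⁴. Inequalities are proved for test functions and extended by closure. -/

theorem tendsto_eLpNorm_zero_of_le {F f g : ℕ → α → ℝ} {C : ℝ} (hC : 0 ≤ C)
    (hf : ∀ n, AEStronglyMeasurable (f n) μ) (hg : ∀ n, AEStronglyMeasurable (g n) μ)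
    (hF : ∀ n, ∀ᵐ x ∂μ, |F n x| ≤ C * (|f n x| + |g n x|))
    (hf0 : Tendsto (fun n => eLpNorm (f n) 2 μ) atTop (𝓝 0))
    (hg0 : Tendsto (fun n => eLpNorm (g n) 2 μ) atTop (𝓝 0)) :
    Tendsto (fun n => eLpNorm (F n) 2 μ) atTop (𝓝 0) := by
  have key : ∀ n, eLpNorm (F n) 2 μ
      ≤ ENNReal.ofReal C * (eLpNorm (f n) 2 μ + eLpNorm (g n) 2 μ) := by
    intro n
    have h1 : eLpNorm (F n) 2 μ ≤ eLpNorm (C • fun x => |f n x| + |g n x|) 2 μ := by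
      refine eLpNorm_mono_ae ?_
      filter_upwards [hF n] with x hx
      simpa [abs_of_nonneg hC, abs_of_nonneg (add_nonneg (abs_nonneg (f n x)) (abs_nonneg (g n x)))]
        using hx
    refine h1.trans ?_
    rw [eLpNorm_const_smul, Real.enorm_eq_ofReal hC]
    gcongr
    have h2 := eLpNorm_add_le (μ := μ) (p := 2) (hf n).norm (hg n).norm (by norm_num)
    rw [eLpNorm_norm, eLpNorm_norm] at h2
    exact h2
  have lim : Tendsto (fun n => ENNReal.ofReal C * (eLpNorm (f n) 2 μ + eLpNorm (g n) 2 μ))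
      atTop (𝓝 0) := by
    have := ENNReal.Tendsto.const_mul (a := ENNReal.ofReal C) (hf0.add hg0)
      (Or.inr ENNReal.ofReal_ne_top)
    simpa using this
  exact tendsto_of_tendsto_of_tendsto_of_le_of_le tendsto_const_nhds lim (fun _ => bot_le) key

theorem eLpNorm_two_eq (f : α → ℝ) :
    eLpNorm f 2 μ = (∫⁻ x, ‖f x‖ₑ ^ 2 ∂μ) ^ (1 / 2 : ℝ) := by
  rw [eLpNorm_eq_lintegral_rpow_enorm_toReal (by norm_num) (by norm_num)]
  simp

theorem eLpNorm_two_sq (f : α → ℝ) :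
    eLpNorm f 2 μ ^ 2 = ∫⁻ x, ‖f x‖ₑ ^ 2 ∂μ := by
  rw [eLpNorm_two_eq, ← ENNReal.rpow_natCast, ← ENNReal.rpow_mul]
  norm_num

theorem tendsto_eLpNorm_zero_of_dominated {F : ℕ → α → ℝ} {g : α → ℝ}
    (hF : ∀ n, AEStronglyMeasurable (F n) μ) (hg : MemLp g 2 μ)
    (hle : ∀ n, ∀ᵐ x ∂μ, |F n x| ≤ |g x|)
    (hlim : ∀ᵐ x ∂μ, Tendsto (fun n => F n x) atTop (𝓝 0)) :
    Tendsto (fun n => eLpNorm (F n) 2 μ) atTop (𝓝 0) := by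
  simp_rw [eLpNorm_two_eq]
  have h0 : Tendsto (fun n => ∫⁻ x, ‖F n x‖ₑ ^ 2 ∂μ) atTop (𝓝 (∫⁻ _, 0 ∂μ)) := by
    refine tendsto_lintegral_of_dominated_convergence' (fun x => ‖g x‖ₑ ^ 2)
      (fun n => (hF n).enorm.pow_const 2) (fun n => ?_) ?_ ?_
    · filter_upwards [hle n] with x hx
      gcongr
      simpa [enorm_le_iff_norm_le] using hx
    · rw [← eLpNorm_two_sq]
      exact ENNReal.pow_ne_top hg.2.ne
    · filter_upwards [hlim] with x hx
      have := ((ENNReal.continuous_pow 2).tendsto _).comp hx.enorm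
      simpa [Function.comp_def] using this
  have := h0.ennrpow_const (1 / 2 : ℝ)
  simpa using this

/-- Subsequences are extracted one index at a time, so that a single one serves all components of a
jet. -/
theorem exists_subseq_ae_tendsto {ι : Type*} (s : Finset ι) {f : ℕ → ι → α → ℝ} {g : ι → α → ℝ}
    (h : ∀ j, TendstoInMeasure μ (fun n => f n j) atTop (g j)) :
    ∃ ns : ℕ → ℕ, StrictMono ns ∧
      ∀ j ∈ s, ∀ᵐ x ∂μ, Tendsto (fun k => f (ns k) j x) atTop (𝓝 (g j x)) := by
  classical
  induction s using Finset.induction_on with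
  | empty => exact ⟨id, strictMono_id, by simp⟩
  | insert a s _ ih =>
    obtain ⟨ns, hns, hs⟩ := ih
    have h1 : TendstoInMeasure μ (fun n => f (ns n) a) atTop (g a) :=
      fun ε hε => (h a ε hε).comp hns.tendsto_atTop
    obtain ⟨ms, hms, ha⟩ := h1.exists_seq_tendsto_ae
    refine ⟨ns ∘ ms, hns.comp hms, fun j hj => ?_⟩
    rcases Finset.mem_insert.1 hj with rfl | hj
    · exact ha
    · filter_upwards [hs j hj] with x hx using hx.comp hms.tendsto_atTop

/-- If `gₙ → g` in `L²`, and `aₙ → a` a.e. with `|aₙ| ≤ C`, then `aₙ gₙ → a g` in `L²`. -/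
theorem tendsto_eLpNorm_mul_sub {a : ℕ → α → ℝ} {a₀ : α → ℝ} {g : ℕ → α → ℝ} {g₀ : α → ℝ} {C : ℝ}
    (ha : ∀ n, AEStronglyMeasurable (a n) μ) (ha₀ : AEStronglyMeasurable a₀ μ)
    (hg : ∀ n, AEStronglyMeasurable (g n) μ) (hg₀ : MemLp g₀ 2 μ)
    (haC : ∀ n, ∀ᵐ x ∂μ, |a n x| ≤ C)
    (hlim : ∀ᵐ x ∂μ, Tendsto (fun n => a n x) atTop (𝓝 (a₀ x)))
    (hgl : Tendsto (fun n => eLpNorm (g n - g₀) 2 μ) atTop (𝓝 0)) :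
    Tendsto (fun n => eLpNorm (fun x => a n x * g n x - a₀ x * g₀ x) 2 μ) atTop (𝓝 0) := by
  have ha₀C : ∀ᵐ x ∂μ, |a₀ x| ≤ C := by
    filter_upwards [ae_all_iff.2 haC, hlim] with x hx hl
    exact le_of_tendsto hl.abs (Eventually.of_forall hx)
  -- The factor |C| + 1 is positive and dominates both C, for the term aₙ (gₙ - g), and 1, for the
  -- term (aₙ - a) g.
  refine tendsto_eLpNorm_zero_of_le (C := |C| + 1) (f := fun n => g n - g₀)
    (g := fun n x => (a n x - a₀ x) * g₀ x) (by positivity) (fun n => (hg n).sub hg₀.1)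
    (fun n => ((ha n).sub ha₀).mul hg₀.1) (fun n => ?_) hgl ?_
  · filter_upwards [haC n] with x hx
    have h1 : a n x * g n x - a₀ x * g₀ x = a n x * (g n x - g₀ x) + (a n x - a₀ x) * g₀ x := by ring
    rw [h1]
    refine (abs_add_le _ _).trans ?_
    rw [abs_mul (a n x), mul_add]
    have h2 : |a n x| ≤ |C| + 1 := by linarith [le_abs_self C]
    refine add_le_add (mul_le_mul_of_nonneg_right h2 (abs_nonneg _)) ?_
    exact le_mul_of_one_le_left (abs_nonneg _) (by linarith [abs_nonneg C])
  · refine tendsto_eLpNorm_zero_of_dominated (g := fun x => (2 * C) * g₀ x)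
      (fun n => ((ha n).sub ha₀).mul hg₀.1) (hg₀.const_mul _) (fun n => ?_) ?_
    · filter_upwards [haC n, ha₀C] with x hx hx0
      rw [abs_mul, abs_mul]
      refine mul_le_mul_of_nonneg_right ?_ (abs_nonneg _)
      refine (norm_sub_le (a n x) (a₀ x)).trans ?_
      rw [Real.norm_eq_abs, Real.norm_eq_abs]
      linarith [le_abs_self (2 * C)]
    · filter_upwards [hlim] with x hx
      have := (hx.sub_const (a₀ x)).mul_const (g₀ x)
      simpa [Function.comp_def] using this

end General

/-! ### Test functions and their jets -/

theorem isOpen_halfPlane : IsOpen halfPlane :=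
  isOpen_lt continuous_const (by fun_prop)

theorem measurableSet_halfPlane : MeasurableSet halfPlane := isOpen_halfPlane.measurableSet

instance : IsLocallyFiniteMeasure halfVolume := by unfold halfVolume; infer_instance
instance : IsFiniteMeasureOnCompacts halfVolume := by unfold halfVolume; infer_instance

theorem contDiff_coord (i : Fin 2) : ContDiff ℝ ∞ (fun x : Plane => x i) := by fun_prop

namespace IsTestFunction

variable {φ ψ : Plane → ℝ}

theorem contDiff (h : IsTestFunction φ) : ContDiff ℝ ∞ φ := h.1

theorem continuous (h : IsTestFunction φ) : Continuous φ := h.1.continuous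

theorem differentiable (h : IsTestFunction φ) : Differentiable ℝ φ := h.1.differentiable (by simp)

theorem eq_zero (h : IsTestFunction φ) {x : Plane} (hx : x ∉ halfPlane) : φ x = 0 := by
  by_contra h0
  exact hx (h.2.2 (subset_tsupport _ h0))

theorem mul_left (h : IsTestFunction φ) (hψ : ContDiff ℝ ∞ ψ) :
    IsTestFunction (fun x => ψ x * φ x) :=
  ⟨hψ.mul h.1, h.2.1.mul_left, (tsupport_mul_subset_right).trans h.2.2⟩

theorem add (h : IsTestFunction φ) (hψ : IsTestFunction ψ) : IsTestFunction (fun x => φ x + ψ x) :=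
  ⟨h.1.add hψ.1, h.2.1.add hψ.2.1,
    (tsupport_add φ ψ).trans (Set.union_subset h.2.2 hψ.2.2)⟩

theorem const_mul (h : IsTestFunction φ) (c : ℝ) : IsTestFunction (fun x => c * φ x) :=
  h.mul_left contDiff_const

theorem sub (h : IsTestFunction φ) (hψ : IsTestFunction ψ) : IsTestFunction (fun x => φ x - ψ x) := by
  simpa [sub_eq_add_neg] using h.add (hψ.const_mul (-1))

theorem zero : IsTestFunction (fun _ => 0) :=
  ⟨contDiff_const, HasCompactSupport.zero, by simp [tsupport]⟩

theorem partialDeriv (h : IsTestFunction φ) (i : Fin 2) : IsTestFunction (partialDeriv i φ) := by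
  refine ⟨?_, ?_, ?_⟩
  · exact (h.1.fderiv_right (m := ∞) (by simp)).clm_apply contDiff_const
  · exact h.2.1.fderiv_apply ℝ _
  · refine (tsupport_fderiv_apply_subset ℝ _).trans h.2.2

theorem memLp (h : IsTestFunction φ) (p : ℝ≥0∞) : MemLp φ p halfVolume :=
  h.continuous.memLp_of_hasCompactSupport h.2.1

theorem integrable (h : IsTestFunction φ) : Integrable φ :=
  h.continuous.integrable_of_hasCompactSupport h.2.1

theorem integral_half (h : IsTestFunction φ) : ∫ x, φ x ∂halfVolume = ∫ x, φ x :=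
  setIntegral_eq_integral_of_forall_compl_eq_zero fun _ hx => h.eq_zero hx

theorem integral_mul_partialDeriv (h : IsTestFunction φ) (hψ : IsTestFunction ψ) (i : Fin 2) :
    ∫ x, φ x * HalfPlaneNLS.partialDeriv i ψ x ∂halfVolume
      = -∫ x, HalfPlaneNLS.partialDeriv i φ x * ψ x ∂halfVolume := by
  rw [((hψ.partialDeriv i).mul_left h.1).integral_half,
    (hψ.mul_left (h.partialDeriv i).1).integral_half]
  exact integral_mul_fderiv_eq_neg_fderiv_mul_of_integrable
    (hψ.mul_left (h.partialDeriv i).1).integrable ((hψ.partialDeriv i).mul_left h.1).integrable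
    (hψ.mul_left h.1).integrable (fun x _ => h.differentiable x) (fun x _ => hψ.differentiable x)

end IsTestFunction

theorem partialDeriv_add {φ ψ : Plane → ℝ} (h : Differentiable ℝ φ) (hψ : Differentiable ℝ ψ)
    (i : Fin 2) (x : Plane) :
    partialDeriv i (fun x => φ x + ψ x) x = partialDeriv i φ x + partialDeriv i ψ x := by
  simp only [partialDeriv]
  rw [fderiv_fun_add (h x) (hψ x)]
  rfl

theorem partialDeriv_mul {φ ψ : Plane → ℝ} (h : Differentiable ℝ φ) (hψ : Differentiable ℝ ψ)
    (i : Fin 2) (x : Plane) :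
    partialDeriv i (fun x => φ x * ψ x) x = φ x * partialDeriv i ψ x + ψ x * partialDeriv i φ x := by
  simp only [partialDeriv]
  rw [fderiv_fun_mul (h x) (hψ x)]
  rfl

theorem partialDeriv_const_mul {φ : Plane → ℝ} (h : Differentiable ℝ φ) (c : ℝ)
    (i : Fin 2) (x : Plane) :
    partialDeriv i (fun x => c * φ x) x = c * partialDeriv i φ x := by
  simp only [partialDeriv]
  rw [fderiv_const_mul (h x)]
  rfl

theorem partialDeriv_comp {φ : Plane → ℝ} {F : ℝ → ℝ} {F' : ℝ} (h : Differentiable ℝ φ) (i : Fin 2)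
    (x : Plane) (hF : HasDerivAt F F' (φ x)) :
    partialDeriv i (fun x => F (φ x)) x = F' * partialDeriv i φ x := by
  simp only [partialDeriv]
  have := hF.comp_hasFDerivAt x (h x).hasFDerivAt
  rw [show (fun x => F (φ x)) = F ∘ φ from rfl, this.fderiv]
  rfl

/-- The function together with its partial derivatives and its angular derivative. -/
noncomputable def jet (φ : Plane → ℝ) : Fin 4 → Plane → ℝ :=
  ![φ, partialDeriv 0 φ, partialDeriv 1 φ,
    fun x => x 0 * partialDeriv 1 φ x - x 1 * partialDeriv 0 φ x]

/-- The index of the `i`-th partial derivative in a jet. -/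
def gradIdx (i : Fin 2) : Fin 4 := i.succ.castSucc

theorem jet_gradIdx (φ : Plane → ℝ) (i : Fin 2) : jet φ (gradIdx i) = partialDeriv i φ := by
  fin_cases i <;> rfl

theorem IsTestFunction.jet {φ : Plane → ℝ} (h : IsTestFunction φ) (j : Fin 4) :
    IsTestFunction (jet φ j) := by
  fin_cases j
  · exact h
  · exact h.partialDeriv 0
  · exact h.partialDeriv 1
  · exact ((h.partialDeriv 1).mul_left (contDiff_coord 0)).sub
      ((h.partialDeriv 0).mul_left (contDiff_coord 1))

theorem jet_add {φ ψ : Plane → ℝ} (h : Differentiable ℝ φ) (hψ : Differentiable ℝ ψ) (j : Fin 4)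
    (x : Plane) : HalfPlaneNLS.jet (fun x => φ x + ψ x) j x = jet φ j x + jet ψ j x := by
  fin_cases j <;> simp [jet, partialDeriv_add h hψ]
  ring

theorem jet_const_mul {φ : Plane → ℝ} (h : Differentiable ℝ φ) (c : ℝ) (j : Fin 4)
    (x : Plane) : HalfPlaneNLS.jet (fun x => c * φ x) j x = c * jet φ j x := by
  fin_cases j <;> simp [jet, partialDeriv_const_mul h]
  ring

/-! ### The closed space of jets -/

/-- Real square integrable functions on the half-plane. -/
abbrev HalfL2 : Type := Lp ℝ 2 halfVolume

/-- The jets of test functions, as square integrable functions. -/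
noncomputable def testJets : Submodule ℝ (Fin 4 → HalfL2) where
  carrier := {U | ∃ φ, IsTestFunction φ ∧ ∀ j, U j =ᵐ[halfVolume] jet φ j}
  add_mem' := by
    rintro U V ⟨φ, hφ, hU⟩ ⟨ψ, hψ, hV⟩
    refine ⟨_, hφ.add hψ, fun j => ?_⟩
    filter_upwards [hU j, hV j, Lp.coeFn_add (U j) (V j)] with x h1 h2 h3
    rw [Pi.add_apply, h3, Pi.add_apply, h1, h2, jet_add hφ.differentiable hψ.differentiable]
  zero_mem' := by
    refine ⟨_, IsTestFunction.zero, fun j => ?_⟩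
    filter_upwards [Lp.coeFn_zero ℝ 2 halfVolume] with x h1
    have := jet_const_mul (φ := fun _ => 0) (by fun_prop) 0 j x
    simp only [zero_mul] at this
    rw [this]
    exact h1
  smul_mem' := by
    rintro c U ⟨φ, hφ, hU⟩
    refine ⟨_, hφ.const_mul c, fun j => ?_⟩
    filter_upwards [hU j, Lp.coeFn_smul c (U j)] with x h1 h2
    rw [Pi.smul_apply, h2, Pi.smul_apply, h1, jet_const_mul hφ.differentiable, smul_eq_mul]

/-- The jets of the elements of `H⁺`. -/
noncomputable def jetSpace : Submodule ℝ (Fin 4 → HalfL2) := testJets.topologicalClosure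

theorem isClosed_jetSpace : IsClosed (jetSpace : Set (Fin 4 → HalfL2)) :=
  testJets.isClosed_topologicalClosure

/-- The jet of a test function as a tuple of square integrable functions. -/
noncomputable def IsTestFunction.toL2 {φ : Plane → ℝ} (h : IsTestFunction φ) : Fin 4 → HalfL2 :=
  fun j => ((h.jet j).memLp 2).toLp

theorem IsTestFunction.coeFn_toL2 {φ : Plane → ℝ} (h : IsTestFunction φ) (j : Fin 4) :
    h.toL2 j =ᵐ[halfVolume] HalfPlaneNLS.jet φ j := MemLp.coeFn_toLp _

theorem IsTestFunction.toL2_mem {φ : Plane → ℝ} (h : IsTestFunction φ) : h.toL2 ∈ jetSpace :=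
  testJets.le_topologicalClosure ⟨φ, h, h.coeFn_toL2⟩

/-- The criterion behind the nontrivial memberships in `jetSpace`. The angular component needs its
own convergence: its coefficients are unbounded, so convergence in H¹ does not imply it. -/
theorem mem_jetSpace_of_tendsto {G : Fin 4 → Plane → ℝ} (hG : ∀ j, MemLp (G j) 2 halfVolume)
    {φ : ℕ → Plane → ℝ} (hφ : ∀ n, IsTestFunction (φ n))
    (hlim : ∀ j, Tendsto (fun n => eLpNorm (fun x => jet (φ n) j x - G j x) 2 halfVolume) atTop
      (𝓝 0)) : (fun j => (hG j).toLp) ∈ jetSpace := by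
  refine isClosed_jetSpace.mem_of_tendsto (b := atTop) (f := fun n => (hφ n).toL2) ?_
    (Eventually.of_forall fun n => (hφ n).toL2_mem)
  refine tendsto_pi_nhds.2 fun j => ?_
  exact (Lp.tendsto_Lp_iff_tendsto_eLpNorm'' _ (fun n => ((hφ n).jet j).memLp 2) _ (hG j)).2 (hlim j)

/-- Elements of the jet space are limits of jets of test functions, in `L²` and almost
everywhere. -/
theorem exists_seq_of_mem_jetSpace {U : Fin 4 → HalfL2} (hU : U ∈ jetSpace) :
    ∃ (φ : ℕ → Plane → ℝ) (hφ : ∀ n, IsTestFunction (φ n)),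
      Tendsto (fun n => (hφ n).toL2) atTop (𝓝 U) ∧
      (∀ j, Tendsto (fun n => eLpNorm (fun x => jet (φ n) j x - U j x) 2 halfVolume) atTop (𝓝 0)) ∧
      ∀ j, ∀ᵐ x ∂halfVolume, Tendsto (fun n => jet (φ n) j x) atTop (𝓝 (U j x)) := by
  obtain ⟨V, hV, hlim⟩ := mem_closure_iff_seq_limit.1 hU
  choose φ hφ hφV using hV
  have hVφ : ∀ n, V n = (hφ n).toL2 := fun n => funext fun j =>
    Lp.ext ((hφV n j).trans ((hφ n).coeFn_toL2 j).symm)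
  have hlim2 : Tendsto (fun n => (hφ n).toL2) atTop (𝓝 U) := by
    simpa only [← hVφ] using hlim
  have hj : ∀ j, Tendsto (fun n => eLpNorm (fun x => jet (φ n) j x - U j x) 2 halfVolume)
      atTop (𝓝 0) := by
    intro j
    have := (Lp.tendsto_Lp_iff_tendsto_eLpNorm' _ _).1 ((tendsto_pi_nhds.1 hlim2) j)
    refine this.congr fun n => eLpNorm_congr_ae ?_
    filter_upwards [(hφ n).coeFn_toL2 j] with x hx
    rw [Pi.sub_apply, hx]
  obtain ⟨ns, hns, hae⟩ := exists_subseq_ae_tendsto (μ := halfVolume) Finset.univ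
    (f := fun n j => jet (φ n) j) (g := fun j => U j) fun j =>
      tendstoInMeasure_of_tendsto_eLpNorm (p := 2) (by norm_num)
        (fun n => (((hφ n).jet j).memLp 2).1) (Lp.memLp (U j)).1 (hj j)
  exact ⟨fun n => φ (ns n), fun n => hφ (ns n), hlim2.comp hns.tendsto_atTop,
    fun j => (hj j).comp hns.tendsto_atTop, fun j => hae j (Finset.mem_univ j)⟩

theorem inner_halfL2 (F G : HalfL2) : inner ℝ F G = ∫ x, F x * G x ∂halfVolume := by
  rw [L2.inner_def]
  refine integral_congr_ae (Eventually.of_forall fun x => ?_)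
  simp [mul_comm]

/-- Because x₁ and x₂ are unbounded, the identity is passed to the limit pointwise almost everywhere
rather than in L². -/
theorem angular_eq_of_mem_jetSpace {U : Fin 4 → HalfL2} (hU : U ∈ jetSpace) :
    ∀ᵐ x ∂halfVolume, U 3 x = x 0 * U 2 x - x 1 * U 1 x := by
  obtain ⟨φ, hφ, -, -, hae⟩ := exists_seq_of_mem_jetSpace hU
  filter_upwards [hae 1, hae 2, hae 3] with x h1 h2 h3
  exact tendsto_nhds_unique h3 ((h2.const_mul _).sub (h1.const_mul _))

/-! ### Uniqueness of weak derivatives and the description of `H⁺` -/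

theorem locallyIntegrableOn_of_memLp {u : Plane → ℝ} (hu : MemLp u 2 halfVolume) :
    LocallyIntegrableOn u halfPlane :=
  locallyIntegrableOn_of_locallyIntegrable_restrict (hu.locallyIntegrable (by norm_num))

theorem IsWeakPartial.ae_eq {i : Fin 2} {u g h : Plane → ℝ} (hg : IsWeakPartial i u g)
    (hh : IsWeakPartial i u h) : g =ᵐ[halfVolume] h := by
  have key := isOpen_halfPlane.ae_eq_zero_of_integral_contDiff_smul_eq_zero (μ := volume)
    (f := fun x => g x - h x) (hg.2.1.sub hh.2.1) ?_
  · rw [EventuallyEq, halfVolume, ae_restrict_iff' measurableSet_halfPlane]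
    filter_upwards [key] with x hx hm
    exact sub_eq_zero.1 (hx hm)
  · intro φ h1 h2 h3
    have hφ : IsTestFunction φ := ⟨h1, h2, h3⟩
    have e1 := hg.2.2 φ hφ
    rw [hh.2.2 φ hφ, neg_inj] at e1
    have hint : ∀ f : Plane → ℝ, LocallyIntegrableOn f halfPlane →
        Integrable (fun x => f x * φ x) halfVolume := by
      intro f hf
      have : IntegrableOn (fun x => φ x * f x) (tsupport φ) := by
        refine IntegrableOn.continuousOn_mul h1.continuous.continuousOn ?_ h2
        exact hf.integrableOn_compact_subset h3 h2
      have h4 : Integrable (fun x => φ x * f x) volume := by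
        rw [← integrableOn_univ]
        refine this.of_forall_sdiff_eq_zero MeasurableSet.univ fun x hx => ?_
        rw [image_eq_zero_of_notMem_tsupport hx.2, zero_mul]
      exact (h4.congr (Eventually.of_forall fun x => mul_comm _ _)).restrict
    have e2 : ∫ x, (g x * φ x - h x * φ x) ∂halfVolume = 0 := by
      rw [integral_sub (hint g hg.2.1) (hint h hh.2.1), e1, sub_self]
    rw [← e2]
    symm
    refine (setIntegral_eq_integral_of_forall_compl_eq_zero fun x hx => ?_).trans ?_
    · rw [hφ.eq_zero hx]; ring
    · refine integral_congr_ae (Eventually.of_forall fun x => ?_)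
      simp only [smul_eq_mul]; ring

theorem IsWeakPartial.weakPartial_ae_eq {i : Fin 2} {u g : Plane → ℝ} (hg : IsWeakPartial i u g) :
    weakPartial i u =ᵐ[halfVolume] g := by
  have h : ∃ g, IsWeakPartial i u g := ⟨g, hg⟩
  rw [weakPartial, dif_pos h]
  exact h.choose_spec.ae_eq hg

/-- `U` is the jet of `u`. -/
structure IsJet (u : Plane → ℝ) (U : Fin 4 → HalfL2) : Prop where
  mem : U ∈ jetSpace
  ae_eq : u =ᵐ[halfVolume] U 0

theorem isJet_self {U : Fin 4 → HalfL2} (hU : U ∈ jetSpace) : IsJet (U 0) U := ⟨hU, EventuallyEq.rfl⟩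

namespace IsJet

variable {u v : Plane → ℝ} {U V : Fin 4 → HalfL2}

theorem memLp (h : IsJet u U) : MemLp u 2 halfVolume := (memLp_congr_ae h.ae_eq).2 (Lp.memLp _)

/-- Both sides of the integration by parts formula are L² inner products with a fixed test function,
hence continuous on the closure. -/
theorem isWeakPartial (h : IsJet u U) (i : Fin 2) : IsWeakPartial i u (U (gradIdx i)) := by
  refine ⟨locallyIntegrableOn_of_memLp h.memLp, locallyIntegrableOn_of_memLp (Lp.memLp _),
    fun ψ hψ => ?_⟩
  obtain ⟨φ, hφ, hlim, -, -⟩ := exists_seq_of_mem_jetSpace h.mem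
  have h1 : Tendsto (fun n => inner ℝ ((hφ n).toL2 0) (hψ.toL2 (gradIdx i))) atTop
      (𝓝 (inner ℝ (U 0) (hψ.toL2 (gradIdx i)))) :=
    ((tendsto_pi_nhds.1 hlim) 0).inner tendsto_const_nhds
  have h2 : Tendsto (fun n => inner ℝ ((hφ n).toL2 (gradIdx i)) (hψ.toL2 0)) atTop
      (𝓝 (inner ℝ (U (gradIdx i)) (hψ.toL2 0))) :=
    ((tendsto_pi_nhds.1 hlim) (gradIdx i)).inner tendsto_const_nhds
  have h3 : ∀ n, inner ℝ ((hφ n).toL2 0) (hψ.toL2 (gradIdx i))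
      = - inner ℝ ((hφ n).toL2 (gradIdx i)) (hψ.toL2 0) := by
    intro n
    rw [inner_halfL2, inner_halfL2]
    refine (integral_congr_ae ?_).trans
      (((hφ n).integral_mul_partialDeriv hψ i).trans (congrArg Neg.neg (integral_congr_ae ?_)))
    · filter_upwards [(hφ n).coeFn_toL2 0, hψ.coeFn_toL2 (gradIdx i)] with x e1 e2
      rw [e1, e2, jet_gradIdx]; rfl
    · filter_upwards [(hφ n).coeFn_toL2 (gradIdx i), hψ.coeFn_toL2 0] with x e1 e2
      rw [e1, e2, jet_gradIdx]; rfl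
  have h4 := tendsto_nhds_unique (h1.congr h3) h2.neg
  rw [inner_halfL2, inner_halfL2] at h4
  refine (integral_congr_ae ?_).trans (h4.trans (congrArg Neg.neg (integral_congr_ae ?_)))
  · filter_upwards [h.ae_eq, hψ.coeFn_toL2 (gradIdx i)] with x e1 e2
    rw [e1, e2, jet_gradIdx]
  · filter_upwards [hψ.coeFn_toL2 0] with x e2
    rw [e2]; rfl

theorem weakPartial_zero (h : IsJet u U) : weakPartial 0 u =ᵐ[halfVolume] U 1 :=
  (h.isWeakPartial 0).weakPartial_ae_eq

theorem weakPartial_one (h : IsJet u U) : weakPartial 1 u =ᵐ[halfVolume] U 2 :=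
  (h.isWeakPartial 1).weakPartial_ae_eq

theorem angularDeriv (h : IsJet u U) : angularDeriv u =ᵐ[halfVolume] U 3 := by
  filter_upwards [h.weakPartial_zero, h.weakPartial_one, angular_eq_of_mem_jetSpace h.mem]
    with x h1 h2 h3
  rw [HalfPlaneNLS.angularDeriv, h1, h2, h3]

/-- The easy half of the identification of H⁺ with `jetSpace`; the other half is
`exists_isJet_of_memHPlus`. -/
theorem memHPlus (h : IsJet u U) : MemHPlus u := by
  have hw : ∀ i, weakPartial i u =ᵐ[halfVolume] U (gradIdx i) :=
    fun i => (h.isWeakPartial i).weakPartial_ae_eq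
  refine ⟨⟨⟨h.memLp, fun i => ⟨⟨_, h.isWeakPartial i⟩, (memLp_congr_ae (hw i)).2 (Lp.memLp _)⟩⟩, ?_⟩,
    (memLp_congr_ae h.angularDeriv).2 (Lp.memLp _)⟩
  obtain ⟨φ, hφ, -, hlim, -⟩ := exists_seq_of_mem_jetSpace h.mem
  refine ⟨φ, hφ, (hlim 0).congr fun n => eLpNorm_congr_ae ?_,
    fun i => (hlim (gradIdx i)).congr fun n => eLpNorm_congr_ae ?_⟩
  · filter_upwards [h.ae_eq] with x hx
    rw [hx]; rfl
  · filter_upwards [hw i] with x hx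
    rw [hx, jet_gradIdx]

theorem sub (h : IsJet u U) (h' : IsJet v V) : IsJet (fun x => u x - v x) (U - V) :=
  ⟨jetSpace.sub_mem h.mem h'.mem, by
    filter_upwards [h.ae_eq, h'.ae_eq, Lp.coeFn_sub (U 0) (V 0)] with x h1 h2 h3
    rw [Pi.sub_apply, h3, Pi.sub_apply, h1, h2]⟩

theorem const_mul (h : IsJet u U) (c : ℝ) : IsJet (fun x => c * u x) (c • U) :=
  ⟨jetSpace.smul_mem c h.mem, by
    filter_upwards [h.ae_eq, Lp.coeFn_smul c (U 0)] with x h1 h3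
    rw [Pi.smul_apply, h3, Pi.smul_apply, h1, smul_eq_mul]⟩

end IsJet

/-! ### Radial cutoffs: test functions are dense in `H⁺` -/

/-- A radial cutoff, equal to `1` on the unit ball. -/
noncomputable def radialCutoff (x : Plane) : ℝ := Real.smoothTransition (2 - ‖x‖ ^ 2)

theorem contDiff_radialCutoff : ContDiff ℝ ∞ radialCutoff :=
  Real.smoothTransition.contDiff.comp (contDiff_const.sub (contDiff_norm_sq ℝ))

theorem radialCutoff_eq_zero {x : Plane} (hx : 2 ≤ ‖x‖) : radialCutoff x = 0 :=
  Real.smoothTransition.zero_of_nonpos (by nlinarith)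

theorem radialCutoff_eq_one {x : Plane} (hx : ‖x‖ ≤ 1) : radialCutoff x = 1 :=
  Real.smoothTransition.one_of_one_le (by nlinarith [norm_nonneg x])

theorem hasCompactSupport_radialCutoff : HasCompactSupport radialCutoff :=
  HasCompactSupport.intro (isCompact_closedBall (0 : Plane) 2) fun x hx =>
    radialCutoff_eq_zero (by
      rw [Metric.mem_closedBall, dist_zero_right, not_le] at hx
      exact hx.le)

theorem abs_radialCutoff_le (x : Plane) : |radialCutoff x| ≤ 1 := by
  rw [radialCutoff, abs_of_nonneg (Real.smoothTransition.nonneg _)]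
  exact Real.smoothTransition.le_one _

/-- The cutoff is invariant under rotations, so multiplying by it produces no extra term in the
angular derivative. -/
theorem angular_radialCutoff (x : Plane) :
    x 0 * partialDeriv 1 radialCutoff x - x 1 * partialDeriv 0 radialCutoff x = 0 := by
  have h1 : HasFDerivAt (fun y : Plane => 2 - ‖y‖ ^ 2) (-(2 • innerSL ℝ x)) x :=
    ((hasStrictFDerivAt_norm_sq x).hasFDerivAt).const_sub 2
  have h2 : HasDerivAt Real.smoothTransition (deriv Real.smoothTransition (2 - ‖x‖ ^ 2))
      (2 - ‖x‖ ^ 2) :=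
    ((Real.smoothTransition.contDiff (n := 1)).differentiable (by simp) _).hasDerivAt
  have h3 := h2.comp_hasFDerivAt x h1
  have h4 : fderiv ℝ radialCutoff x = _ := h3.fderiv
  simp only [partialDeriv, h4]
  simp [EuclideanSpace.inner_single_right]
  ring

/-- The radial cutoff at scale `R`. -/
noncomputable def scaledCutoff (R : ℝ) (x : Plane) : ℝ := radialCutoff (R⁻¹ • x)

theorem contDiff_scaledCutoff (R : ℝ) : ContDiff ℝ ∞ (scaledCutoff R) :=
  contDiff_radialCutoff.comp (contDiff_const_smul _)

theorem abs_scaledCutoff_le (R : ℝ) (x : Plane) : |scaledCutoff R x| ≤ 1 := abs_radialCutoff_le _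

theorem partialDeriv_comp_smul (φ : Plane → ℝ) (c : ℝ) (i : Fin 2)
    (x : Plane) : partialDeriv i (fun x => φ (c • x)) x = c * partialDeriv i φ (c • x) := by
  simp only [partialDeriv]
  rw [fderiv_comp_smul]
  simp

theorem partialDeriv_scaledCutoff (R : ℝ) (i : Fin 2) (x : Plane) :
    partialDeriv i (scaledCutoff R) x = R⁻¹ * partialDeriv i radialCutoff (R⁻¹ • x) :=
  partialDeriv_comp_smul _ _ _ _

theorem angular_scaledCutoff (R : ℝ) (x : Plane) :
    x 0 * partialDeriv 1 (scaledCutoff R) x - x 1 * partialDeriv 0 (scaledCutoff R) x = 0 := by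
  rw [partialDeriv_scaledCutoff, partialDeriv_scaledCutoff]
  have := angular_radialCutoff (R⁻¹ • x)
  simp only [PiLp.smul_apply, smul_eq_mul] at this
  linear_combination this

theorem exists_bound_partialDeriv_radialCutoff :
    ∃ C, 0 ≤ C ∧ ∀ i x, |partialDeriv i radialCutoff x| ≤ C := by
  have h1 : Continuous (fderiv ℝ radialCutoff) :=
    (contDiff_radialCutoff.fderiv_right (m := ∞) (by simp)).continuous
  obtain ⟨C, hC⟩ := (hasCompactSupport_radialCutoff.fderiv ℝ).exists_bound_of_continuous h1
  refine ⟨C, (norm_nonneg _).trans (hC 0), fun i x => ?_⟩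
  refine ((fderiv ℝ radialCutoff x).le_opNorm _).trans ?_
  simpa using hC x

theorem scaledCutoff_eq_zero {R : ℝ} (hR : 0 < R) {x : Plane} (hx : 2 * R ≤ ‖x‖) :
    scaledCutoff R x = 0 := by
  refine radialCutoff_eq_zero ?_
  rw [norm_smul, norm_inv, Real.norm_of_nonneg hR.le, inv_mul_eq_div, le_div_iff₀ hR]
  exact hx

theorem tendsto_scaledCutoff (x : Plane) :
    Tendsto (fun n : ℕ => scaledCutoff (n + 1) x) atTop (𝓝 1) := by
  refine tendsto_const_nhds.congr' ?_
  obtain ⟨N, hN⟩ := exists_nat_ge ‖x‖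
  filter_upwards [eventually_ge_atTop N] with n hn
  refine (radialCutoff_eq_one ?_).symm
  have hn' : (N : ℝ) ≤ n := by exact_mod_cast hn
  rw [norm_smul, norm_inv, Real.norm_of_nonneg (by positivity), inv_mul_eq_div,
    div_le_one (by positivity)]
  linarith

theorem abs_coord_le_norm (x : Plane) (i : Fin 2) : |x i| ≤ ‖x‖ := by
  simpa using PiLp.norm_apply_le x i

/-- The approximating test functions φₘ converge in H¹ only, and nothing is known about ∂_θ φₘ. For
a fixed radial cutoff χₙ the coefficients of ∂_θ are bounded on the support, so χₙ φₘ → χₙ u in all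
four components as m → ∞. Since ∂_θ (χₙ u) = χₙ ∂_θ u, dominated convergence then removes the
cutoff. -/
theorem exists_isJet_of_memHPlus {u : Plane → ℝ} (hu : MemHPlus u) : ∃ U, IsJet u U := by
  obtain ⟨⟨⟨hu2, hw⟩, φ, hφ, hφu, hφw⟩, hθ⟩ := hu
  obtain ⟨C, hC0, hC⟩ := exists_bound_partialDeriv_radialCutoff
  have hw2 : ∀ i, MemLp (weakPartial i u) 2 halfVolume := fun i => (hw i).2
  let χ : ℕ → Plane → ℝ := fun n => scaledCutoff (n + 1)
  have hχ : ∀ n, ContDiff ℝ ∞ (χ n) := fun n => contDiff_scaledCutoff _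
  have hχ1 : ∀ n x, |χ n x| ≤ 1 := fun n x => abs_scaledCutoff_le _ x
  have hχm : ∀ n, AEStronglyMeasurable (χ n) halfVolume :=
    fun n => (hχ n).continuous.aestronglyMeasurable
  have hdχ : ∀ n i x, |partialDeriv i (χ n) x| ≤ ((n : ℝ) + 1)⁻¹ * C := by
    intro n i x
    rw [partialDeriv_scaledCutoff, abs_mul, abs_of_nonneg (by positivity : (0 : ℝ) ≤ ((n : ℝ) + 1)⁻¹)]
    exact mul_le_mul_of_nonneg_left (hC i _) (by positivity)
  have hdχC : ∀ n i x, |partialDeriv i (χ n) x| ≤ C := fun n i x =>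
    (hdχ n i x).trans (mul_le_of_le_one_left hC0 (inv_le_one_of_one_le₀ (by linarith [n.cast_nonneg (α := ℝ)])))
  have hdχm : ∀ n i, AEStronglyMeasurable (partialDeriv i (χ n)) halfVolume := fun n i =>
    (((hχ n).fderiv_right (m := ∞) (by simp)).clm_apply contDiff_const).continuous.aestronglyMeasurable
  -- the jet of `χ n * u`
  let G : ℕ → Fin 4 → Plane → ℝ := fun n =>
    ![fun x => χ n x * u x,
      fun x => χ n x * weakPartial 0 u x + u x * partialDeriv 0 (χ n) x,
      fun x => χ n x * weakPartial 1 u x + u x * partialDeriv 1 (χ n) x,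
      fun x => χ n x * angularDeriv u x]
  let G' : Fin 4 → Plane → ℝ := ![u, weakPartial 0 u, weakPartial 1 u, angularDeriv u]
  have hmul : ∀ (n : ℕ) {f : Plane → ℝ}, MemLp f 2 halfVolume →
      MemLp (fun x => χ n x * f x) 2 halfVolume := fun n f hf =>
    hf.of_le ((hχm n).mul hf.1) (Eventually.of_forall fun x => by
      rw [norm_mul]; exact mul_le_of_le_one_left (norm_nonneg _) (hχ1 n x))
  have hmul' : ∀ (n : ℕ) (i : Fin 2), MemLp (fun x => u x * partialDeriv i (χ n) x) 2 halfVolume :=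
    fun n i => hu2.of_le_mul (c := C) (hu2.1.mul (hdχm n i)) (Eventually.of_forall fun x => by
      rw [norm_mul, mul_comm]
      exact mul_le_mul_of_nonneg_right (hdχC n i x) (norm_nonneg _))
  have hG : ∀ n j, MemLp (G n j) 2 halfVolume := by
    intro n j
    fin_cases j
    · exact hmul n hu2
    · exact (hmul n (hw2 0)).add (hmul' n 0)
    · exact (hmul n (hw2 1)).add (hmul' n 1)
    · exact hmul n hθ
  have hG' : ∀ j, MemLp (G' j) 2 halfVolume := by
    intro j
    fin_cases j
    · exact hu2
    · exact hw2 0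
    · exact hw2 1
    · exact hθ
  have hdφm : ∀ m i, AEStronglyMeasurable (fun x => partialDeriv i (φ m) x - weakPartial i u x)
      halfVolume := fun m i => (((hφ m).partialDeriv i).memLp 2).1.sub (hw2 i).1
  have hφm : ∀ m, AEStronglyMeasurable (fun x => φ m x - u x) halfVolume := fun m =>
    ((hφ m).memLp 2).1.sub hu2.1
  have hjet : ∀ n m x, (∀ i, partialDeriv i (fun x => χ n x * φ m x) x
      = χ n x * partialDeriv i (φ m) x + φ m x * partialDeriv i (χ n) x) := fun n m x i =>
    partialDeriv_mul ((hχ n).differentiable (by simp)) (hφ m).differentiable i x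
  have step : ∀ n, (fun j => (hG n j).toLp) ∈ jetSpace := by
    intro n
    refine mem_jetSpace_of_tendsto (hG n) (φ := fun m x => χ n x * φ m x)
      (fun m => (hφ m).mul_left (hχ n)) fun j => ?_
    have hgrad : ∀ i, Tendsto (fun m => eLpNorm (fun x => partialDeriv i (fun x => χ n x * φ m x) x -
        (χ n x * weakPartial i u x + u x * partialDeriv i (χ n) x)) 2 halfVolume) atTop (𝓝 0) := by
      intro i
      refine tendsto_eLpNorm_zero_of_le (C := 1 + C) (by positivity) (hdφm · i) hφm
        (fun m => Eventually.of_forall fun x => ?_) (hφw i) hφu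
      rw [hjet, show χ n x * partialDeriv i (φ m) x + φ m x * partialDeriv i (χ n) x -
        (χ n x * weakPartial i u x + u x * partialDeriv i (χ n) x) =
        χ n x * (partialDeriv i (φ m) x - weakPartial i u x) +
        partialDeriv i (χ n) x * (φ m x - u x) by ring]
      refine (abs_add_le _ _).trans ?_
      rw [abs_mul, abs_mul, mul_add]
      gcongr
      · linarith [hχ1 n x]
      · linarith [hdχC n i x]
    fin_cases j
    · refine tendsto_eLpNorm_zero_of_le (C := 1) (by positivity) hφm hφm
        (fun m => Eventually.of_forall fun x => ?_) hφu hφu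
      change |χ n x * φ m x - χ n x * u x| ≤ _
      rw [← mul_sub, abs_mul]
      nlinarith [hχ1 n x, abs_nonneg (φ m x - u x), abs_nonneg (χ n x)]
    · exact hgrad 0
    · exact hgrad 1
    · refine tendsto_eLpNorm_zero_of_le (C := 2 * (n + 1)) (by positivity) (hdφm · 1) (hdφm · 0)
        (fun m => Eventually.of_forall fun x => ?_) (hφw 1) (hφw 0)
      change |x 0 * partialDeriv 1 (fun x => χ n x * φ m x) x
        - x 1 * partialDeriv 0 (fun x => χ n x * φ m x) x - χ n x * angularDeriv u x| ≤ _
      have e : x 0 * partialDeriv 1 (fun x => χ n x * φ m x) x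
        - x 1 * partialDeriv 0 (fun x => χ n x * φ m x) x - χ n x * angularDeriv u x
        = (χ n x * x 0) * (partialDeriv 1 (φ m) x - weakPartial 1 u x)
          - (χ n x * x 1) * (partialDeriv 0 (φ m) x - weakPartial 0 u x) := by
        rw [hjet, hjet, angularDeriv]
        have := angular_scaledCutoff ((n : ℝ) + 1) x
        linear_combination φ m x * this
      -- The cutoff at scale n + 1 vanishes for |x| ≥ 2 (n + 1), which bounds the coefficients of
      -- ∂_θ.
      have hb : ∀ i, |χ n x * x i| ≤ 2 * ((n : ℝ) + 1) := by
        intro i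
        rcases le_total (2 * ((n : ℝ) + 1)) ‖x‖ with h | h
        · have : χ n x = 0 := scaledCutoff_eq_zero (by positivity) h
          rw [this, zero_mul, abs_zero]; positivity
        · rw [abs_mul]
          have h1 := abs_coord_le_norm x i
          nlinarith [hχ1 n x, abs_nonneg (x i), abs_nonneg (χ n x)]
      rw [e]
      refine (abs_sub _ _).trans ?_
      rw [abs_mul, abs_mul (χ n x * x 1), mul_add]
      gcongr
      · exact hb 0
      · exact hb 1
  have hmem : (fun j => (hG' j).toLp) ∈ jetSpace := by
    refine isClosed_jetSpace.mem_of_tendsto (b := atTop) (f := fun n j => (hG n j).toLp) ?_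
      (Eventually.of_forall step)
    refine tendsto_pi_nhds.2 fun j => ?_
    refine (Lp.tendsto_Lp_iff_tendsto_eLpNorm'' _ (hG · j) _ (hG' j)).2 ?_
    have hbase : ∀ f : Plane → ℝ, MemLp f 2 halfVolume →
        Tendsto (fun n => eLpNorm (fun x => χ n x * f x - f x) 2 halfVolume) atTop (𝓝 0) := by
      intro f hf
      refine tendsto_eLpNorm_zero_of_dominated (g := fun x => 2 * f x)
        (fun n => (hmul n hf).1.sub hf.1) (hf.const_mul 2) (fun n => Eventually.of_forall fun x => ?_)
        (Eventually.of_forall fun x => ?_)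
      · rw [← sub_one_mul, abs_mul, abs_mul, abs_two]
        refine mul_le_mul_of_nonneg_right ?_ (abs_nonneg _)
        have := abs_le.1 (hχ1 n x)
        rw [abs_le]; constructor <;> linarith
      · simpa using ((tendsto_scaledCutoff x).mul_const (f x)).sub_const (f x)
    have hgrad : ∀ i, Tendsto (fun n => eLpNorm (fun x => χ n x * weakPartial i u x +
        u x * partialDeriv i (χ n) x - weakPartial i u x) 2 halfVolume) atTop (𝓝 0) := by
      intro i
      refine tendsto_eLpNorm_zero_of_le (C := 1) (by positivity)
        (fun n => (hmul n (hw2 i)).1.sub (hw2 i).1) (fun n => (hmul' n i).1)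
        (fun n => Eventually.of_forall fun x => ?_) (hbase _ (hw2 i)) ?_
      · rw [one_mul]
        refine le_trans (le_of_eq ?_) (abs_add_le _ _)
        congr 1
        change _ = χ n x * weakPartial i u x - weakPartial i u x + u x * partialDeriv i (χ n) x
        ring
      · refine tendsto_eLpNorm_zero_of_dominated (g := fun x => C * u x)
          (fun n => (hmul' n i).1) (hu2.const_mul C) (fun n => Eventually.of_forall fun x => ?_)
          (Eventually.of_forall fun x => ?_)
        · rw [abs_mul, abs_mul, abs_of_nonneg hC0, mul_comm]
          exact mul_le_mul_of_nonneg_right (hdχC n i x) (abs_nonneg _)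
        -- The gradient of the cutoff is of order 1/(n + 1), so the commutator term u ∂ᵢχₙ
        -- disappears.
        · have h1 : Tendsto (fun n : ℕ => ((n : ℝ) + 1)⁻¹ * C) atTop (𝓝 0) := by
            have := (tendsto_one_div_add_atTop_nhds_zero_nat (𝕜 := ℝ)).mul_const C
            simpa using this
          have h2 : Tendsto (fun n => partialDeriv i (χ n) x) atTop (𝓝 0) :=
            squeeze_zero_norm (fun n => hdχ n i x) h1
          simpa using h2.const_mul (u x)
    fin_cases j
    · exact hbase u hu2
    · exact hgrad 0
    · exact hgrad 1
    · exact hbase _ hθ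
  exact ⟨_, hmem, (MemLp.coeFn_toLp (hG' 0)).symm⟩

/-! ### The quadratic form on jets -/

/-- The scalar product `⟨u,v⟩_{λ,q}` in terms of jets. -/
noncomputable def jetForm (lam q : ℝ) (U V : Fin 4 → HalfL2) : ℝ :=
  inner ℝ (U 1) (V 1) + inner ℝ (U 2) (V 2) + 1 / lam ^ 2 * inner ℝ (U 3) (V 3)
    + q * inner ℝ (U 0) (V 0)

theorem integrable_mul_halfL2 (F G : HalfL2) : Integrable (fun x => F x * G x) halfVolume :=
  (Lp.memLp F).integrable_mul (Lp.memLp G)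

theorem IsJet.form_eq {u v : Plane → ℝ} {U V : Fin 4 → HalfL2} (h : IsJet u U) (h' : IsJet v V)
    (lam q : ℝ) : form lam q u v = jetForm lam q U V := by
  have e1 : Integrable (fun x => U 1 x * V 1 x + U 2 x * V 2 x) halfVolume :=
    (integrable_mul_halfL2 _ _).add (integrable_mul_halfL2 _ _)
  have e2 : Integrable (fun x => U 1 x * V 1 x + U 2 x * V 2 x + 1 / lam ^ 2 * (U 3 x * V 3 x))
      halfVolume := e1.add ((integrable_mul_halfL2 _ _).const_mul _)
  simp only [jetForm, inner_halfL2]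
  rw [← integral_const_mul, ← integral_const_mul,
    ← integral_add (integrable_mul_halfL2 _ _) (integrable_mul_halfL2 _ _),
    ← integral_add e1 ((integrable_mul_halfL2 _ _).const_mul _),
    ← integral_add e2 ((integrable_mul_halfL2 _ _).const_mul _)]
  refine integral_congr_ae ?_
  filter_upwards [h.weakPartial_zero, h'.weakPartial_zero, h.weakPartial_one, h'.weakPartial_one,
    h.angularDeriv, h'.angularDeriv, h.ae_eq, h'.ae_eq] with x h1 h2 h3 h4 h5 h6 h7 h8
  rw [h1, h2, h3, h4, h5, h6, h7, h8]

theorem jetForm_comm (lam q : ℝ) (U V : Fin 4 → HalfL2) : jetForm lam q U V = jetForm lam q V U := by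
  simp only [jetForm, real_inner_comm]

theorem jetForm_add_self (lam q : ℝ) (U V : Fin 4 → HalfL2) :
    jetForm lam q (U + V) (U + V) = jetForm lam q U U + 2 * jetForm lam q U V + jetForm lam q V V := by
  simp only [jetForm, Pi.add_apply, inner_add_left, inner_add_right, real_inner_comm]
  rw [real_inner_comm (U 1), real_inner_comm (U 2), real_inner_comm (U 3), real_inner_comm (U 0)]
  ring

theorem jetForm_smul_right (lam q c : ℝ) (U V : Fin 4 → HalfL2) :
    jetForm lam q U (c • V) = c * jetForm lam q U V := by
  simp only [jetForm, Pi.smul_apply, inner_smul_right]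
  ring

theorem jetForm_smul_self (lam q c : ℝ) (U : Fin 4 → HalfL2) :
    jetForm lam q (c • U) (c • U) = c ^ 2 * jetForm lam q U U := by
  simp only [jetForm, Pi.smul_apply, inner_smul_right, real_inner_smul_left]
  ring

theorem jetForm_parallelogram (lam q : ℝ) (U V : Fin 4 → HalfL2) :
    jetForm lam q (U - V) (U - V)
      = 2 * jetForm lam q U U + 2 * jetForm lam q V V - jetForm lam q (U + V) (U + V) := by
  have h := jetForm_add_self lam q U ((-1 : ℝ) • V)
  rw [jetForm_smul_self, jetForm_smul_right, neg_one_smul, ← sub_eq_add_neg] at h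
  rw [h, jetForm_add_self]
  ring

theorem jetForm_self (lam q : ℝ) (U : Fin 4 → HalfL2) :
    jetForm lam q U U = ‖U 1‖ ^ 2 + ‖U 2‖ ^ 2 + 1 / lam ^ 2 * ‖U 3‖ ^ 2 + q * ‖U 0‖ ^ 2 := by
  simp only [jetForm, real_inner_self_eq_norm_sq]

theorem jetForm_self_nonneg (lam : ℝ) {q : ℝ} (hq : 0 ≤ q) (U : Fin 4 → HalfL2) :
    0 ≤ jetForm lam q U U := by
  rw [jetForm_self]; positivity

@[fun_prop]
theorem continuous_jetForm (lam q : ℝ) :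
    Continuous (fun P : (Fin 4 → HalfL2) × (Fin 4 → HalfL2) => jetForm lam q P.1 P.2) := by
  unfold jetForm
  fun_prop

/-! ### Inequalities for test functions -/

theorem lintegral_mul_sq_le {α : Type*} [MeasurableSpace α] {μ : Measure α} {f g : α → ℝ≥0∞}
    (hf : AEMeasurable f μ) (hg : AEMeasurable g μ) :
    (∫⁻ x, f x * g x ∂μ) ^ 2 ≤ (∫⁻ x, f x ^ 2 ∂μ) * ∫⁻ x, g x ^ 2 ∂μ := by
  have h := ENNReal.lintegral_mul_le_Lp_mul_Lq μ Real.HolderConjugate.two_two hf hg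
  have h2 := pow_le_pow_left' h 2
  refine h2.trans (le_of_eq ?_)
  rw [mul_pow, ← ENNReal.rpow_natCast, ← ENNReal.rpow_natCast, ← ENNReal.rpow_mul,
    ← ENNReal.rpow_mul]
  simp

theorem IsTestFunction.lintegral_half {φ : Plane → ℝ} (h : IsTestFunction φ)
    {F : Plane → ℝ≥0∞} (hF : ∀ x, φ x = 0 → F x = 0) :
    ∫⁻ x, F x ∂halfVolume = ∫⁻ x, F x := by
  rw [halfVolume, ← lintegral_indicator measurableSet_halfPlane]
  congr 1
  ext x
  by_cases hx : x ∈ halfPlane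
  · rw [Set.indicator_of_mem hx]
  · rw [Set.indicator_of_notMem hx, hF x (h.eq_zero hx)]

theorem lintegral_halfL2_sq (F : HalfL2) : ∫⁻ x, ‖F x‖ₑ ^ 2 ∂halfVolume = ‖F‖ₑ ^ 2 := by
  rw [← eLpNorm_two_sq, Lp.enorm_def]

theorem IsTestFunction.lintegral_jet_sq {φ : Plane → ℝ} (h : IsTestFunction φ) (j : Fin 4) :
    ∫⁻ x, ‖HalfPlaneNLS.jet φ j x‖ₑ ^ 2 = ‖h.toL2 j‖ₑ ^ 2 := by
  rw [← lintegral_halfL2_sq, ← (h.jet j).lintegral_half (by simp +contextual)]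
  refine lintegral_congr_ae ?_
  filter_upwards [h.coeFn_toL2 j] with x hx
  rw [hx]

theorem enorm_apply_le (U : Fin 4 → HalfL2) (j : Fin 4) : ‖U j‖ₑ ≤ ‖U‖ₑ :=
  enorm_le_iff_norm_le.2 (norm_le_pi_norm U j)

theorem IsTestFunction.lintegral_jet_sq_le {φ : Plane → ℝ} (h : IsTestFunction φ) (j : Fin 4) :
    ∫⁻ x, ‖HalfPlaneNLS.jet φ j x‖ₑ ^ 2 ≤ ‖h.toL2‖ₑ ^ 2 := by
  rw [h.lintegral_jet_sq]
  gcongr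
  exact enorm_apply_le _ _

theorem single_eq_basis (x : Plane) :
    x = x 0 • EuclideanSpace.single 0 (1 : ℝ) + x 1 • EuclideanSpace.single 1 (1 : ℝ) := by
  ext i
  fin_cases i <;> simp

theorem fderiv_apply_eq (φ : Plane → ℝ) (x v : Plane) :
    fderiv ℝ φ x v = v 0 * partialDeriv 0 φ x + v 1 * partialDeriv 1 φ x := by
  conv_lhs => rw [single_eq_basis v]
  simp [partialDeriv]

theorem norm_fderiv_le (φ : Plane → ℝ) (x : Plane) :
    ‖fderiv ℝ φ x‖ ≤ ‖partialDeriv 0 φ x‖ + ‖partialDeriv 1 φ x‖ := by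
  refine ContinuousLinearMap.opNorm_le_bound _ (by positivity) fun v => ?_
  rw [fderiv_apply_eq, add_mul]
  refine (norm_add_le _ _).trans ?_
  rw [norm_mul, norm_mul]
  have h0 := abs_coord_le_norm v 0
  have h1 := abs_coord_le_norm v 1
  rw [mul_comm ‖v 0‖, mul_comm ‖v 1‖]
  simp only [Real.norm_eq_abs]
  gcongr

theorem IsTestFunction.lintegral_fderiv_sq_le {φ : Plane → ℝ} (h : IsTestFunction φ) :
    ∫⁻ x, ‖fderiv ℝ φ x‖ₑ ^ 2 ≤ 4 * ‖h.toL2‖ₑ ^ 2 := by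
  have hm : ∀ i, Measurable fun x => ‖HalfPlaneNLS.partialDeriv i φ x‖ₑ ^ 2 := fun i =>
    ((h.partialDeriv i).continuous.measurable.enorm).pow_const 2
  calc ∫⁻ x, ‖fderiv ℝ φ x‖ₑ ^ 2
      ≤ ∫⁻ x, (2 * ‖HalfPlaneNLS.partialDeriv 0 φ x‖ₑ ^ 2
          + 2 * ‖HalfPlaneNLS.partialDeriv 1 φ x‖ₑ ^ 2) := by
        refine lintegral_mono fun x => ?_
        simp only [enorm_eq_nnnorm]
        norm_cast
        have h1 := norm_fderiv_le φ x
        rw [← NNReal.coe_le_coe]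
        push_cast
        nlinarith [norm_nonneg (fderiv ℝ φ x),
          sq_nonneg (‖HalfPlaneNLS.partialDeriv 0 φ x‖ - ‖HalfPlaneNLS.partialDeriv 1 φ x‖)]
    _ = 2 * (∫⁻ x, ‖HalfPlaneNLS.jet φ 1 x‖ₑ ^ 2) + 2 * ∫⁻ x, ‖HalfPlaneNLS.jet φ 2 x‖ₑ ^ 2 := by
        rw [lintegral_add_left ((hm 0).const_mul 2), lintegral_const_mul _ (hm 0),
          lintegral_const_mul _ (hm 1)]
        rfl
    _ ≤ 2 * ‖h.toL2‖ₑ ^ 2 + 2 * ‖h.toL2‖ₑ ^ 2 := by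
        gcongr <;> exact h.lintegral_jet_sq_le _
    _ = 4 * ‖h.toL2‖ₑ ^ 2 := by rw [← add_mul]; norm_num

/-- Induction on k. In the plane the Gagliardo–Nirenberg–Sobolev inequality bounds the L² norm by
the L¹ norm of the gradient. For φ^(k+2) that gradient is of size (k+2) |φ|^(k+1) |∇φ|, and
Cauchy–Schwarz leaves the integral of |φ|^(2(k+1)), which is the previous case. -/
theorem exists_lintegral_pow_le (k : ℕ) : ∃ C : ℝ≥0∞, C ≠ ⊤ ∧
    ∀ (φ : Plane → ℝ) (h : IsTestFunction φ),
      ∫⁻ x, ‖φ x‖ₑ ^ (2 * (k + 1)) ≤ C * ‖h.toL2‖ₑ ^ (2 * (k + 1)) := by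
  induction k with
  | zero => exact ⟨1, by simp, fun φ h => by simpa using! h.lintegral_jet_sq_le 0⟩
  | succ k ih =>
    obtain ⟨C, hC, ih⟩ := ih
    set K : ℝ≥0∞ := (lintegralPowLePowLIntegralFDerivConst (volume : Measure Plane) 2 : ℝ≥0∞)
    refine ⟨K * ((k + 2 : ℕ) ^ 2 * (C * 4)), ?_, fun φ h => ?_⟩
    · refine ENNReal.mul_ne_top ENNReal.coe_ne_top (ENNReal.mul_ne_top ?_
        (ENNReal.mul_ne_top hC (by norm_num)))
      exact ENNReal.pow_ne_top (ENNReal.natCast_ne_top _)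
    have hcd : ContDiff ℝ 1 (fun x => φ x ^ (k + 2)) := (h.1.pow _).of_le (by simp)
    have hcs : HasCompactSupport (fun x => φ x ^ (k + 2)) :=
      h.2.1.comp_left (g := fun t : ℝ => t ^ (k + 2)) (by simp)
    have hGN := lintegral_pow_le_pow_lintegral_fderiv (volume : Measure Plane) hcd hcs (p := 2)
      (by simpa using Real.HolderConjugate.two_two)
    have hfd : ∀ x, ‖fderiv ℝ (fun x => φ x ^ (k + 2)) x‖ₑ
        = (k + 2 : ℕ) * (‖φ x‖ₑ ^ (k + 1) * ‖fderiv ℝ φ x‖ₑ) := by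
      intro x
      have h1 := (h.differentiable x).hasFDerivAt.pow (k + 2)
      rw [h1.fderiv, enorm_smul]
      simp only [show k + 2 - 1 = k + 1 from rfl, nsmul_eq_mul, enorm_mul,
        enorm_pow]
      rw [mul_assoc]
      congr 1
      rw [Real.enorm_eq_ofReal (by positivity), ENNReal.ofReal_natCast]
    have hmφ : Measurable fun x => ‖φ x‖ₑ := h.continuous.measurable.enorm
    have hmd : Measurable fun x => ‖fderiv ℝ φ x‖ₑ :=
      (h.1.continuous_fderiv (by simp)).measurable.enorm
    simp only [hfd, ENNReal.rpow_two] at hGN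
    have hmm : Measurable fun x => ‖φ x‖ₑ ^ (k + 1) * ‖fderiv ℝ φ x‖ₑ := (hmφ.pow_const _).mul hmd
    rw [lintegral_const_mul _ hmm] at hGN
    calc ∫⁻ x, ‖φ x‖ₑ ^ (2 * (k + 1 + 1))
        = ∫⁻ x, ‖φ x ^ (k + 2)‖ₑ ^ 2 := by
          refine lintegral_congr fun x => ?_
          rw [enorm_pow, ← pow_mul]; congr 1; ring
      _ ≤ _ := hGN
      _ ≤ K * ((k + 2 : ℕ) ^ 2 * ((C * ‖h.toL2‖ₑ ^ (2 * (k + 1))) * (4 * ‖h.toL2‖ₑ ^ 2))) := by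
          rw [mul_pow]
          gcongr
          refine (lintegral_mul_sq_le (hmφ.pow_const _).aemeasurable hmd.aemeasurable).trans ?_
          gcongr
          · refine le_trans (le_of_eq (lintegral_congr fun x => ?_)) (ih φ h)
            rw [← pow_mul]; congr 1; ring
          · exact h.lintegral_fderiv_sq_le
      _ = _ := by ring

/-! #### Polar coordinates -/

/-- The point with polar coordinates `(r, θ)`. -/
noncomputable def polarPoint (r θ : ℝ) : Plane := !₂[r * Real.cos θ, r * Real.sin θ]

theorem continuous_polarPoint : Continuous fun p : ℝ × ℝ => polarPoint p.1 p.2 := by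
  unfold polarPoint; fun_prop

/-- Integration over the plane in Cartesian coordinates. -/
theorem lintegral_plane (F : Plane → ℝ≥0∞) : ∫⁻ x, F x = ∫⁻ p : ℝ × ℝ, F !₂[p.1, p.2] := by
  rw [← (EuclideanSpace.volume_preserving_symm_measurableEquiv_toLp (Fin 2)).symm.lintegral_comp_emb
    (MeasurableEquiv.measurableEmbedding _),
    ← (volume_preserving_finTwoArrow ℝ).symm.lintegral_comp_emb
    (MeasurableEquiv.measurableEmbedding _)]
  rfl

theorem lintegral_plane_polar {F : Plane → ℝ≥0∞} (hF : Measurable F) :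
    ∫⁻ x, F x = ∫⁻ r in Set.Ioi (0 : ℝ), ∫⁻ θ in Set.Ioo (-Real.pi) Real.pi,
      ENNReal.ofReal r * F (polarPoint r θ) := by
  rw [lintegral_plane, ← lintegral_comp_polarCoord_symm, polarCoord_target, Measure.volume_eq_prod,
    ← Measure.prod_restrict, lintegral_prod]
  · rfl
  · refine Measurable.aemeasurable ?_
    simp only [polarCoord_symm_apply, smul_eq_mul]
    exact (ENNReal.measurable_ofReal.comp measurable_fst).mul
      (hF.comp continuous_polarPoint.measurable)

theorem lintegral_plane_polar_swap {F : Plane → ℝ≥0∞} (hF : Measurable F) :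
    ∫⁻ x, F x = ∫⁻ θ in Set.Ioo (-Real.pi) Real.pi, ∫⁻ r in Set.Ioi (0 : ℝ),
      ENNReal.ofReal r * F (polarPoint r θ) := by
  rw [lintegral_plane_polar hF, lintegral_lintegral_swap]
  exact ((ENNReal.measurable_ofReal.comp measurable_fst).mul
      (hF.comp continuous_polarPoint.measurable)).aemeasurable

theorem hasDerivAt_plane {f g : ℝ → ℝ} {f' g' t : ℝ} (hf : HasDerivAt f f' t)
    (hg : HasDerivAt g g' t) : HasDerivAt (fun t => (!₂[f t, g t] : Plane)) !₂[f', g'] t := by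
  have e : ∀ a b : ℝ, (!₂[a, b] : Plane)
      = a • EuclideanSpace.single 0 (1 : ℝ) + b • EuclideanSpace.single 1 (1 : ℝ) :=
    fun a b => single_eq_basis !₂[a, b]
  simp only [e]
  exact (hf.smul_const _).fun_add (hg.smul_const _)

theorem hasDerivAt_polar_angle {φ : Plane → ℝ} (h : Differentiable ℝ φ) (r θ : ℝ) :
    HasDerivAt (fun θ => φ (polarPoint r θ)) (jet φ 3 (polarPoint r θ)) θ := by
  have h1 : HasDerivAt (fun θ => polarPoint r θ) !₂[r * -Real.sin θ, r * Real.cos θ] θ := by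
    refine hasDerivAt_plane (f := fun θ => r * Real.cos θ) (g := fun θ => r * Real.sin θ)
      ((Real.hasDerivAt_cos θ).const_mul r) ((Real.hasDerivAt_sin θ).const_mul r)
  have h2 := (h (polarPoint r θ)).hasFDerivAt.comp_hasDerivAt θ h1
  rw [fderiv_apply_eq] at h2
  refine h2.congr_deriv ?_
  simp [jet, polarPoint]
  ring

theorem hasDerivAt_polar_radius {φ : Plane → ℝ} (h : Differentiable ℝ φ) (r θ : ℝ) :
    HasDerivAt (fun r => φ (polarPoint r θ)) (Real.cos θ * partialDeriv 0 φ (polarPoint r θ)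
      + Real.sin θ * partialDeriv 1 φ (polarPoint r θ)) r := by
  have h1 : HasDerivAt (fun r => polarPoint r θ) !₂[Real.cos θ, Real.sin θ] r := by
    refine hasDerivAt_plane (f := fun r => r * Real.cos θ) (g := fun r => r * Real.sin θ) ?_ ?_
    · simpa using (hasDerivAt_id r).mul_const (Real.cos θ)
    · simpa using (hasDerivAt_id r).mul_const (Real.sin θ)
  have h2 := (h (polarPoint r θ)).hasFDerivAt.comp_hasDerivAt r h1
  rw [fderiv_apply_eq] at h2
  exact h2

/-- A function vanishing at the left end point is bounded by the integral of its derivative. -/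
theorem enorm_le_lintegral_deriv {f f' : ℝ → ℝ} (hf : ∀ t, HasDerivAt f (f' t) t)
    (hc : Continuous f') {a t : ℝ} (hat : a ≤ t) (h0 : f a = 0) {S : Set ℝ}
    (hS : Set.Ioc a t ≤ᵐ[volume] S) :
    ‖f t‖ₑ ≤ ∫⁻ s in S, ‖f' s‖ₑ := by
  have h1 : ∫ s in a..t, f' s = f t := by
    rw [intervalIntegral.integral_eq_sub_of_hasDerivAt (fun s _ => hf s) (hc.intervalIntegrable _ _),
      h0, sub_zero]
  rw [← h1, intervalIntegral.integral_of_le hat]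
  refine (enorm_integral_le_lintegral_enorm _).trans ?_
  exact lintegral_mono' (Measure.restrict_mono_ae hS) le_rfl

/-- The square of φ is integrated along the circle from the angle -π, where the point (-r, 0) lies
outside the half-plane. The right-hand side no longer depends on θ. -/
theorem lintegral_angular_bound {φ : Plane → ℝ} (h : IsTestFunction φ) {r θ : ℝ} (hr : 0 < r)
    (hθ : θ ∈ Set.Ioo (-Real.pi) Real.pi) :
    ‖φ (polarPoint r θ)‖ₑ ^ 2 ≤ ∫⁻ t in Set.Ioo (-Real.pi) Real.pi,
      2 * (‖φ (polarPoint r t)‖ₑ * ‖jet φ 3 (polarPoint r t)‖ₑ) := by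
  have hc : Continuous fun t => polarPoint r t := continuous_polarPoint.comp (f := fun t => (r, t)) (by fun_prop)
  have h0 : φ (polarPoint r (-Real.pi)) = 0 := h.eq_zero (by
    simp only [halfPlane, Set.mem_ofPred_eq, polarPoint]
    simp [hr.le])
  have := enorm_le_lintegral_deriv (f := fun t => φ (polarPoint r t) ^ 2)
    (f' := fun t => 2 * (φ (polarPoint r t) * jet φ 3 (polarPoint r t))) (fun t => by
      simpa [mul_assoc] using (hasDerivAt_polar_angle h.differentiable r t).fun_pow 2)
    (continuous_const.mul ((h.continuous.comp hc).mul ((h.jet 3).continuous.comp hc)))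
    hθ.1.le (by rw [h0]; ring) (S := Set.Ioo (-Real.pi) Real.pi)
    (LE.le.eventuallyLE fun s hs => ⟨hs.1, hs.2.trans_lt hθ.2⟩)
  have h2 : ‖(2 : ℝ)‖ₑ = 2 := by rw [Real.enorm_eq_ofReal (by norm_num)]; norm_num
  simpa [enorm_pow, enorm_mul, h2] using this

/-- A weight growing linearly at infinity and quadratically at zero. -/
noncomputable def tailWeight (r : ℝ) : ℝ := Real.sqrt (1 + r ^ 2) - 1

theorem hasDerivAt_tailWeight (r : ℝ) :
    HasDerivAt tailWeight (r / Real.sqrt (1 + r ^ 2)) r := by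
  have h1 : HasDerivAt (fun r : ℝ => 1 + r ^ 2) (2 * r) r := by
    simpa using (hasDerivAt_pow 2 r).const_add 1
  have := (h1.sqrt (by positivity)).sub_const 1
  refine this.congr_deriv ?_
  rw [mul_div_mul_left _ _ two_ne_zero]

theorem tailWeight_nonneg (r : ℝ) : 0 ≤ tailWeight r := by
  rw [tailWeight, sub_nonneg, Real.one_le_sqrt]
  nlinarith [sq_nonneg r]

theorem tailWeight_le {r : ℝ} (hr : 0 ≤ r) : tailWeight r ≤ r := by
  rw [tailWeight, sub_le_iff_le_add, Real.sqrt_le_left (by positivity)]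
  nlinarith

/-- The fundamental theorem of calculus for w φ² along a ray from the origin, with w = `tailWeight`
and w(0) = 0. Both w(t) ≤ t and |w'(t)| ≤ t hold, so the Jacobian t of polar coordinates appears by
itself. The right-hand side no longer depends on r. -/
theorem lintegral_radial_bound {φ : Plane → ℝ} (h : IsTestFunction φ) {r : ℝ} (hr : 0 < r) (θ : ℝ) :
    ‖tailWeight r‖ₑ * ‖φ (polarPoint r θ)‖ₑ ^ 2 ≤ ∫⁻ t in Set.Ioi (0 : ℝ), ENNReal.ofReal t *
      (‖φ (polarPoint t θ)‖ₑ ^ 2 + 2 * (‖φ (polarPoint t θ)‖ₑ *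
        (‖partialDeriv 0 φ (polarPoint t θ)‖ₑ + ‖partialDeriv 1 φ (polarPoint t θ)‖ₑ))) := by
  have hc : Continuous fun t => polarPoint t θ := continuous_polarPoint.comp (f := fun t => (t, θ)) (by fun_prop)
  have hcd : ∀ i, Continuous fun t => partialDeriv i φ (polarPoint t θ) := fun i =>
    (h.partialDeriv i).continuous.comp hc
  have hcφ : Continuous fun t => φ (polarPoint t θ) := h.continuous.comp hc
  have hcw : Continuous tailWeight := by unfold tailWeight; fun_prop
  have h0 : tailWeight 0 = 0 := by simp [tailWeight]
  have := enorm_le_lintegral_deriv (f := fun t => tailWeight t * φ (polarPoint t θ) ^ 2)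
    (f' := fun t => t / Real.sqrt (1 + t ^ 2) * φ (polarPoint t θ) ^ 2 + tailWeight t *
      (2 * φ (polarPoint t θ) * (Real.cos θ * partialDeriv 0 φ (polarPoint t θ)
      + Real.sin θ * partialDeriv 1 φ (polarPoint t θ)))) (fun t => by
      have := (hasDerivAt_tailWeight t).fun_mul ((hasDerivAt_polar_radius h.differentiable t θ).fun_pow 2)
      simpa using this)
    (by
      refine (Continuous.mul ?_ (hcφ.pow 2)).add (hcw.mul ((continuous_const.mul hcφ).mul
        ((continuous_const.mul (hcd 0)).add (continuous_const.mul (hcd 1)))))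
      exact continuous_id.div (by fun_prop) fun t => by positivity)
    hr.le (by rw [h0]; ring) (S := Set.Ioi 0)
    (LE.le.eventuallyLE fun s hs => hs.1)
  rw [← enorm_pow, ← enorm_mul]
  refine this.trans (setLIntegral_mono' measurableSet_Ioi fun t ht => ?_)
  have ht0 : (0 : ℝ) < t := ht
  simp only [enorm_eq_nnnorm, ENNReal.ofReal]
  norm_cast
  rw [← NNReal.coe_le_coe]
  push_cast
  rw [Real.coe_toNNReal _ ht0.le]
  have h1 : |t / Real.sqrt (1 + t ^ 2)| ≤ t := by
    rw [abs_of_nonneg (by positivity)]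
    exact div_le_self ht0.le (by rw [Real.one_le_sqrt]; nlinarith)
  have h2 : |tailWeight t| ≤ t := by
    rw [abs_of_nonneg (tailWeight_nonneg t)]; exact tailWeight_le ht0.le
  simp only [Real.norm_eq_abs]
  refine (abs_add_le _ _).trans ?_
  rw [mul_add t, abs_mul, abs_mul, abs_pow, abs_mul (2 * _), abs_mul 2, abs_two, mul_assoc 2]
  gcongr
  refine (abs_add_le _ _).trans ?_
  rw [abs_mul, abs_mul]
  refine add_le_add (mul_le_of_le_one_left (abs_nonneg _) (Real.abs_cos_le_one _))
    (mul_le_of_le_one_left (abs_nonneg _) (Real.abs_sin_le_one _))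

theorem norm_polarPoint {r : ℝ} (hr : 0 ≤ r) (θ : ℝ) : ‖polarPoint r θ‖ = r := by
  rw [EuclideanSpace.norm_eq, polarPoint]
  simp only [Fin.sum_univ_two, Real.norm_eq_abs, sq_abs]
  simp only [Matrix.cons_val_zero, Matrix.cons_val_one]
  rw [show (r * Real.cos θ) ^ 2 + (r * Real.sin θ) ^ 2 = r ^ 2 by
    linear_combination r ^ 2 * Real.sin_sq_add_cos_sq θ, Real.sqrt_sq hr]

theorem lintegral_mul_le_of_sq_le {α : Type*} [MeasurableSpace α] {μ : Measure α} {f g : α → ℝ≥0∞}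
    (hf : AEMeasurable f μ) (hg : AEMeasurable g μ) {a b : ℝ≥0∞} (ha : ∫⁻ x, f x ^ 2 ∂μ ≤ a ^ 2)
    (hb : ∫⁻ x, g x ^ 2 ∂μ ≤ b ^ 2) : ∫⁻ x, f x * g x ∂μ ≤ a * b := by
  rw [← ENNReal.pow_le_pow_left_iff two_ne_zero, mul_pow]
  exact (lintegral_mul_sq_le hf hg).trans (mul_le_mul' ha hb)

theorem IsTestFunction.measurable_enorm_jet {φ : Plane → ℝ} (h : IsTestFunction φ) (j : Fin 4) :
    Measurable fun x => ‖HalfPlaneNLS.jet φ j x‖ₑ := (h.jet j).continuous.measurable.enorm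

theorem IsTestFunction.lintegral_angular_le {φ : Plane → ℝ} (h : IsTestFunction φ) :
    ∫⁻ x, 2 * (‖φ x‖ₑ * ‖HalfPlaneNLS.jet φ 3 x‖ₑ) ≤ 2 * (‖h.toL2 0‖ₑ * ‖h.toL2 3‖ₑ) := by
  have hm : Measurable fun x => ‖φ x‖ₑ * ‖HalfPlaneNLS.jet φ 3 x‖ₑ :=
    (h.measurable_enorm_jet 0).mul (h.measurable_enorm_jet 3)
  rw [lintegral_const_mul _ hm]
  gcongr
  exact lintegral_mul_le_of_sq_le (h.measurable_enorm_jet 0).aemeasurable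
    (h.measurable_enorm_jet 3).aemeasurable (h.lintegral_jet_sq 0).le (h.lintegral_jet_sq 3).le

/-- Integrating the angular bound over θ and r gives ‖φ‖² ≤ 2π · 2 ‖φ‖ ‖∂_θ φ‖ by Cauchy–Schwarz;
one factor ‖φ‖ is then cancelled. -/
theorem IsTestFunction.poincare {φ : Plane → ℝ} (h : IsTestFunction φ) :
    ‖h.toL2 0‖ ≤ 4 * Real.pi * ‖h.toL2 3‖ := by
  have hm : Measurable fun x => 2 * (‖φ x‖ₑ * ‖HalfPlaneNLS.jet φ 3 x‖ₑ) :=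
    ((h.measurable_enorm_jet 0).mul (h.measurable_enorm_jet 3)).const_mul 2
  have hmp : Measurable fun p : ℝ × ℝ =>
      2 * (‖φ (polarPoint p.1 p.2)‖ₑ * ‖HalfPlaneNLS.jet φ 3 (polarPoint p.1 p.2)‖ₑ) :=
    hm.comp continuous_polarPoint.measurable
  have key : ‖h.toL2 0‖ₑ ^ 2
      ≤ ENNReal.ofReal (2 * Real.pi) * (2 * (‖h.toL2 0‖ₑ * ‖h.toL2 3‖ₑ)) := by
    rw [← h.lintegral_jet_sq 0, lintegral_plane_polar ((h.measurable_enorm_jet 0).pow_const 2)]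
    refine le_trans ?_ (mul_le_mul' le_rfl h.lintegral_angular_le)
    rw [lintegral_plane_polar hm, ← lintegral_const_mul']
    swap; · exact ENNReal.ofReal_ne_top
    refine setLIntegral_mono' measurableSet_Ioi fun r hr => ?_
    have hr0 : (0 : ℝ) < r := hr
    rw [lintegral_const_mul' _ (fun θ =>
      2 * (‖φ (polarPoint r θ)‖ₑ * ‖HalfPlaneNLS.jet φ 3 (polarPoint r θ)‖ₑ)) ENNReal.ofReal_ne_top]
    calc ∫⁻ θ in Set.Ioo (-Real.pi) Real.pi, ENNReal.ofReal r *
          ‖HalfPlaneNLS.jet φ 0 (polarPoint r θ)‖ₑ ^ 2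
        ≤ ∫⁻ θ in Set.Ioo (-Real.pi) Real.pi, ENNReal.ofReal r *
          ∫⁻ t in Set.Ioo (-Real.pi) Real.pi,
          2 * (‖φ (polarPoint r t)‖ₑ * ‖HalfPlaneNLS.jet φ 3 (polarPoint r t)‖ₑ) := by
          refine setLIntegral_mono' measurableSet_Ioo fun θ hθ => ?_
          gcongr
          exact lintegral_angular_bound h hr0 hθ
      _ = _ := by
          rw [setLIntegral_const, Real.volume_Ioo, mul_comm]
          congr 2
          ring_nf
  have key2 : ‖h.toL2 0‖ ^ 2 ≤ 2 * Real.pi * (2 * (‖h.toL2 0‖ * ‖h.toL2 3‖)) := by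
    have := ENNReal.toReal_mono (by simp [ENNReal.mul_eq_top]) key
    simpa [Real.pi_pos.le] using this
  rcases (norm_nonneg (h.toL2 0)).eq_or_lt with h0 | h0
  · rw [← h0]; positivity
  · nlinarith

/-- A Ladyzhenskaya argument in polar coordinates: φ² is bounded by a function of r alone and w φ²
by a function of θ alone, so the integral of w φ⁴ is at most the product of two plane integrals. The
Jacobian r goes with the angular factor, as the radial one already contains its own. The two
integrals contribute 2 and 5 to the constant. -/
theorem IsTestFunction.lintegral_tailWeight_le {φ : Plane → ℝ} (h : IsTestFunction φ) :
    ∫⁻ x, ‖tailWeight ‖x‖‖ₑ * ‖φ x‖ₑ ^ 4 ≤ 10 * ‖h.toL2‖ₑ ^ 4 := by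
  set F₁ : Plane → ℝ≥0∞ := fun x => 2 * (‖φ x‖ₑ * ‖HalfPlaneNLS.jet φ 3 x‖ₑ) with hF₁
  set F₂ : Plane → ℝ≥0∞ := fun x => ‖φ x‖ₑ ^ 2 + 2 * (‖φ x‖ₑ *
        (‖HalfPlaneNLS.partialDeriv 0 φ x‖ₑ + ‖HalfPlaneNLS.partialDeriv 1 φ x‖ₑ)) with hF₂
  have hm0 : Measurable fun x => ‖φ x‖ₑ := h.measurable_enorm_jet 0
  have hm1 : Measurable fun x => ‖HalfPlaneNLS.partialDeriv 0 φ x‖ₑ := h.measurable_enorm_jet 1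
  have hm2 : Measurable fun x => ‖HalfPlaneNLS.partialDeriv 1 φ x‖ₑ := h.measurable_enorm_jet 2
  have hm₁ : Measurable F₁ := (hm0.mul (h.measurable_enorm_jet 3)).const_mul 2
  have hm₂ : Measurable F₂ := (hm0.pow_const 2).add ((hm0.mul (hm1.add hm2)).const_mul 2)
  have hw : Measurable fun x : Plane => ‖tailWeight ‖x‖‖ₑ := by
    refine Measurable.enorm (Continuous.measurable ?_)
    unfold tailWeight; fun_prop
  have I₁ : ∫⁻ x, F₁ x ≤ 2 * ‖h.toL2‖ₑ ^ 2 := by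
    refine h.lintegral_angular_le.trans ?_
    rw [pow_two]
    gcongr <;> exact enorm_apply_le _ _
  have I₂ : ∫⁻ x, F₂ x ≤ 5 * ‖h.toL2‖ₑ ^ 2 := by
    have hb : ∀ j, ∫⁻ x, ‖φ x‖ₑ * ‖HalfPlaneNLS.jet φ j x‖ₑ ≤ ‖h.toL2‖ₑ ^ 2 := fun j => by
      rw [pow_two]
      exact lintegral_mul_le_of_sq_le hm0.aemeasurable (h.measurable_enorm_jet j).aemeasurable
        (h.lintegral_jet_sq_le 0) (h.lintegral_jet_sq_le j)
    have m12 : Measurable fun x => ‖φ x‖ₑ *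
        (‖HalfPlaneNLS.partialDeriv 0 φ x‖ₑ + ‖HalfPlaneNLS.partialDeriv 1 φ x‖ₑ) :=
      hm0.mul (hm1.add hm2)
    have m1 : Measurable fun x => ‖φ x‖ₑ * ‖HalfPlaneNLS.partialDeriv 0 φ x‖ₑ := hm0.mul hm1
    calc ∫⁻ x, F₂ x = (∫⁻ x, ‖φ x‖ₑ ^ 2) + 2 * ((∫⁻ x, ‖φ x‖ₑ * ‖HalfPlaneNLS.jet φ 1 x‖ₑ)
            + ∫⁻ x, ‖φ x‖ₑ * ‖HalfPlaneNLS.jet φ 2 x‖ₑ) := by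
          rw [hF₂, lintegral_add_left (hm0.pow_const 2), lintegral_const_mul _ m12]
          congr 2
          simp only [mul_add]
          rw [lintegral_add_left m1]
          rfl
      _ ≤ ‖h.toL2‖ₑ ^ 2 + 2 * (‖h.toL2‖ₑ ^ 2 + ‖h.toL2‖ₑ ^ 2) := by
          gcongr
          · exact h.lintegral_jet_sq_le 0
          · exact hb 1
          · exact hb 2
      _ = 5 * ‖h.toL2‖ₑ ^ 2 := by ring
  have hc := continuous_polarPoint.measurable
  have hmB : Measurable fun θ : ℝ => ∫⁻ t in Set.Ioi (0 : ℝ), ENNReal.ofReal t * F₂ (polarPoint t θ) := by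
    refine Measurable.lintegral_prod_right' (f := fun p : ℝ × ℝ =>
      ENNReal.ofReal p.2 * F₂ (polarPoint p.2 p.1)) ?_
    exact (ENNReal.measurable_ofReal.comp measurable_snd).mul
      (hm₂.comp (hc.comp (measurable_snd.prodMk measurable_fst)))
  have hmA : Measurable fun r : ℝ => ∫⁻ t in Set.Ioo (-Real.pi) Real.pi,
      ENNReal.ofReal r * F₁ (polarPoint r t) := by
    refine Measurable.lintegral_prod_right' (f := fun p : ℝ × ℝ =>
      ENNReal.ofReal p.1 * F₁ (polarPoint p.1 p.2)) ?_
    exact (ENNReal.measurable_ofReal.comp measurable_fst).mul (hm₁.comp hc)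
  rw [lintegral_plane_polar (F := fun x => ‖tailWeight ‖x‖‖ₑ * ‖φ x‖ₑ ^ 4)
    (hw.mul (hm0.pow_const 4))]
  calc ∫⁻ r in Set.Ioi (0 : ℝ), ∫⁻ θ in Set.Ioo (-Real.pi) Real.pi, ENNReal.ofReal r *
        (‖tailWeight ‖polarPoint r θ‖‖ₑ * ‖φ (polarPoint r θ)‖ₑ ^ 4)
      ≤ ∫⁻ r in Set.Ioi (0 : ℝ), ∫⁻ θ in Set.Ioo (-Real.pi) Real.pi,
        (∫⁻ t in Set.Ioo (-Real.pi) Real.pi, ENNReal.ofReal r * F₁ (polarPoint r t)) *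
        (∫⁻ t in Set.Ioi (0 : ℝ), ENNReal.ofReal t * F₂ (polarPoint t θ)) := by
        refine setLIntegral_mono' measurableSet_Ioi fun r hr => ?_
        refine setLIntegral_mono' measurableSet_Ioo fun θ hθ => ?_
        have hr0 : (0 : ℝ) < r := hr
        rw [norm_polarPoint hr0.le, lintegral_const_mul' _ _ ENNReal.ofReal_ne_top, mul_assoc]
        refine mul_le_mul' le_rfl ?_
        rw [show ‖tailWeight r‖ₑ * ‖φ (polarPoint r θ)‖ₑ ^ 4
          = ‖φ (polarPoint r θ)‖ₑ ^ 2 * (‖tailWeight r‖ₑ * ‖φ (polarPoint r θ)‖ₑ ^ 2) by ring]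
        exact mul_le_mul' (lintegral_angular_bound h hr0 hθ) (lintegral_radial_bound h hr0 θ)
    _ = (∫⁻ x, F₁ x) * ∫⁻ x, F₂ x := by
        simp_rw [lintegral_const_mul _ hmB]
        rw [lintegral_mul_const _ hmA, ← lintegral_plane_polar hm₁, ← lintegral_plane_polar_swap hm₂]
    _ ≤ (2 * ‖h.toL2‖ₑ ^ 2) * (5 * ‖h.toL2‖ₑ ^ 2) := mul_le_mul' I₁ I₂
    _ = 10 * ‖h.toL2‖ₑ ^ 4 := by ring

/-! #### The Poincaré inequality on rectangles -/

/-- The rectangle with lower left corner `(a₀, a₁)` and side lengths `b₀`, `b₁`. -/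
def rectangle (a b : Fin 2 → ℝ) : Set Plane := {x | ∀ i, x i ∈ Set.Ico (a i) (a i + b i)}

theorem measurableSet_rectangle (a b : Fin 2 → ℝ) : MeasurableSet (rectangle a b) := by
  have : rectangle a b = ⋂ i, (fun x : Plane => x i) ⁻¹' Set.Ico (a i) (a i + b i) := by
    ext x; simp [rectangle]
  rw [this]
  exact MeasurableSet.iInter fun i =>
    (contDiff_coord i).continuous.measurable measurableSet_Ico

theorem setLIntegral_rectangle (a b : Fin 2 → ℝ) {F : Plane → ℝ≥0∞} (hF : Measurable F) :
    ∫⁻ x in rectangle a b, F x = ∫⁻ s in Set.Ico (a 0) (a 0 + b 0),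
      ∫⁻ t in Set.Ico (a 1) (a 1 + b 1), F !₂[s, t] := by
  have hc : Measurable fun p : ℝ × ℝ => (!₂[p.1, p.2] : Plane) := by
    refine Continuous.measurable ?_; fun_prop
  rw [← lintegral_indicator (measurableSet_rectangle a b), lintegral_plane,
    ← lintegral_prod (μ := volume.restrict (Set.Ico (a 0) (a 0 + b 0)))
      (ν := volume.restrict (Set.Ico (a 1) (a 1 + b 1))) (fun p => F !₂[p.1, p.2])
      (hF.comp hc).aemeasurable, Measure.prod_restrict, ← Measure.volume_eq_prod,
    ← lintegral_indicator (measurableSet_Ico.prod measurableSet_Ico)]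
  refine lintegral_congr fun p => ?_
  simp only [Set.indicator]
  congr 1
  simp [rectangle]

theorem setLIntegral_rectangle_swap (a b : Fin 2 → ℝ) {F : Plane → ℝ≥0∞} (hF : Measurable F) :
    ∫⁻ x in rectangle a b, F x = ∫⁻ t in Set.Ico (a 1) (a 1 + b 1),
      ∫⁻ s in Set.Ico (a 0) (a 0 + b 0), F !₂[s, t] := by
  have hc : Measurable fun p : ℝ × ℝ => (!₂[p.1, p.2] : Plane) := by
    refine Continuous.measurable ?_; fun_prop
  rw [setLIntegral_rectangle a b hF, lintegral_lintegral_swap]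
  exact (hF.comp hc).aemeasurable

theorem volume_rectangle {a b : Fin 2 → ℝ} :
    volume (rectangle a b) = ENNReal.ofReal (b 0) * ENNReal.ofReal (b 1) := by
  have := setLIntegral_rectangle a b (F := fun _ => 1) measurable_const
  simp only [lintegral_const, Measure.restrict_apply MeasurableSet.univ, Set.univ_inter, one_mul,
    Real.volume_Ico, add_sub_cancel_left] at this
  rw [this, mul_comm]

/-- Squared increments on an interval are bounded by the integral of the squared derivative. -/
theorem enorm_sub_sq_le {f f' : ℝ → ℝ} (hf : ∀ t, HasDerivAt f (f' t) t) (hc : Continuous f')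
    {a b s t : ℝ} (hs : s ∈ Set.Ico a (a + b)) (ht : t ∈ Set.Ico a (a + b)) :
    ‖f s - f t‖ₑ ^ 2 ≤ ENNReal.ofReal b * ∫⁻ r in Set.Ico a (a + b), ‖f' r‖ₑ ^ 2 := by
  have h1 : ‖f s - f t‖ₑ ≤ ∫⁻ r in Set.Ico a (a + b), 1 * ‖f' r‖ₑ := by
    simp only [one_mul]
    wlog hst : t ≤ s generalizing s t
    · rw [enorm_sub_rev]
      exact this ht hs (le_of_not_ge hst)
    exact enorm_le_lintegral_deriv (f := fun r => f r - f t) (fun r => (hf r).sub_const _) hc hst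
      (sub_self _) (LE.le.eventuallyLE fun r hr => ⟨ht.1.trans hr.1.le, hr.2.trans_lt hs.2⟩)
  refine (pow_le_pow_left' h1 2).trans ((lintegral_mul_sq_le measurable_const.aemeasurable
    hc.measurable.enorm.aemeasurable).trans (le_of_eq ?_))
  congr 1
  simp

theorem enorm_add_sq_le (x y : ℝ) : ‖x + y‖ₑ ^ 2 ≤ 2 * ‖x‖ₑ ^ 2 + 2 * ‖y‖ₑ ^ 2 := by
  simp only [enorm_eq_nnnorm]
  norm_cast
  rw [← NNReal.coe_le_coe]
  push_cast
  simp only [Real.norm_eq_abs, sq_abs]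
  nlinarith [sq_nonneg (x - y)]

/-- The points x and y are joined by two segments parallel to the axes, through the corner (y₁, x₂).
The form with a double integral contains no mean value and passes to limits by Fatou's lemma. -/
theorem poincare_rectangle {φ : Plane → ℝ} (hφ : ContDiff ℝ 1 φ) {a b : Fin 2 → ℝ} :
    ∫⁻ x in rectangle a b, ∫⁻ y in rectangle a b, ‖φ x - φ y‖ₑ ^ 2
      ≤ 2 * ENNReal.ofReal (b 0) * ENNReal.ofReal (b 1) *
        (ENNReal.ofReal (b 0) ^ 2 * (∫⁻ x in rectangle a b, ‖partialDeriv 0 φ x‖ₑ ^ 2)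
          + ENNReal.ofReal (b 1) ^ 2 * ∫⁻ x in rectangle a b, ‖partialDeriv 1 φ x‖ₑ ^ 2) := by
  have hd : Differentiable ℝ φ := hφ.differentiable (by simp)
  have hcp : ∀ i, Continuous (partialDeriv i φ) := fun i =>
    (hφ.continuous_fderiv (by simp)).clm_apply continuous_const
  have hc : Continuous fun p : ℝ × ℝ => (!₂[p.1, p.2] : Plane) := by fun_prop
  have hder0 : ∀ s t : ℝ, HasDerivAt (fun s => φ !₂[s, t]) (partialDeriv 0 φ !₂[s, t]) s := by
    intro s t
    have := (hd !₂[s, t]).hasFDerivAt.comp_hasDerivAt s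
      (hasDerivAt_plane (hasDerivAt_id s) (hasDerivAt_const s t))
    rw [fderiv_apply_eq] at this
    exact this.congr_deriv (by simp)
  have hder1 : ∀ s t : ℝ, HasDerivAt (fun t => φ !₂[s, t]) (partialDeriv 1 φ !₂[s, t]) t := by
    intro s t
    have := (hd !₂[s, t]).hasFDerivAt.comp_hasDerivAt t
      (hasDerivAt_plane (hasDerivAt_const t s) (hasDerivAt_id t))
    rw [fderiv_apply_eq] at this
    exact this.congr_deriv (by simp)
  have hm : ∀ i, Measurable fun x => ‖partialDeriv i φ x‖ₑ ^ 2 := fun i =>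
    (hcp i).measurable.enorm.pow_const 2
  set D₀ : ℝ → ℝ≥0∞ := fun t => ∫⁻ r in Set.Ico (a 0) (a 0 + b 0), ‖partialDeriv 0 φ !₂[r, t]‖ₑ ^ 2
  set D₁ : ℝ → ℝ≥0∞ := fun s => ∫⁻ r in Set.Ico (a 1) (a 1 + b 1), ‖partialDeriv 1 φ !₂[s, r]‖ₑ ^ 2
  have hD₀ : Measurable D₀ := Measurable.lintegral_prod_right' (f := fun p : ℝ × ℝ =>
    ‖partialDeriv 0 φ !₂[p.2, p.1]‖ₑ ^ 2)
    ((hm 0).comp (hc.measurable.comp (measurable_snd.prodMk measurable_fst)))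
  have hD₁ : Measurable D₁ := Measurable.lintegral_prod_right' (f := fun p : ℝ × ℝ =>
    ‖partialDeriv 1 φ !₂[p.1, p.2]‖ₑ ^ 2) ((hm 1).comp hc.measurable)
  have hcoord : ∀ i : Fin 2, Measurable fun x : Plane => x i := fun i =>
    (contDiff_coord i).continuous.measurable
  have ID₀ : ∫⁻ x in rectangle a b, D₀ (x 1)
      = ENNReal.ofReal (b 0) * ∫⁻ x in rectangle a b, ‖partialDeriv 0 φ x‖ₑ ^ 2 := by
    rw [setLIntegral_rectangle a b (F := fun x => D₀ (x 1)) (hD₀.comp (hcoord 1)), setLIntegral_rectangle_swap a b (hm 0)]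
    simp [mul_comm, D₀]
  have ID₁ : ∫⁻ x in rectangle a b, D₁ (x 0)
      = ENNReal.ofReal (b 1) * ∫⁻ x in rectangle a b, ‖partialDeriv 1 φ x‖ₑ ^ 2 := by
    rw [setLIntegral_rectangle_swap a b (F := fun x => D₁ (x 0)) (hD₁.comp (hcoord 0)),
      setLIntegral_rectangle a b (hm 1)]
    simp [mul_comm, D₁]
  have hpt : ∀ x ∈ rectangle a b, ∀ y ∈ rectangle a b, ‖φ x - φ y‖ₑ ^ 2
      ≤ 2 * (ENNReal.ofReal (b 0) * D₀ (x 1)) + 2 * (ENNReal.ofReal (b 1) * D₁ (y 0)) := by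
    intro x hx y hy
    have e : φ x - φ y = (φ !₂[x 0, x 1] - φ !₂[y 0, x 1]) + (φ !₂[y 0, x 1] - φ !₂[y 0, y 1]) := by
      have h : ∀ z : Plane, !₂[z 0, z 1] = z := fun z => by ext i; fin_cases i <;> rfl
      rw [h x, h y]; ring
    rw [e]
    refine (enorm_add_sq_le _ _).trans ?_
    gcongr
    · exact enorm_sub_sq_le (fun s => hder0 s (x 1)) ((hcp 0).comp (hc.comp (f := fun s => (s, x 1))
        (by fun_prop))) (hx 0) (hy 0)
    · exact enorm_sub_sq_le (fun s => hder1 (y 0) s) ((hcp 1).comp (hc.comp (f := fun s => (y 0, s))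
        (by fun_prop))) (hx 1) (hy 1)
  have hv : volume (rectangle a b) ≠ ⊤ := by
    rw [volume_rectangle]; exact ENNReal.mul_ne_top ENNReal.ofReal_ne_top ENNReal.ofReal_ne_top
  calc ∫⁻ x in rectangle a b, ∫⁻ y in rectangle a b, ‖φ x - φ y‖ₑ ^ 2
      ≤ ∫⁻ x in rectangle a b, ∫⁻ y in rectangle a b,
        (2 * (ENNReal.ofReal (b 0) * D₀ (x 1)) + 2 * (ENNReal.ofReal (b 1) * D₁ (y 0))) :=
        setLIntegral_mono' (measurableSet_rectangle a b) fun x hx =>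
          setLIntegral_mono' (measurableSet_rectangle a b) fun y hy => hpt x hx y hy
    _ = volume (rectangle a b) * (2 * (ENNReal.ofReal (b 0) * ∫⁻ x in rectangle a b, D₀ (x 1)))
        + volume (rectangle a b) *
          (2 * (ENNReal.ofReal (b 1) * ∫⁻ x in rectangle a b, D₁ (x 0))) := by
        have m0 : Measurable fun x : Plane => D₀ (x 1) := hD₀.comp (hcoord 1)
        have m1 : Measurable fun x : Plane => D₁ (x 0) := hD₁.comp (hcoord 0)
        simp_rw [lintegral_add_left measurable_const, setLIntegral_const]
        rw [lintegral_add_right _ measurable_const, setLIntegral_const,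
          lintegral_mul_const' _ _ hv, lintegral_const_mul _ (m0.const_mul _),
          lintegral_const_mul _ m0, lintegral_const_mul _ (m1.const_mul _),
          lintegral_const_mul _ m1]
        ring
    _ = _ := by
        rw [ID₀, ID₁, volume_rectangle]
        ring

/-! ### Passing to the closure -/

/-- Fatou's lemma along test functions whose jets converge in L² and almost everywhere; the bound Ψ
converges by continuity. -/
theorem lintegral_le_of_mem_jetSpace {w : Plane → ℝ≥0∞} (hw : Measurable w) (hw' : ∀ x, w x ≠ ⊤)
    (n : ℕ) {Ψ : (Fin 4 → HalfL2) → ℝ≥0∞} (hΨ : Continuous Ψ)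
    (h : ∀ (φ : Plane → ℝ) (hφ : IsTestFunction φ),
      ∫⁻ x, w x * ‖φ x‖ₑ ^ n ∂halfVolume ≤ Ψ hφ.toL2) {U : Fin 4 → HalfL2} (hU : U ∈ jetSpace) :
    ∫⁻ x, w x * ‖U 0 x‖ₑ ^ n ∂halfVolume ≤ Ψ U := by
  obtain ⟨φ, hφ, hlim, -, hae⟩ := exists_seq_of_mem_jetSpace hU
  have hm : ∀ k, Measurable fun x => w x * ‖φ k x‖ₑ ^ n := fun k =>
    hw.mul ((hφ k).continuous.measurable.enorm.pow_const n)
  calc ∫⁻ x, w x * ‖U 0 x‖ₑ ^ n ∂halfVolume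
      = ∫⁻ x, liminf (fun k => w x * ‖φ k x‖ₑ ^ n) atTop ∂halfVolume := by
        refine lintegral_congr_ae ?_
        filter_upwards [hae 0] with x hx
        refine (Tendsto.liminf_eq ?_).symm
        exact ENNReal.Tendsto.const_mul ((ENNReal.continuous_pow n).continuousAt.tendsto.comp
          hx.enorm) (Or.inr (hw' x))
    _ ≤ liminf (fun k => ∫⁻ x, w x * ‖φ k x‖ₑ ^ n ∂halfVolume) atTop := lintegral_liminf_le hm
    _ ≤ liminf (fun k => Ψ (hφ k).toL2) atTop :=
        liminf_le_liminf (Eventually.of_forall fun k => h _ (hφ k))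
    _ = Ψ U := ((hΨ.tendsto U).comp hlim).liminf_eq

theorem continuous_const_mul_enorm_pow {C : ℝ≥0∞} (hC : C ≠ ⊤) (n : ℕ) :
    Continuous fun U : Fin 4 → HalfL2 => C * ‖U‖ₑ ^ n :=
  (ENNReal.continuous_const_mul hC).comp ((ENNReal.continuous_pow n).comp continuous_enorm)

theorem poincare_of_mem_jetSpace {U : Fin 4 → HalfL2} (hU : U ∈ jetSpace) :
    ‖U 0‖ ≤ 4 * Real.pi * ‖U 3‖ := by
  obtain ⟨φ, hφ, hlim, -, -⟩ := exists_seq_of_mem_jetSpace hU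
  exact le_of_tendsto_of_tendsto' (tendsto_pi_nhds.1 hlim 0).norm
    ((tendsto_pi_nhds.1 hlim 3).norm.const_mul _) fun n => (hφ n).poincare

theorem exists_lintegral_pow_le_of_mem_jetSpace (k : ℕ) : ∃ C : ℝ≥0∞, C ≠ ⊤ ∧
    ∀ U ∈ jetSpace, ∫⁻ x, ‖U 0 x‖ₑ ^ (2 * (k + 1)) ∂halfVolume ≤ C * ‖U‖ₑ ^ (2 * (k + 1)) := by
  obtain ⟨C, hC, h⟩ := exists_lintegral_pow_le k
  refine ⟨C, hC, fun U hU => ?_⟩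
  simpa using lintegral_le_of_mem_jetSpace (w := fun _ => 1) measurable_const (by simp) _
    (continuous_const_mul_enorm_pow hC (2 * (k + 1))) (fun φ hφ => by
      simp only [one_mul]
      exact (lintegral_mono' Measure.restrict_le_self le_rfl).trans (h φ hφ)) hU

theorem measurable_tailWeight : Measurable fun x : Plane => ‖tailWeight ‖x‖‖ₑ := by
  refine Measurable.enorm (Continuous.measurable ?_)
  unfold tailWeight; fun_prop

theorem lintegral_tailWeight_le_of_mem_jetSpace {U : Fin 4 → HalfL2} (hU : U ∈ jetSpace) :
    ∫⁻ x, ‖tailWeight ‖x‖‖ₑ * ‖U 0 x‖ₑ ^ 4 ∂halfVolume ≤ 10 * ‖U‖ₑ ^ 4 :=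
  lintegral_le_of_mem_jetSpace measurable_tailWeight (by simp) _
    (continuous_const_mul_enorm_pow (by norm_num) 4) (fun φ hφ =>
      (lintegral_mono' Measure.restrict_le_self le_rfl).trans hφ.lintegral_tailWeight_le) hU

/-! ### Local compactness in `L²` -/

theorem measurable_sub_prod {φ : Plane → ℝ} (hφ : Continuous φ) :
    Measurable fun p : Plane × Plane => ‖φ p.1 - φ p.2‖ₑ ^ 2 :=
  (((hφ.comp continuous_fst).sub (hφ.comp continuous_snd)).measurable.enorm).pow_const 2

/-- Write d² φ(x) as the integral of φ(x) - φ(y) over the square plus the integral of φ. The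
Poincaré inequality bounds the first part, with a factor that is small for a small square; the
second is a single linear functional of φ. -/
theorem lintegral_square_le {φ : Plane → ℝ} (h : IsTestFunction φ) (a : Fin 2 → ℝ) {d : ℝ}
    (hd : 0 < d) :
    ∫⁻ x in rectangle a (fun _ => d), ‖φ x‖ₑ ^ 2 ≤
      ENNReal.ofReal (4 * d ^ 2) * (∫⁻ x in rectangle a (fun _ => d),
        (‖partialDeriv 0 φ x‖ₑ ^ 2 + ‖partialDeriv 1 φ x‖ₑ ^ 2))
      + ENNReal.ofReal (2 / d ^ 2) * ‖∫ x in rectangle a (fun _ => d), φ x‖ₑ ^ 2 := by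
  set Q := rectangle a (fun _ => d) with hQ
  have hvol : volume Q = ENNReal.ofReal (d ^ 2) := by
    rw [hQ, volume_rectangle, ← ENNReal.ofReal_mul hd.le, pow_two]
  have hreal : volume.real Q = d ^ 2 := by
    rw [Measure.real, hvol, ENNReal.toReal_ofReal (by positivity)]
  have hm0 : Measurable fun x => ‖φ x‖ₑ ^ 2 := (h.measurable_enorm_jet 0).pow_const 2
  have hm1 : Measurable fun x => ‖partialDeriv 0 φ x‖ₑ ^ 2 := (h.measurable_enorm_jet 1).pow_const 2
  have hφi : IntegrableOn φ Q :=
    (h.continuous.integrable_of_hasCompactSupport h.2.1).integrableOn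
  have hprod := measurable_sub_prod h.continuous
  have hpt : ∀ x, ENNReal.ofReal (d ^ 2) ^ 2 * ‖φ x‖ₑ ^ 2 ≤
      2 * (ENNReal.ofReal (d ^ 2) * ∫⁻ y in Q, ‖φ x - φ y‖ₑ ^ 2) + 2 * ‖∫ y in Q, φ y‖ₑ ^ 2 := by
    intro x
    have hci : IntegrableOn (fun _ : Plane => φ x) Q :=
      integrableOn_const (by rw [hvol]; exact ENNReal.ofReal_ne_top)
    have e : d ^ 2 * φ x = (∫ y in Q, (φ x - φ y)) + ∫ y in Q, φ y := by
      rw [integral_sub hci hφi, setIntegral_const, hreal, smul_eq_mul]; ring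
    have e2 : ENNReal.ofReal (d ^ 2) ^ 2 * ‖φ x‖ₑ ^ 2 = ‖d ^ 2 * φ x‖ₑ ^ 2 := by
      rw [enorm_mul, mul_pow, Real.enorm_eq_ofReal (sq_nonneg d)]
    rw [e2, e]
    refine (enorm_add_sq_le _ _).trans ?_
    gcongr
    have h1 : ‖∫ y in Q, (φ x - φ y)‖ₑ ≤ ∫⁻ y in Q, 1 * ‖φ x - φ y‖ₑ := by
      simpa using enorm_integral_le_lintegral_enorm (μ := volume.restrict Q) (fun y => φ x - φ y)
    refine (pow_le_pow_left' h1 2).trans ((lintegral_mul_sq_le measurable_const.aemeasurable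
      (continuous_const.sub h.continuous).measurable.enorm.aemeasurable).trans (le_of_eq ?_))
    simp [hvol]
  have hd0 : ENNReal.ofReal (d ^ 2) ≠ 0 := by
    rw [Ne, ENNReal.ofReal_eq_zero, not_le]; positivity
  have hdt : ENNReal.ofReal (d ^ 2) ≠ ⊤ := ENNReal.ofReal_ne_top
  have hint := lintegral_mono (μ := volume.restrict Q) hpt
  have hmI : Measurable fun x => ∫⁻ y in Q, ‖φ x - φ y‖ₑ ^ 2 :=
    Measurable.lintegral_prod_right' hprod
  rw [lintegral_const_mul _ hm0, lintegral_add_right _ measurable_const,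
    lintegral_const_mul _ (hmI.const_mul _), lintegral_const_mul _ hmI, setLIntegral_const,
    hvol] at hint
  have hP := poincare_rectangle (h.1.of_le (by simp) : ContDiff ℝ 1 φ) (a := a) (b := fun _ => d)
  rw [← hQ] at hP
  set I := ∫⁻ x in Q, ‖φ x‖ₑ ^ 2
  set J := ‖∫ y in Q, φ y‖ₑ ^ 2
  set K := ∫⁻ x in Q, (‖partialDeriv 0 φ x‖ₑ ^ 2 + ‖partialDeriv 1 φ x‖ₑ ^ 2) with hK
  rw [lintegral_add_left hm1] at hK
  have hP' : ∫⁻ x in Q, ∫⁻ y in Q, ‖φ x - φ y‖ₑ ^ 2 ≤ 2 * ENNReal.ofReal (d ^ 2) ^ 2 * K := by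
    refine hP.trans (le_of_eq ?_)
    rw [hK, ENNReal.ofReal_pow hd.le]
    ring
  have h4 : ENNReal.ofReal (d ^ 2) ^ 2 * I ≤ ENNReal.ofReal (d ^ 2) ^ 2 *
      (ENNReal.ofReal (4 * d ^ 2) * K + ENNReal.ofReal (2 / d ^ 2) * J) := by
    refine hint.trans ?_
    have e3 : ENNReal.ofReal (4 * d ^ 2) = 4 * ENNReal.ofReal (d ^ 2) := by
      rw [ENNReal.ofReal_mul (by norm_num)]; norm_num
    have e4 : ENNReal.ofReal (d ^ 2) * ENNReal.ofReal (2 / d ^ 2) = 2 := by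
      rw [← ENNReal.ofReal_mul (by positivity), mul_div_cancel₀ _ (by positivity)]; norm_num
    calc 2 * (ENNReal.ofReal (d ^ 2) * ∫⁻ x in Q, ∫⁻ y in Q, ‖φ x - φ y‖ₑ ^ 2)
          + 2 * J * ENNReal.ofReal (d ^ 2)
        ≤ 2 * (ENNReal.ofReal (d ^ 2) * (2 * ENNReal.ofReal (d ^ 2) ^ 2 * K))
          + 2 * J * ENNReal.ofReal (d ^ 2) := by gcongr
      _ = ENNReal.ofReal (d ^ 2) ^ 2 * (4 * ENNReal.ofReal (d ^ 2) * K)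
          + (ENNReal.ofReal (d ^ 2) * ENNReal.ofReal (2 / d ^ 2)) * (ENNReal.ofReal (d ^ 2) * J) := by
        rw [e4]; ring
      _ = _ := by rw [e3]; ring
  exact (ENNReal.mul_le_mul_iff_right (pow_ne_zero 2 hd0) (ENNReal.pow_ne_top hdt)).1 h4

/-- The squares of the grid with mesh width `d`. -/
noncomputable def gridSquare (d : ℝ) (i : ℤ × ℤ) : Set Plane :=
  rectangle ![i.1 * d, i.2 * d] (fun _ => d)

theorem mem_gridSquare {d : ℝ} (hd : 0 < d) {i : ℤ × ℤ} {x : Plane} :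
    x ∈ gridSquare d i ↔ ⌊x 0 / d⌋ = i.1 ∧ ⌊x 1 / d⌋ = i.2 := by
  simp only [gridSquare, rectangle, Set.mem_ofPred_eq, Fin.forall_fin_two, Set.mem_Ico,
    Int.floor_eq_iff, le_div_iff₀ hd, div_lt_iff₀ hd, add_mul, one_mul, Matrix.cons_val_zero,
    Matrix.cons_val_one]

theorem pairwiseDisjoint_gridSquare {d : ℝ} (hd : 0 < d) (s : Set (ℤ × ℤ)) :
    s.PairwiseDisjoint (gridSquare d) := by
  intro i _ j _ hij
  refine Set.disjoint_left.2 fun x hi hj => hij ?_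
  rw [mem_gridSquare hd] at hi hj
  exact Prod.ext (hi.1.symm.trans hj.1) (hi.2.symm.trans hj.2)

theorem measurableSet_gridSquare (d : ℝ) (i : ℤ × ℤ) : MeasurableSet (gridSquare d i) :=
  measurableSet_rectangle _ _

theorem closedBall_subset_gridSquare {d : ℝ} (hd : 0 < d) {R : ℝ} {K : ℕ} (hK : R / d ≤ K) :
    Metric.closedBall (0 : Plane) R ⊆
      ⋃ i ∈ Finset.Icc (-(K : ℤ)) K ×ˢ Finset.Icc (-(K : ℤ)) K, gridSquare d i := by
  intro x hx
  rw [mem_closedBall_zero_iff] at hx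
  have hb : ∀ j, ⌊x j / d⌋ ∈ Finset.Icc (-(K : ℤ)) K := by
    intro j
    have h1 := abs_le.1 ((abs_coord_le_norm x j).trans hx)
    rw [Finset.mem_Icc, Int.le_floor]
    constructor
    · push_cast
      rw [le_div_iff₀ hd]
      rw [div_le_iff₀ hd] at hK
      nlinarith
    · rw [← Int.cast_le (R := ℝ)]
      refine (Int.floor_le _).trans ?_
      push_cast
      exact (div_le_div_of_nonneg_right h1.2 hd.le).trans hK
  simp only [Set.mem_iUnion]
  exact ⟨(⌊x 0 / d⌋, ⌊x 1 / d⌋), Finset.mem_product.2 ⟨hb 0, hb 1⟩, (mem_gridSquare hd).2 ⟨rfl, rfl⟩⟩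

theorem halfVolume_gridSquare_ne_top (d : ℝ) (i : ℤ × ℤ) : halfVolume (gridSquare d i) ≠ ⊤ := by
  refine ne_top_of_le_ne_top ?_ (Measure.restrict_le_self (gridSquare d i))
  rw [gridSquare, volume_rectangle]
  exact ENNReal.mul_ne_top ENNReal.ofReal_ne_top ENNReal.ofReal_ne_top

/-- The indicator function of a grid square. -/
noncomputable def gridIndicator (d : ℝ) (i : ℤ × ℤ) : HalfL2 :=
  indicatorConstLp 2 (measurableSet_gridSquare d i) (halfVolume_gridSquare_ne_top d i) 1

theorem IsTestFunction.inner_gridIndicator {φ : Plane → ℝ} (h : IsTestFunction φ) (d : ℝ)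
    (i : ℤ × ℤ) : inner ℝ (gridIndicator d i) (h.toL2 0) = ∫ x in gridSquare d i, φ x := by
  rw [gridIndicator, L2.inner_indicatorConstLp_one, ← integral_indicator (measurableSet_gridSquare d i),
    ← integral_indicator (measurableSet_gridSquare d i)]
  have e : ∫ x, (gridSquare d i).indicator φ x = ∫ x, (gridSquare d i).indicator φ x ∂halfVolume := by
    refine (setIntegral_eq_integral_of_forall_compl_eq_zero fun x hx => ?_).symm
    simp [Set.indicator, h.eq_zero hx]
  rw [e]
  refine integral_congr_ae ?_
  filter_upwards [h.coeFn_toL2 0] with x hx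
  simp only [Set.indicator]
  rw [hx]; rfl

/-- A quantitative Rellich theorem: up to an error ε ‖U‖², the local L² norm is controlled by
finitely many bounded linear functionals, the integrals over the grid squares that cover the ball.
-/
theorem exists_lintegral_closedBall_le (R : ℝ) {ε : ℝ} (hε : 0 < ε) :
    ∃ (s : Finset (ℤ × ℤ)) (d : ℝ) (C : ℝ≥0∞), C ≠ ⊤ ∧ ∀ U ∈ jetSpace,
      ∫⁻ x in Metric.closedBall 0 R, ‖U 0 x‖ₑ ^ 2 ∂halfVolume ≤
        ENNReal.ofReal ε * ‖U‖ₑ ^ 2 + C * ∑ i ∈ s, ‖inner ℝ (gridIndicator d i) (U 0)‖ₑ ^ 2 := by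
  -- The 8 is the factor 4 of `lintegral_square_le` times 2, since each of the two partial
  -- derivatives is bounded by the sup norm of the jet.
  obtain ⟨d, hd, hdε⟩ : ∃ d : ℝ, 0 < d ∧ 8 * d ^ 2 ≤ ε :=
    ⟨Real.sqrt (ε / 8), by positivity, by rw [Real.sq_sqrt (by positivity)]; linarith⟩
  obtain ⟨K, hK⟩ := exists_nat_ge (R / d)
  set s := Finset.Icc (-(K : ℤ)) K ×ˢ Finset.Icc (-(K : ℤ)) K
  refine ⟨s, d, ENNReal.ofReal (2 / d ^ 2), ENNReal.ofReal_ne_top, fun U hU => ?_⟩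
  have key := lintegral_le_of_mem_jetSpace
    (w := (Metric.closedBall (0 : Plane) R).indicator 1)
    (measurable_one.indicator measurableSet_closedBall)
    (fun x => by by_cases hx : x ∈ Metric.closedBall (0 : Plane) R <;> simp [hx]) 2
    (Ψ := fun U => ENNReal.ofReal ε * ‖U‖ₑ ^ 2
      + ENNReal.ofReal (2 / d ^ 2) * ∑ i ∈ s, ‖inner ℝ (gridIndicator d i) (U 0)‖ₑ ^ 2)
    ?_ ?_ hU
  · refine le_trans (le_of_eq ?_) key
    rw [← lintegral_indicator measurableSet_closedBall]
    refine lintegral_congr fun x => ?_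
    by_cases hx : x ∈ Metric.closedBall (0 : Plane) R <;> simp [hx]
  · refine (continuous_const_mul_enorm_pow ENNReal.ofReal_ne_top 2).add
      ((ENNReal.continuous_const_mul ENNReal.ofReal_ne_top).comp
        (continuous_finsetSum _ fun i _ => (ENNReal.continuous_pow 2).comp ?_))
    exact continuous_enorm.comp (by fun_prop)
  · intro φ h
    have hm1 : Measurable fun x => ‖partialDeriv 0 φ x‖ₑ ^ 2 :=
      (h.measurable_enorm_jet 1).pow_const 2
    calc ∫⁻ x, (Metric.closedBall (0 : Plane) R).indicator 1 x * ‖φ x‖ₑ ^ 2 ∂halfVolume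
        ≤ ∫⁻ x, (Metric.closedBall (0 : Plane) R).indicator 1 x * ‖φ x‖ₑ ^ 2 :=
          lintegral_mono' Measure.restrict_le_self le_rfl
      _ = ∫⁻ x in Metric.closedBall 0 R, ‖φ x‖ₑ ^ 2 := by
          rw [← lintegral_indicator measurableSet_closedBall]
          refine lintegral_congr fun x => ?_
          by_cases hx : x ∈ Metric.closedBall (0 : Plane) R <;> simp [hx]
      _ ≤ ∫⁻ x in ⋃ i ∈ s, gridSquare d i, ‖φ x‖ₑ ^ 2 :=
          lintegral_mono_set (closedBall_subset_gridSquare hd hK)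
      _ = ∑ i ∈ s, ∫⁻ x in gridSquare d i, ‖φ x‖ₑ ^ 2 :=
          lintegral_biUnion_finset (pairwiseDisjoint_gridSquare hd _)
            (fun i _ => measurableSet_gridSquare d i) _
      _ ≤ ∑ i ∈ s, (ENNReal.ofReal (4 * d ^ 2) * (∫⁻ x in gridSquare d i,
            (‖partialDeriv 0 φ x‖ₑ ^ 2 + ‖partialDeriv 1 φ x‖ₑ ^ 2))
          + ENNReal.ofReal (2 / d ^ 2) * ‖∫ x in gridSquare d i, φ x‖ₑ ^ 2) :=
          Finset.sum_le_sum fun i _ => lintegral_square_le h _ hd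
      _ = ENNReal.ofReal (4 * d ^ 2) * (∫⁻ x in ⋃ i ∈ s, gridSquare d i,
            (‖partialDeriv 0 φ x‖ₑ ^ 2 + ‖partialDeriv 1 φ x‖ₑ ^ 2))
          + ENNReal.ofReal (2 / d ^ 2) * ∑ i ∈ s, ‖inner ℝ (gridIndicator d i) (h.toL2 0)‖ₑ ^ 2 := by
          rw [lintegral_biUnion_finset (pairwiseDisjoint_gridSquare hd _)
            (fun i _ => measurableSet_gridSquare d i), Finset.sum_add_distrib, Finset.mul_sum,
            Finset.mul_sum]
          simp only [h.inner_gridIndicator]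
      _ ≤ ENNReal.ofReal (4 * d ^ 2) * (2 * ‖h.toL2‖ₑ ^ 2)
          + ENNReal.ofReal (2 / d ^ 2) * ∑ i ∈ s, ‖inner ℝ (gridIndicator d i) (h.toL2 0)‖ₑ ^ 2 := by
          gcongr
          refine (setLIntegral_le_lintegral _ _).trans ?_
          rw [lintegral_add_left hm1, two_mul]
          exact add_le_add (h.lintegral_jet_sq_le 1) (h.lintegral_jet_sq_le 2)
      _ ≤ _ := by
          refine add_le_add ?_ le_rfl
          rw [← mul_assoc]
          refine mul_le_mul' ?_ le_rfl
          rw [← ENNReal.ofReal_ofNat, ← ENNReal.ofReal_mul (by positivity)]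
          exact ENNReal.ofReal_le_ofReal (by linarith)

/-! ### The compact embedding into `Lᵖ` -/

/-- Here W stands for the weight. Small t are absorbed by ε t² because p > 2, and large t by the
higher power. For t in between, t^p is bounded, and the product of W t⁴ and t²/W does not depend on
W, so the inequality of arithmetic and geometric means applies. The remainder t²/W is harmless where
the weight is large. -/
theorem exists_rpow_le {p : ℝ} (hp : 2 < p) {k : ℕ} (hk : p < 2 * (k + 1)) {ε : ℝ} (hε : 0 < ε) :
    ∃ C, 0 ≤ C ∧ ∀ W t : ℝ, 1 ≤ W → 0 ≤ t →
      t ^ p ≤ ε * (t ^ 2 + t ^ (2 * (k + 1)) + W * t ^ 4) + C * (t ^ 2 / W) := by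
  set δ : ℝ := min 1 (ε ^ (1 / (p - 2)))
  have hδ : 0 < δ := by positivity
  set M : ℝ := max 1 (ε⁻¹ ^ (1 / (2 * (k + 1) - p)))
  have hM : 1 ≤ M := le_max_left _ _
  refine ⟨M ^ (2 * p) / (4 * ε * δ ^ 6), by positivity, fun W t hW ht => ?_⟩
  have hW0 : 0 < W := by linarith
  rcases le_total t δ with h1 | h1
  · rcases ht.eq_or_lt with rfl | h0
    · rw [Real.zero_rpow (by linarith)]; positivity
    have e : t ^ p = t ^ (p - 2) * t ^ 2 := by
      rw [← Real.rpow_natCast t 2, ← Real.rpow_add h0]; norm_num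
    have h2 : t ^ (p - 2) ≤ ε := by
      have h3 : t ≤ ε ^ (1 / (p - 2)) := h1.trans (min_le_right _ _)
      calc t ^ (p - 2) ≤ (ε ^ (1 / (p - 2))) ^ (p - 2) :=
            Real.rpow_le_rpow ht h3 (by linarith)
        _ = ε := by rw [← Real.rpow_mul hε.le, one_div_mul_cancel (by linarith), Real.rpow_one]
    have h4 : t ^ p ≤ ε * t ^ 2 := by rw [e]; gcongr
    have h5 : 0 ≤ ε * (t ^ (2 * (k + 1)) + W * t ^ 4)
      + M ^ (2 * p) / (4 * ε * δ ^ 6) * (t ^ 2 / W) := by positivity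
    linarith
  have h0 : 0 < t := hδ.trans_le h1
  rcases le_total M t with h2 | h2
  · have h3 : (ε⁻¹ ^ (1 / (2 * (k + 1) - p))) ≤ t := (le_max_right _ _).trans h2
    have h4 : ε⁻¹ ≤ t ^ (2 * ((k : ℝ) + 1) - p) := by
      calc ε⁻¹ = (ε⁻¹ ^ (1 / (2 * ((k : ℝ) + 1) - p))) ^ (2 * ((k : ℝ) + 1) - p) := by
            rw [← Real.rpow_mul (by positivity), one_div_mul_cancel (by linarith), Real.rpow_one]
        _ ≤ _ := Real.rpow_le_rpow (by positivity) h3 (by linarith)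
    have e : t ^ (2 * (k + 1)) = t ^ (2 * ((k : ℝ) + 1) - p) * t ^ p := by
      rw [← Real.rpow_add h0, ← Real.rpow_natCast]; congr 1; push_cast; ring
    have h5 : t ^ p ≤ ε * t ^ (2 * (k + 1)) := by
      rw [e, ← mul_assoc]
      refine le_mul_of_one_le_left (by positivity) ?_
      calc (1 : ℝ) = ε * ε⁻¹ := (mul_inv_cancel₀ hε.ne').symm
        _ ≤ _ := by gcongr
    have h6 : 0 ≤ ε * (t ^ 2 + W * t ^ 4)
      + M ^ (2 * p) / (4 * ε * δ ^ 6) * (t ^ 2 / W) := by positivity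
    linarith
  · have h3 : t ^ p ≤ M ^ p := Real.rpow_le_rpow ht h2 (by linarith)
    set m : ℝ := M ^ p with hm
    have hm0 : 0 < m := by positivity
    have e : M ^ (2 * p) = m ^ 2 := by
      rw [hm, ← Real.rpow_natCast, ← Real.rpow_mul (by positivity)]
      congr 1; push_cast; ring
    rw [e]
    have h4 : m ≤ ε * (W * t ^ 4) + m ^ 2 / (4 * ε * δ ^ 6) * (t ^ 2 / W) := by
      -- With A = ε W t⁴ the left-hand side is m²/(4A), and A + m²/(4A) ≥ m. Replacing t by its
      -- lower bound δ frees the constant of t.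
      have h5 : m ^ 2 / (4 * ε * t ^ 6) * (t ^ 2 / W) ≤ m ^ 2 / (4 * ε * δ ^ 6) * (t ^ 2 / W) := by
        gcongr
      refine le_trans ?_ (add_le_add le_rfl h5)
      rw [← sub_nonneg]
      have : ε * (W * t ^ 4) + m ^ 2 / (4 * ε * t ^ 6) * (t ^ 2 / W) - m
        = (2 * ε * W * t ^ 4 - m) ^ 2 / (4 * ε * W * t ^ 4) := by
        field_simp
        ring
      rw [this]
      positivity
    have h6 : 0 ≤ ε * (t ^ 2 + t ^ (2 * (k + 1))) := by positivity
    linarith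

/-- The pointwise inequality is integrated with W = √(1 + |x|²). The Sobolev and weighted L⁴ bounds
make the ε terms small, and the remainder only matters in a ball. -/
theorem exists_lintegral_rpow_le {p : ℝ} (hp : 2 < p) {M η : ℝ} (hη : 0 < η) :
    ∃ C R : ℝ, ∀ U ∈ jetSpace, ‖U‖ ≤ M → ∫⁻ x, ‖U 0 x‖ₑ ^ p ∂halfVolume ≤
      ENNReal.ofReal η + ENNReal.ofReal C *
        ∫⁻ x in Metric.closedBall 0 R, ‖U 0 x‖ₑ ^ 2 ∂halfVolume := by
  obtain ⟨k, hk⟩ : ∃ k : ℕ, p < 2 * (k + 1) := by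
    obtain ⟨k, hk⟩ := exists_nat_gt p
    exact ⟨k, by linarith⟩
  obtain ⟨C₁, hC₁, h1⟩ := exists_lintegral_pow_le_of_mem_jetSpace k
  obtain ⟨C₂, hC₂, h2⟩ := exists_lintegral_pow_le_of_mem_jetSpace 1
  set m := ENNReal.ofReal M with hm
  -- A bounds the integrals multiplied by ε when ‖U‖ ≤ M. The L² term counts twice because the
  -- remainder outside the ball is absorbed into it.
  set A : ℝ≥0∞ := 2 * m ^ 2 + C₁ * m ^ (2 * (k + 1)) + (C₂ * m ^ 4 + 10 * m ^ 4) with hA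
  have hAt : A ≠ ⊤ := by
    have : m ≠ ⊤ := ENNReal.ofReal_ne_top
    simp [hA, ENNReal.mul_eq_top, hC₁, hC₂, this]
  set ε : ℝ := η / (A.toReal + 1) with hε
  have hA0 : 0 ≤ A.toReal := ENNReal.toReal_nonneg
  have hε0 : 0 < ε := by positivity
  obtain ⟨C, hC, hpt⟩ := exists_rpow_le hp hk hε0
  -- Outside the ball of radius C/ε the weight exceeds C/ε, so C t²/W ≤ ε t².
  refine ⟨C, C / ε, fun U hU hUM => ?_⟩
  set R := C / ε
  have hUm : ‖U‖ₑ ≤ m := by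
    rw [← ofReal_norm]; exact ENNReal.ofReal_le_ofReal hUM
  have hmU : AEMeasurable (fun x => ‖U 0 x‖ₑ) halfVolume := (Lp.memLp (U 0)).1.enorm
  have hpt2 : ∀ (x : Plane) (t : ℝ), ‖t‖ₑ ^ p ≤ ENNReal.ofReal ε *
      (2 * ‖t‖ₑ ^ 2 + ‖t‖ₑ ^ (2 * (k + 1)) + (‖t‖ₑ ^ 4 + ‖tailWeight ‖x‖‖ₑ * ‖t‖ₑ ^ 4))
      + ENNReal.ofReal C * (Metric.closedBall 0 R).indicator (fun _ => ‖t‖ₑ ^ 2) x := by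
    intro x t
    have hW : 1 ≤ 1 + tailWeight ‖x‖ := by linarith [tailWeight_nonneg ‖x‖]
    have key := hpt _ |t| hW (abs_nonneg t)
    have hs : Real.sqrt (1 + ‖x‖ ^ 2) = 1 + tailWeight ‖x‖ := by rw [tailWeight]; ring
    have hreal : |t| ^ p ≤ ε * (2 * |t| ^ 2 + |t| ^ (2 * (k + 1)) +
        (|t| ^ 4 + |tailWeight ‖x‖| * |t| ^ 4))
        + C * (Metric.closedBall 0 R).indicator (fun _ => |t| ^ 2) x := by
      rw [abs_of_nonneg (tailWeight_nonneg ‖x‖)]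
      by_cases hx : x ∈ Metric.closedBall 0 R
      · rw [Set.indicator_of_mem hx]
        have h3 : C * (|t| ^ 2 / (1 + tailWeight ‖x‖)) ≤ C * |t| ^ 2 :=
          mul_le_mul_of_nonneg_left (div_le_self (by positivity) hW) hC
        have : 0 ≤ ε * |t| ^ 2 := by positivity
        linarith
      · rw [Set.indicator_of_notMem hx]
        rw [mem_closedBall_zero_iff, not_le] at hx
        have h3 : R ≤ 1 + tailWeight ‖x‖ := by
          rw [← hs]
          exact hx.le.trans (Real.le_sqrt_of_sq_le (by linarith))
        have h4 : C * (|t| ^ 2 / (1 + tailWeight ‖x‖)) ≤ ε * |t| ^ 2 := by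
          rw [mul_div_assoc', div_le_iff₀ (by linarith)]
          have : C ≤ ε * (1 + tailWeight ‖x‖) := by
            rwa [div_le_iff₀ hε0, mul_comm] at h3
          nlinarith [sq_nonneg |t|]
        linarith
    have e1 : ‖t‖ₑ = ENNReal.ofReal |t| := (ofReal_norm t).symm
    have e2 : ‖tailWeight ‖x‖‖ₑ = ENNReal.ofReal |tailWeight ‖x‖| := (ofReal_norm _).symm
    have e3 : (Metric.closedBall 0 R).indicator (fun _ => ‖t‖ₑ ^ 2) x
        = ENNReal.ofReal ((Metric.closedBall 0 R).indicator (fun _ => |t| ^ 2) x) := by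
      by_cases hx : x ∈ Metric.closedBall 0 R
      · rw [Set.indicator_of_mem hx, Set.indicator_of_mem hx, e1, ENNReal.ofReal_pow (abs_nonneg t)]
      · rw [Set.indicator_of_notMem hx, Set.indicator_of_notMem hx, ENNReal.ofReal_zero]
    have hi : 0 ≤ (Metric.closedBall 0 R).indicator (fun _ => |t| ^ 2) x :=
      Set.indicator_nonneg (fun _ _ => by positivity) x
    rw [e3, e2, e1, ENNReal.ofReal_rpow_of_nonneg (abs_nonneg t) (by linarith)]
    refine (ENNReal.ofReal_le_ofReal hreal).trans (le_of_eq ?_)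
    rw [ENNReal.ofReal_add (by positivity) (by positivity), ENNReal.ofReal_mul hε0.le,
      ENNReal.ofReal_mul hC, ENNReal.ofReal_add (by positivity) (by positivity),
      ENNReal.ofReal_add (by positivity) (by positivity),
      ENNReal.ofReal_add (by positivity) (by positivity),
      ENNReal.ofReal_mul (by positivity), ENNReal.ofReal_mul (by positivity),
      ENNReal.ofReal_pow (abs_nonneg t), ENNReal.ofReal_pow (abs_nonneg t),
      ENNReal.ofReal_pow (abs_nonneg t), ENNReal.ofReal_ofNat]
  have hmw : AEMeasurable (fun x => ‖tailWeight ‖x‖‖ₑ * ‖U 0 x‖ₑ ^ 4) halfVolume :=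
    measurable_tailWeight.aemeasurable.mul (hmU.pow_const 4)
  have hm1 : AEMeasurable (fun x => 2 * ‖U 0 x‖ₑ ^ 2 + ‖U 0 x‖ₑ ^ (2 * (k + 1))) halfVolume :=
    ((hmU.pow_const 2).const_mul 2).add (hmU.pow_const _)
  have hm2 : AEMeasurable (fun x => ‖U 0 x‖ₑ ^ 4 + ‖tailWeight ‖x‖‖ₑ * ‖U 0 x‖ₑ ^ 4) halfVolume :=
    (hmU.pow_const 4).add hmw
  have hm3 : AEMeasurable (fun x => 2 * ‖U 0 x‖ₑ ^ 2 + ‖U 0 x‖ₑ ^ (2 * (k + 1))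
      + (‖U 0 x‖ₑ ^ 4 + ‖tailWeight ‖x‖‖ₑ * ‖U 0 x‖ₑ ^ 4)) halfVolume := hm1.add hm2
  calc ∫⁻ x, ‖U 0 x‖ₑ ^ p ∂halfVolume
      ≤ ∫⁻ x, (ENNReal.ofReal ε * (2 * ‖U 0 x‖ₑ ^ 2 + ‖U 0 x‖ₑ ^ (2 * (k + 1))
          + (‖U 0 x‖ₑ ^ 4 + ‖tailWeight ‖x‖‖ₑ * ‖U 0 x‖ₑ ^ 4))
          + ENNReal.ofReal C * (Metric.closedBall 0 R).indicator (fun x => ‖U 0 x‖ₑ ^ 2) x)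
          ∂halfVolume := by
        refine lintegral_mono fun x => (hpt2 x (U 0 x)).trans (le_of_eq ?_)
        by_cases hx : x ∈ Metric.closedBall 0 R <;> simp [hx]
    _ = ENNReal.ofReal ε * (2 * (∫⁻ x, ‖U 0 x‖ₑ ^ 2 ∂halfVolume)
          + (∫⁻ x, ‖U 0 x‖ₑ ^ (2 * (k + 1)) ∂halfVolume) + ((∫⁻ x, ‖U 0 x‖ₑ ^ 4 ∂halfVolume)
          + ∫⁻ x, ‖tailWeight ‖x‖‖ₑ * ‖U 0 x‖ₑ ^ 4 ∂halfVolume))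
          + ENNReal.ofReal C * ∫⁻ x in Metric.closedBall 0 R, ‖U 0 x‖ₑ ^ 2 ∂halfVolume := by
        rw [lintegral_add_left' (hm3.const_mul _), lintegral_const_mul'' _ hm3,
          lintegral_add_left' hm1, lintegral_add_right' _ (hmU.pow_const _),
          lintegral_add_left' (hmU.pow_const 4), lintegral_const_mul'' _ (hmU.pow_const 2),
          lintegral_const_mul'' _ ((hmU.pow_const 2).indicator measurableSet_closedBall),
          lintegral_indicator measurableSet_closedBall]
    _ ≤ ENNReal.ofReal ε * A + ENNReal.ofReal C *
          ∫⁻ x in Metric.closedBall 0 R, ‖U 0 x‖ₑ ^ 2 ∂halfVolume := by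
        gcongr
        rw [hA]
        gcongr
        · rw [lintegral_halfL2_sq]
          gcongr
          exact (enorm_apply_le U 0).trans hUm
        · exact (h1 U hU).trans (by gcongr)
        · exact (h2 U hU).trans (by gcongr)
        · exact (lintegral_tailWeight_le_of_mem_jetSpace hU).trans (by gcongr)
    _ ≤ _ := by
        gcongr
        rw [← ENNReal.ofReal_toReal hAt, ← ENNReal.ofReal_mul hε0.le]
        refine ENNReal.ofReal_le_ofReal ?_
        rw [hε, div_mul_eq_mul_div, div_le_iff₀ (by positivity)]
        nlinarith

theorem exists_lintegral_rpow_le_bound {p : ℝ} (hp : 2 < p) (M : ℝ) :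
    ∃ K : ℝ≥0∞, K ≠ ⊤ ∧ ∀ U ∈ jetSpace, ‖U‖ ≤ M → ∫⁻ x, ‖U 0 x‖ₑ ^ p ∂halfVolume ≤ K := by
  obtain ⟨C, R, h⟩ := exists_lintegral_rpow_le hp (M := M) one_pos
  refine ⟨ENNReal.ofReal 1 + ENNReal.ofReal C * ENNReal.ofReal M ^ 2, ?_, fun U hU hM => ?_⟩
  · simp [ENNReal.mul_eq_top]
  · refine (h U hU hM).trans ?_
    gcongr
    refine (setLIntegral_le_lintegral _ _).trans ?_
    rw [lintegral_halfL2_sq]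
    gcongr
    refine (enorm_apply_le U 0).trans ?_
    rw [← ofReal_norm]
    exact ENNReal.ofReal_le_ofReal hM

theorem exists_lintegral_rpow_le_inner {p : ℝ} (hp : 2 < p) {M η : ℝ} (hη : 0 < η) :
    ∃ (s : Finset (ℤ × ℤ)) (d : ℝ) (C : ℝ≥0∞), C ≠ ⊤ ∧ ∀ U ∈ jetSpace, ‖U‖ ≤ M →
      ∫⁻ x, ‖U 0 x‖ₑ ^ p ∂halfVolume ≤
        ENNReal.ofReal η + C * ∑ i ∈ s, ‖inner ℝ (gridIndicator d i) (U 0)‖ₑ ^ 2 := by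
  obtain ⟨C, R, h⟩ := exists_lintegral_rpow_le hp (M := M) (half_pos hη)
  -- ε is chosen so that the local error, multiplied by |C| M², still fits into the other half of η.
  have hpos : 0 < |C| * M ^ 2 + 1 := by positivity
  set ε : ℝ := η / 2 / (|C| * M ^ 2 + 1) with hε
  obtain ⟨s, d, C', hC', h'⟩ := exists_lintegral_closedBall_le R (ε := ε) (by positivity)
  refine ⟨s, d, ENNReal.ofReal C * C', ENNReal.mul_ne_top ENNReal.ofReal_ne_top hC',
    fun U hU hM => ?_⟩
  refine (h U hU hM).trans ((add_le_add le_rfl (mul_le_mul' le_rfl (h' U hU))).trans ?_)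
  rw [mul_add, ← add_assoc, ← mul_assoc _ C']
  gcongr
  calc ENNReal.ofReal (η / 2) + ENNReal.ofReal C * (ENNReal.ofReal ε * ‖U‖ₑ ^ 2)
      ≤ ENNReal.ofReal (η / 2) + ENNReal.ofReal |C| * (ENNReal.ofReal ε * ENNReal.ofReal M ^ 2) := by
        gcongr
        · exact le_abs_self C
        · rw [← ofReal_norm]; exact ENNReal.ofReal_le_ofReal hM
    _ ≤ _ := by
        rw [← ENNReal.ofReal_pow ((norm_nonneg U).trans hM), ← ENNReal.ofReal_mul (by positivity),
          ← ENNReal.ofReal_mul (abs_nonneg C), ← ENNReal.ofReal_add (by positivity) (by positivity)]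
        refine ENNReal.ofReal_le_ofReal ?_
        have : ε * (|C| * M ^ 2 + 1) = η / 2 := div_mul_cancel₀ _ hpos.ne'
        have h0 : 0 < ε := by positivity
        nlinarith

/-! #### The embedding -/

section Embedding

variable (p : ℝ) [hp : Fact (2 < p)]

instance fact_one_le_ofReal : Fact (1 ≤ ENNReal.ofReal p) :=
  ⟨by rw [ENNReal.one_le_ofReal]; linarith [hp.out]⟩

theorem ofReal_exponent_ne_zero : ENNReal.ofReal p ≠ 0 := by
  rw [Ne, ENNReal.ofReal_eq_zero, not_le]; linarith [hp.out]

theorem toReal_ofReal_exponent : (ENNReal.ofReal p).toReal = p :=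
  ENNReal.toReal_ofReal (by linarith [hp.out])

variable {p}

theorem memLp_of_mem_jetSpace {U : Fin 4 → HalfL2} (hU : U ∈ jetSpace) :
    MemLp (U 0) (ENNReal.ofReal p) halfVolume := by
  refine ⟨(Lp.memLp (U 0)).1, ?_⟩
  obtain ⟨K, hK, h⟩ := exists_lintegral_rpow_le_bound hp.out ‖U‖
  rw [eLpNorm_lt_top_iff_lintegral_rpow_enorm_lt_top (ofReal_exponent_ne_zero p)
    ENNReal.ofReal_ne_top, toReal_ofReal_exponent]
  exact (h U hU le_rfl).trans_lt hK.lt_top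

variable (p)

/-- The embedding of `H⁺` into `Lᵖ`. -/
noncomputable def lpEmb : jetSpace →ₗ[ℝ] Lp ℝ (ENNReal.ofReal p) halfVolume where
  toFun U := (memLp_of_mem_jetSpace U.2).toLp
  map_add' U V := by
    rw [← MemLp.toLp_add]
    exact (MemLp.toLp_eq_toLp_iff _ _).2 (Lp.coeFn_add _ _)
  map_smul' c U := by
    rw [RingHom.id_apply, ← MemLp.toLp_const_smul]
    exact (MemLp.toLp_eq_toLp_iff _ _).2 (Lp.coeFn_smul _ _)

variable {p}

theorem coeFn_lpEmb (U : jetSpace) : lpEmb p U =ᵐ[halfVolume] U.1 0 :=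
  MemLp.coeFn_toLp (memLp_of_mem_jetSpace U.2)

theorem enorm_lpEmb_rpow (U : jetSpace) :
    ‖lpEmb p U‖ₑ ^ p = ∫⁻ x, ‖U.1 0 x‖ₑ ^ p ∂halfVolume := by
  rw [Lp.enorm_def, eLpNorm_congr_ae (coeFn_lpEmb U),
    eLpNorm_eq_lintegral_rpow_enorm_toReal (ofReal_exponent_ne_zero p) ENNReal.ofReal_ne_top,
    toReal_ofReal_exponent, ← ENNReal.rpow_mul, one_div_mul_cancel (by linarith [hp.out]),
    ENNReal.rpow_one]

theorem exists_norm_lpEmb_le : ∃ K, 0 < K ∧ ∀ U : jetSpace, ‖lpEmb p U‖ ≤ K * ‖U‖ := by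
  obtain ⟨K, hK, h⟩ := exists_lintegral_rpow_le_bound hp.out 1
  have hp0 : 0 < p := by linarith [hp.out]
  have hb : ∀ U : jetSpace, ‖U‖ ≤ 1 → ‖lpEmb p U‖ ≤ (K ^ p⁻¹).toReal := by
    intro U hU
    have h1 := h U.1 U.2 hU
    rw [← enorm_lpEmb_rpow U, ← ENNReal.le_rpow_inv_iff hp0] at h1
    rw [← toReal_enorm]
    exact ENNReal.toReal_mono (ENNReal.rpow_ne_top_of_nonneg (by positivity) hK) h1
  refine ⟨(K ^ p⁻¹).toReal + 1, by positivity, fun U => ?_⟩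
  rcases eq_or_ne U 0 with rfl | hU
  · simp
  have hU' : 0 < ‖U‖ := norm_pos_iff.2 hU
  have h2 := hb (‖U‖⁻¹ • U) (by rw [norm_smul, norm_inv, norm_norm, inv_mul_cancel₀ hU'.ne'])
  rw [map_smul, norm_smul, norm_inv, norm_norm, inv_mul_le_iff₀ hU'] at h2
  nlinarith

/-- Up to ε, distances are controlled by finitely many real coordinates. Bounded subsets of a
finite-dimensional space are totally bounded, and a finite net there lifts to one for the sequence.
-/
theorem totallyBounded_range_of_approx {E : Type*} [PseudoMetricSpace E] {f : ℕ → E}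
    (h : ∀ ε > 0, ∃ (ι : Type) (_ : Fintype ι) (L : ℕ → ι → ℝ) (δ : ℝ), 0 < δ ∧
      Bornology.IsBounded (Set.range L) ∧ ∀ n l, dist (L n) (L l) < δ → dist (f n) (f l) < ε) :
    TotallyBounded (Set.range f) := by
  refine Metric.totallyBounded_iff.2 fun ε hε => ?_
  obtain ⟨ι, _, L, δ, hδ, hb, hL⟩ := h ε hε
  have htb : TotallyBounded (Set.range L) :=
    hb.isCompact_closure.totallyBounded.subset subset_closure
  obtain ⟨t, hts, htf, ht⟩ := Metric.finite_approx_of_totallyBounded htb δ hδ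
  have hts' : ∀ y ∈ t, ∃ n, L n = y := fun y hy => hts hy
  choose! σ hσ using hts'
  refine ⟨f '' (σ '' t), (htf.image σ).image f, ?_⟩
  rintro _ ⟨n, rfl⟩
  obtain ⟨y, hy, hn⟩ := Set.mem_iUnion₂.1 (ht (Set.mem_range_self n))
  refine Set.mem_iUnion₂.2 ⟨f (σ y), Set.mem_image_of_mem f (Set.mem_image_of_mem σ hy), hL n _ ?_⟩
  rwa [hσ y hy]

/-- The embedding of `H⁺` into `Lᵖ` is compact. -/
theorem exists_subseq_tendsto_lpEmb {U : ℕ → jetSpace} {M : ℝ} (hU : ∀ n, ‖U n‖ ≤ M) :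
    ∃ g, ∃ s : ℕ → ℕ, StrictMono s ∧ Tendsto (fun n => lpEmb p (U (s n))) atTop (𝓝 g) := by
  have hp0 : 0 < p := by linarith [hp.out]
  have htb : TotallyBounded (Set.range fun n => lpEmb p (U n)) := by
    refine totallyBounded_range_of_approx fun ε hε => ?_
    -- The estimate is applied to differences of two terms, whence 2M; half of ε^p is kept for the
    -- finitely many inner products.
    obtain ⟨s, d, C, hC, h⟩ := exists_lintegral_rpow_le_inner hp.out (M := 2 * M)
      (η := ε ^ p / 2) (by positivity)
    have hlim : Tendsto (fun δ : ℝ => C * ∑ i ∈ s, ENNReal.ofReal δ ^ 2) (𝓝[>] 0) (𝓝 0) := by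
      have : Continuous (fun δ : ℝ => C * ∑ i ∈ s, ENNReal.ofReal δ ^ 2) :=
        (ENNReal.continuous_const_mul hC).comp (continuous_finsetSum _ fun i _ =>
          (ENNReal.continuous_pow 2).comp ENNReal.continuous_ofReal)
      have h0 := (this.tendsto 0).mono_left (nhdsWithin_le_nhds (s := Set.Ioi 0))
      simpa using h0
    have hε2 : 0 < ENNReal.ofReal (ε ^ p / 2) := by
      rw [ENNReal.ofReal_pos]; positivity
    obtain ⟨δ, hδ, hδ0⟩ := ((hlim.eventually (gt_mem_nhds hε2)).and self_mem_nhdsWithin).exists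
    refine ⟨s, inferInstance, fun n i => inner ℝ (gridIndicator d i) ((U n).1 0), δ, hδ0, ?_, ?_⟩
    · have hb : ∀ n, ‖(fun i : s => inner ℝ (gridIndicator d i) ((U n).1 0))‖
          ≤ ∑ i ∈ s, ‖gridIndicator d i‖ * M := by
        intro n
        have hn0 : ∀ i, 0 ≤ ‖gridIndicator d i‖ * M := fun i =>
          mul_nonneg (norm_nonneg _) ((norm_nonneg _).trans (hU n))
        refine (pi_norm_le_iff_of_nonneg (Finset.sum_nonneg fun i _ => hn0 i)).2 fun i => ?_
        refine (norm_inner_le_norm _ _).trans (le_trans ?_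
          (Finset.single_le_sum (f := fun i => ‖gridIndicator d i‖ * M) (fun i _ => hn0 i) i.2))
        gcongr
        exact (norm_le_pi_norm (U n).1 0).trans (hU n)
      exact (isBounded_iff_forall_norm_le).2 ⟨_, by rintro _ ⟨n, rfl⟩; exact hb n⟩
    · intro n l hnl
      have h1 := h (U n - U l).1 (U n - U l).2 (by
        refine (norm_sub_le (U n) (U l)).trans ?_
        linarith [hU n, hU l])
      rw [← enorm_lpEmb_rpow] at h1
      have h2 : C * ∑ i ∈ s, ‖inner ℝ (gridIndicator d i) ((U n - U l).1 0)‖ₑ ^ 2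
          < ENNReal.ofReal (ε ^ p / 2) := by
        refine lt_of_le_of_lt ?_ hδ
        gcongr with i hi
        rw [← ofReal_norm]
        refine ENNReal.ofReal_le_ofReal ?_
        have h3 := (dist_le_pi_dist (fun i : s => inner ℝ (gridIndicator d i) ((U n).1 0))
          (fun i : s => inner ℝ (gridIndicator d i) ((U l).1 0)) ⟨i, hi⟩).trans hnl.le
        rw [dist_eq_norm, ← inner_sub_right] at h3
        exact h3
      have h4 : ‖lpEmb p (U n - U l)‖ₑ ^ p < ENNReal.ofReal ε ^ p := by
        rw [ENNReal.ofReal_rpow_of_pos hε]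
        refine (h1.trans_lt (ENNReal.add_lt_add_left ENNReal.ofReal_ne_top h2)).trans_le ?_
        rw [← ENNReal.ofReal_add (by positivity) (by positivity), add_halves]
      rw [ENNReal.rpow_lt_rpow_iff hp0, map_sub, ← ofReal_norm,
        ENNReal.ofReal_lt_ofReal_iff hε] at h4
      rwa [dist_eq_norm]
  have hc : IsCompact (closure (Set.range fun n => lpEmb p (U n))) :=
    htb.closure.isCompact_of_isClosed isClosed_closure
  obtain ⟨g, -, s, hs, hlim⟩ := hc.tendsto_subseq (x := fun n => lpEmb p (U n))
    fun n => subset_closure (Set.mem_range_self n)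
  exact ⟨g, s, hs, hlim⟩

end Embedding

/-! ### The variational problem -/

/-- The angular term alone controls the L² norm through the Poincaré inequality, so q = 0 is
allowed. The three summands of the constant come from the gradient, the angular derivative and the
function itself. -/
theorem exists_coercive {lam q : ℝ} (hlam : lam ≠ 0) (hq : 0 ≤ q) :
    ∃ c, 0 < c ∧ ∀ U ∈ jetSpace, ‖U‖ ^ 2 ≤ c * jetForm lam q U U := by
  refine ⟨1 + lam ^ 2 + 16 * Real.pi ^ 2 * lam ^ 2, by positivity, fun U hU => ?_⟩
  have hl : 0 < lam ^ 2 := by positivity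
  have hN := jetForm_self lam q U
  set N := jetForm lam q U U
  have h0 : ‖U 0‖ ^ 2 ≤ 16 * Real.pi ^ 2 * ‖U 3‖ ^ 2 := by
    have := pow_le_pow_left₀ (norm_nonneg _) (poincare_of_mem_jetSpace hU) 2
    linarith
  have h3 : ‖U 3‖ ^ 2 ≤ lam ^ 2 * N := by
    have : 1 / lam ^ 2 * ‖U 3‖ ^ 2 ≤ N := by
      rw [hN]; nlinarith [sq_nonneg ‖U 1‖, sq_nonneg ‖U 2‖, mul_nonneg hq (sq_nonneg ‖U 0‖)]
    rwa [one_div_mul_eq_div, div_le_iff₀ hl, mul_comm] at this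
  have hN0 : 0 ≤ N := by rw [hN]; positivity
  have h12 : ‖U 1‖ ^ 2 + ‖U 2‖ ^ 2 ≤ N := by
    rw [hN]
    have : 0 ≤ 1 / lam ^ 2 * ‖U 3‖ ^ 2 + q * ‖U 0‖ ^ 2 := by positivity
    linarith
  have hp1 : 0 ≤ lam ^ 2 * N := by positivity
  have hp2 : 0 ≤ Real.pi ^ 2 * (lam ^ 2 * N) := by positivity
  have hp3 : Real.pi ^ 2 * ‖U 3‖ ^ 2 ≤ Real.pi ^ 2 * (lam ^ 2 * N) := by gcongr
  rw [← Real.le_sqrt (norm_nonneg _) (by positivity), pi_norm_le_iff_of_nonneg (by positivity)]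
  intro j
  rw [Real.le_sqrt (norm_nonneg _) (by positivity)]
  fin_cases j <;> simp only [Fin.zero_eta, Fin.mk_one, Fin.reduceFinMk] <;>
    nlinarith [sq_nonneg ‖U 1‖, sq_nonneg ‖U 2‖]

instance : CompleteSpace jetSpace := isClosed_jetSpace.completeSpace_coe

theorem abs_rpow_mul_self_mul_self {p : ℝ} (hp2 : 2 < p) (t : ℝ) : |t| ^ (p - 2) * t * t = |t| ^ p := by
  rw [mul_assoc, ← pow_two, ← sq_abs]
  rcases (abs_nonneg t).eq_or_lt with h | h
  · rw [← h, Real.zero_rpow (by linarith : p ≠ 0)]; ring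
  · rw [← Real.rpow_natCast, ← Real.rpow_add h]; congr 1; push_cast; ring

theorem le_of_rpow_sq_le {p y z : ℝ} (hy : 0 ≤ y) (hz : 0 < z) (hp2 : 2 < p)
    (h : y ^ (p - 2) * z ^ 2 ≤ z ^ p) : y ≤ z := by
  have e : z ^ p = z ^ (p - 2) * z ^ 2 := by
    rw [← Real.rpow_natCast z 2, ← Real.rpow_add hz]; norm_num
  rw [e] at h
  have h2 := le_of_mul_le_mul_right h (by positivity)
  exact (Real.rpow_le_rpow_iff hy hz.le (by linarith)).1 h2

theorem half_sub_one_div_pos {p : ℝ} (hp2 : 2 < p) : 0 < 1 / 2 - 1 / p := by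
  rw [sub_pos]
  exact one_div_lt_one_div_of_lt two_pos hp2

section Variational

variable {p : ℝ} [hp : Fact (2 < p)]

theorem continuous_lpEmb : Continuous (lpEmb p) := by
  obtain ⟨K, -, hK⟩ := exists_norm_lpEmb_le (p := p)
  exact AddMonoidHomClass.continuous_of_bound (lpEmb p) K hK

theorem continuous_jetForm_self (lam q : ℝ) : Continuous fun U : jetSpace => jetForm lam q U.1 U.1 :=
  (continuous_jetForm lam q).comp (continuous_subtype_val.prodMk continuous_subtype_val)

/-- By the parallelogram law the form of Uₙ - Uₘ is at most 2aₙ + 2aₘ - S ‖Uₙ + Uₘ‖_p². This tends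
to 4S‖g‖² - 4S‖g‖² = 0, so coercivity makes the sequence Cauchy. Only upper bounds aₙ are required,
so the lemma serves a single problem as well as a sequence of problems. -/
theorem exists_tendsto_of_minimizing {lam q S : ℝ} (hlam : lam ≠ 0) (hq : 0 ≤ q)
    (hS : ∀ W : jetSpace, S * ‖lpEmb p W‖ ^ 2 ≤ jetForm lam q W.1 W.1)
    {U : ℕ → jetSpace} {g : Lp ℝ (ENNReal.ofReal p) halfVolume}
    (hg : Tendsto (fun n => lpEmb p (U n)) atTop (𝓝 g)) {a : ℕ → ℝ}
    (ha : Tendsto a atTop (𝓝 (S * ‖g‖ ^ 2))) (hUa : ∀ n, jetForm lam q (U n).1 (U n).1 ≤ a n) :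
    ∃ V, Tendsto U atTop (𝓝 V) ∧ lpEmb p V = g ∧ jetForm lam q V.1 V.1 = S * ‖g‖ ^ 2 := by
  obtain ⟨c, hc, hcoer⟩ := exists_coercive hlam hq
  have hcauchy : CauchySeq U := by
    rw [cauchySeq_iff_tendsto_dist_atTop_0]
    have h1 : ∀ n : ℕ × ℕ, dist (U n.1) (U n.2) ≤ Real.sqrt (c *
        (2 * a n.1 + 2 * a n.2 - S * ‖lpEmb p (U n.1) + lpEmb p (U n.2)‖ ^ 2)) := by
      intro n
      refine Real.le_sqrt_of_sq_le ?_
      rw [dist_eq_norm]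
      refine (hcoer _ (U n.1 - U n.2).2).trans ?_
      gcongr
      have h2 := jetForm_parallelogram lam q (U n.1).1 (U n.2).1
      have h3 := hS (U n.1 + U n.2)
      rw [map_add] at h3
      have h4 : jetForm lam q (U n.1 - U n.2).1 (U n.1 - U n.2).1
        = jetForm lam q ((U n.1).1 - (U n.2).1) ((U n.1).1 - (U n.2).1) := rfl
      have h5 : jetForm lam q (U n.1 + U n.2).1 (U n.1 + U n.2).1
        = jetForm lam q ((U n.1).1 + (U n.2).1) ((U n.1).1 + (U n.2).1) := rfl
      linarith [hUa n.1, hUa n.2]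
    have hf : Tendsto (Prod.fst : ℕ × ℕ → ℕ) atTop atTop := tendsto_fst.mono_left (by rw [← prod_atTop_atTop_eq])
    have hs : Tendsto (Prod.snd : ℕ × ℕ → ℕ) atTop atTop := tendsto_snd.mono_left (by rw [← prod_atTop_atTop_eq])
    have hlim : Tendsto (fun n : ℕ × ℕ => Real.sqrt (c *
        (2 * a n.1 + 2 * a n.2 - S * ‖lpEmb p (U n.1) + lpEmb p (U n.2)‖ ^ 2))) atTop (𝓝 0) := by
      have h6 := ((((ha.comp hf).const_mul 2).add ((ha.comp hs).const_mul 2)).sub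
        ((((hg.comp hf).add (hg.comp hs)).norm.pow 2).const_mul S)).const_mul c
      have h7 := (Real.continuous_sqrt.tendsto _).comp h6
      refine h7.trans_eq ?_
      rw [← two_smul ℝ g, norm_smul, Real.norm_two, ← Real.sqrt_zero]
      congr 2
      ring
    exact squeeze_zero (fun _ => dist_nonneg) h1 hlim
  obtain ⟨V, hV⟩ := cauchySeq_tendsto_of_complete hcauchy
  have hTV : lpEmb p V = g := tendsto_nhds_unique ((continuous_lpEmb.tendsto V).comp hV) hg
  refine ⟨V, hV, hTV, le_antisymm ?_ ?_⟩
  · exact le_of_tendsto_of_tendsto' (((continuous_jetForm_self lam q).tendsto V).comp hV) ha hUa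
  · rw [← hTV]; exact hS V

/-- `V` minimizes the Rayleigh quotient and is normalized to lie on the Nehari manifold. -/
structure IsMinimizer (p lam q : ℝ) [Fact (2 < p)] (V : jetSpace) : Prop where
  pos : 0 < ‖lpEmb p V‖
  nehari : jetForm lam q V.1 V.1 = ‖lpEmb p V‖ ^ p
  le : ∀ W : jetSpace, ‖lpEmb p V‖ ^ (p - 2) * ‖lpEmb p W‖ ^ 2 ≤ jetForm lam q W.1 W.1

theorem jetForm_smul_coe (lam q c : ℝ) (U : jetSpace) :
    jetForm lam q (c • U).1 (c • U).1 = c ^ 2 * jetForm lam q U.1 U.1 :=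
  jetForm_smul_self lam q c U.1

/-- The direct method on the unit sphere of Lᵖ gives V with form value S, the infimum. Multiplying
by t = S^(1/(p-2)) reaches the Nehari manifold, since t² S = t^p, and then S = t^(p-2) is the
constant demanded by `IsMinimizer.le`. -/
theorem exists_isMinimizer {lam q : ℝ} (hlam : lam ≠ 0) (hq : 0 ≤ q)
    (hne : ∃ U : jetSpace, lpEmb p U ≠ 0) : ∃ V, IsMinimizer p lam q V := by
  obtain ⟨U₀, hU₀⟩ := hne
  obtain ⟨c, hc, hcoer⟩ := exists_coercive hlam hq
  set A : Set ℝ := (fun U : jetSpace => jetForm lam q U.1 U.1) '' {U | ‖lpEmb p U‖ = 1}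
  have hnorm : ∀ W : jetSpace, lpEmb p W ≠ 0 → ‖lpEmb p (‖lpEmb p W‖⁻¹ • W)‖ = 1 := fun W hW => by
    rw [map_smul, norm_smul, norm_inv, norm_norm, inv_mul_cancel₀ (norm_ne_zero_iff.2 hW)]
  have hA : A.Nonempty := ⟨_, _, hnorm U₀ hU₀, rfl⟩
  have hAb : BddBelow A := ⟨0, by rintro _ ⟨U, -, rfl⟩; exact jetForm_self_nonneg lam hq _⟩
  set S := sInf A
  have hS : ∀ W : jetSpace, S * ‖lpEmb p W‖ ^ 2 ≤ jetForm lam q W.1 W.1 := by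
    intro W
    by_cases hW : lpEmb p W = 0
    · rw [hW]; simpa using jetForm_self_nonneg lam hq W.1
    · have h1 : S ≤ jetForm lam q (‖lpEmb p W‖⁻¹ • W).1 (‖lpEmb p W‖⁻¹ • W).1 :=
        csInf_le hAb ⟨_, hnorm W hW, rfl⟩
      have hpos : 0 < ‖lpEmb p W‖ := norm_pos_iff.2 hW
      rwa [jetForm_smul_coe, inv_pow, ← div_eq_inv_mul, le_div_iff₀ (by positivity)] at h1
  obtain ⟨a, -, ha, haA⟩ := exists_seq_tendsto_sInf hA hAb
  choose U hU1 hUa using haA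
  obtain ⟨M, hM⟩ := ha.bddAbove_range
  have hbd : ∀ n, ‖U n‖ ≤ Real.sqrt (c * M) := fun n => by
    refine Real.le_sqrt_of_sq_le ((hcoer _ (U n).2).trans ?_)
    gcongr
    exact (hUa n).le.trans (hM (Set.mem_range_self n))
  obtain ⟨g, s, hs, hg⟩ := exists_subseq_tendsto_lpEmb (p := p) hbd
  have hg1 : ‖g‖ = 1 := by
    refine tendsto_nhds_unique hg.norm ?_
    have : ∀ n, ‖lpEmb p (U (s n))‖ = 1 := fun n => hU1 (s n)
    simp only [this]; exact tendsto_const_nhds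
  obtain ⟨V, -, hVg, hVN⟩ := exists_tendsto_of_minimizing hlam hq hS hg (a := a ∘ s)
    (by rw [hg1, one_pow, mul_one]; exact ha.comp hs.tendsto_atTop) fun n => (hUa (s n)).le
  rw [hg1, one_pow, mul_one] at hVN
  have hV0 : V ≠ 0 := by
    rintro rfl
    rw [map_zero] at hVg
    rw [← hVg, norm_zero] at hg1
    exact zero_ne_one hg1
  have hSpos : 0 < S := by
    have h2 := hcoer V.1 V.2
    have h3 : 0 < ‖V.1‖ := norm_pos_iff.2 fun h => hV0 (Subtype.ext h)
    rw [hVN] at h2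
    by_contra h4
    nlinarith [sq_pos_of_pos h3]
  set t := S ^ (1 / (p - 2)) with ht
  have hp2 : 0 < p - 2 := by linarith [hp.out]
  have htpos : 0 < t := by positivity
  have htS : t ^ (p - 2) = S := by
    rw [ht, ← Real.rpow_mul hSpos.le, one_div_mul_cancel hp2.ne', Real.rpow_one]
  have hT : ‖lpEmb p (t • V)‖ = t := by
    rw [map_smul, norm_smul, hVg, hg1, mul_one, Real.norm_of_nonneg htpos.le]
  refine ⟨t • V, by rwa [hT], ?_, fun W => ?_⟩
  · rw [hT, jetForm_smul_coe, hVN, ← htS, ← Real.rpow_natCast, ← Real.rpow_add htpos]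
    congr 1; push_cast; ring
  · rw [hT, htS]; exact hS W

theorem norm_lpEmb_rpow (U : jetSpace) : ‖lpEmb p U‖ ^ p = ∫ x, |U.1 0 x| ^ p ∂halfVolume := by
  have hp0 : 0 < p := by linarith [hp.out]
  have hm : AEStronglyMeasurable (fun x => |U.1 0 x| ^ p) halfVolume :=
    ((Lp.memLp (U.1 0)).1.norm.aemeasurable.pow_const p).aestronglyMeasurable
  rw [integral_eq_lintegral_of_nonneg_ae (Eventually.of_forall fun x => by positivity) hm, ← toReal_enorm,
    ENNReal.toReal_rpow, enorm_lpEmb_rpow]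
  congr 1
  refine lintegral_congr fun x => ?_
  rw [← ENNReal.ofReal_rpow_of_nonneg (abs_nonneg _) hp0.le, ← ofReal_norm]
  rfl

theorem integrable_rpow_of_memLp {f : Plane → ℝ} (hf : MemLp f (ENNReal.ofReal p) halfVolume) :
    Integrable (fun x => |f x| ^ p) halfVolume := by
  have := hf.integrable_norm_rpow (ofReal_exponent_ne_zero p) ENNReal.ofReal_ne_top
  rwa [toReal_ofReal_exponent] at this

theorem hasDerivAt_integral_rpow (V Φ : jetSpace) :
    HasDerivAt (fun t : ℝ => ∫ x, |V.1 0 x + t * Φ.1 0 x| ^ p ∂halfVolume)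
      (∫ x, p * (|V.1 0 x| ^ (p - 2) * V.1 0 x * Φ.1 0 x) ∂halfVolume) 0 := by
  have hp1 : 1 < p := by linarith [hp.out]
  have hV := memLp_of_mem_jetSpace (p := p) V.2
  have hΦ := memLp_of_mem_jetSpace (p := p) Φ.2
  have hm : ∀ t : ℝ, AEStronglyMeasurable (fun x => V.1 0 x + t * Φ.1 0 x) halfVolume := fun t =>
    hV.1.add (hΦ.1.const_mul t)
  have hmt : ∀ t : ℝ, MemLp (fun x => V.1 0 x + t * Φ.1 0 x) (ENNReal.ofReal p) halfVolume := fun t =>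
    hV.add (hΦ.const_mul t)
  -- For |t| < 1 both V + tΦ and Φ are bounded by |V| + |Φ|, which gives the dominating function.
  have hbi : Integrable (fun x => p * |(|V.1 0 x| + |Φ.1 0 x|)| ^ p) halfVolume :=
    (integrable_rpow_of_memLp (hV.norm.add hΦ.norm)).const_mul p
  have key := hasDerivAt_integral_of_dominated_loc_of_deriv_le (μ := halfVolume)
    (F := fun t x => |V.1 0 x + t * Φ.1 0 x| ^ p)
    (F' := fun t x => p * |V.1 0 x + t * Φ.1 0 x| ^ (p - 2) * (V.1 0 x + t * Φ.1 0 x) * Φ.1 0 x)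
    (x₀ := 0) (s := Metric.ball 0 1) (bound := fun x => p * |(|V.1 0 x| + |Φ.1 0 x|)| ^ p)
    (Metric.ball_mem_nhds 0 one_pos)
    (Eventually.of_forall fun t => (integrable_rpow_of_memLp (hmt t)).1)
    (integrable_rpow_of_memLp (hmt 0))
    (by
      have h1 : AEStronglyMeasurable (fun x => |V.1 0 x + 0 * Φ.1 0 x| ^ (p - 2)) halfVolume :=
        ((hm 0).norm.aemeasurable.pow_const (p - 2)).aestronglyMeasurable
      exact ((h1.const_mul p).mul (hm 0)).mul hΦ.1)
    (Eventually.of_forall fun x t ht => by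
      rw [mem_ball_zero_iff, Real.norm_eq_abs] at ht
      set b := |V.1 0 x + t * Φ.1 0 x|
      set d := |V.1 0 x| + |Φ.1 0 x| with hd
      have hd0 : 0 ≤ d := by positivity
      have hbd : b ≤ d := by
        refine (abs_add_le _ _).trans ?_
        rw [abs_mul]
        exact add_le_add le_rfl (mul_le_of_le_one_left (abs_nonneg _) ht.le)
      have hΦd : |Φ.1 0 x| ≤ d := by rw [hd]; linarith [abs_nonneg (V.1 0 x)]
      rw [norm_mul, norm_mul, norm_mul, Real.norm_of_nonneg (by linarith : 0 ≤ p),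
        Real.norm_of_nonneg (by positivity), Real.norm_eq_abs, Real.norm_eq_abs, abs_of_nonneg hd0,
        mul_assoc, mul_assoc]
      gcongr
      calc b ^ (p - 2) * (b * |Φ.1 0 x|) ≤ d ^ (p - 2) * (d * d) := by
            gcongr
            linarith [hp.out]
        _ = d ^ p := by
            rcases hd0.eq_or_lt with h0 | h0
            · rw [← h0, Real.zero_rpow (by linarith : p ≠ 0)]; ring
            · rw [← pow_two, ← Real.rpow_natCast, ← Real.rpow_add h0]; congr 1; push_cast; ring)
    hbi
    (Eventually.of_forall fun x t _ => by
      have h1 : HasDerivAt (fun t : ℝ => V.1 0 x + t * Φ.1 0 x) (Φ.1 0 x) t := by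
        simpa using ((hasDerivAt_id t).mul_const (Φ.1 0 x)).const_add (V.1 0 x)
      exact (hasDerivAt_abs_rpow (V.1 0 x + t * Φ.1 0 x) hp1).comp t h1)
  refine key.2.congr_deriv (integral_congr_ae (Eventually.of_forall fun x => ?_))
  simp only [zero_mul, add_zero]
  ring

/-- The Euler–Lagrange equation: t ↦ form(V + tΦ) - S ‖V + tΦ‖_p² is nonnegative and vanishes at t =
0, so its derivative there is zero. The Nehari normalization makes the Lagrange multiplier equal to
1. -/
theorem IsMinimizer.jetForm_eq {lam q : ℝ} {V : jetSpace} (h : IsMinimizer p lam q V) (Φ : jetSpace) :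
    jetForm lam q V.1 Φ.1 = ∫ x, |V.1 0 x| ^ (p - 2) * V.1 0 x * Φ.1 0 x ∂halfVolume := by
  have hp0 : 0 < p := by linarith [hp.out]
  set y := ‖lpEmb p V‖ with hy
  have hy0 : 0 < y := h.pos
  have hder := hasDerivAt_integral_rpow (p := p) V Φ
  set I := ∫ x, |V.1 0 x| ^ (p - 2) * V.1 0 x * Φ.1 0 x ∂halfVolume with hI
  rw [integral_const_mul, ← hI] at hder
  set G : ℝ → ℝ := fun t => ∫ x, |V.1 0 x + t * Φ.1 0 x| ^ p ∂halfVolume with hG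
  have hGt : ∀ t, G t = ‖lpEmb p (V + t • Φ)‖ ^ p := by
    intro t
    rw [norm_lpEmb_rpow]
    refine integral_congr_ae ?_
    filter_upwards [Lp.coeFn_add (V.1 0) (t • Φ.1 0), Lp.coeFn_smul t (Φ.1 0)] with x h1 h2
    have h3 : (V + t • Φ).1 0 x = V.1 0 x + t * Φ.1 0 x := by
      change (V.1 0 + t • Φ.1 0 : HalfL2) x = _
      rw [h1, Pi.add_apply, h2]; rfl
    rw [h3]
  have hG0 : G 0 = y ^ p := by rw [hGt, zero_smul, add_zero]
  have hGpos : 0 < G 0 := by rw [hG0]; positivity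
  have hpow : HasDerivAt (fun t => G t ^ (2 / p)) (p * I * (2 / p) * G 0 ^ (2 / p - 1)) 0 :=
    hder.rpow_const (Or.inl hGpos.ne')
  set N : ℝ → ℝ := fun t => jetForm lam q (V + t • Φ).1 (V + t • Φ).1 with hN
  have hNt : ∀ t, N t = jetForm lam q V.1 V.1 + t * (2 * jetForm lam q V.1 Φ.1)
      + t ^ 2 * jetForm lam q Φ.1 Φ.1 := by
    intro t
    have h1 : N t = jetForm lam q (V.1 + t • Φ.1) (V.1 + t • Φ.1) := rfl
    rw [h1, jetForm_add_self, jetForm_smul_right, jetForm_smul_self]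
    ring
  have hNder : HasDerivAt N (2 * jetForm lam q V.1 Φ.1) 0 := by
    have h1 := (((hasDerivAt_id (0 : ℝ)).mul_const (2 * jetForm lam q V.1 Φ.1)).const_add
      (jetForm lam q V.1 V.1)).fun_add ((hasDerivAt_pow 2 (0 : ℝ)).mul_const (jetForm lam q Φ.1 Φ.1))
    have h2 : N = fun t => jetForm lam q V.1 V.1 + id t * (2 * jetForm lam q V.1 Φ.1)
      + t ^ 2 * jetForm lam q Φ.1 Φ.1 := funext hNt
    rw [h2]
    exact h1.congr_deriv (by simp)
  have hf := hNder.fun_sub (hpow.const_mul (y ^ (p - 2)))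
  have hmin : IsLocalMin (fun t => N t - y ^ (p - 2) * G t ^ (2 / p)) 0 := by
    refine Eventually.of_forall fun t => ?_
    have e : ∀ t, G t ^ (2 / p) = ‖lpEmb p (V + t • Φ)‖ ^ 2 := fun t => by
      rw [hGt, ← Real.rpow_mul (norm_nonneg _), mul_div_cancel₀ _ hp0.ne', Real.rpow_two]
    have h0 : N 0 - y ^ (p - 2) * G 0 ^ (2 / p) = 0 := by
      have e1 : y ^ (p - 2) * y ^ 2 = y ^ p := by
        rw [← Real.rpow_natCast y 2, ← Real.rpow_add hy0]; norm_num
      rw [e, zero_smul, add_zero, hNt, h.nehari, ← hy, e1]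
      ring
    change N 0 - y ^ (p - 2) * G 0 ^ (2 / p) ≤ N t - y ^ (p - 2) * G t ^ (2 / p)
    rw [h0, e]
    linarith [h.le (V + t • Φ)]
  have h0 := hmin.hasDerivAt_eq_zero hf
  have e2 : y ^ (p - 2) * (p * I * (2 / p) * G 0 ^ (2 / p - 1)) = 2 * I := by
    -- S = y^(p-2) exactly cancels the factor from differentiating the power 2/p of G, as the
    -- exponents of y add up to 0.
    have e3 : y ^ (p - 2) * G 0 ^ (2 / p - 1) = 1 := by
      rw [hG0, ← Real.rpow_mul hy0.le, ← Real.rpow_add hy0]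
      rw [show p - 2 + p * (2 / p - 1) = 0 by field_simp; ring, Real.rpow_zero]
    calc y ^ (p - 2) * (p * I * (2 / p) * G 0 ^ (2 / p - 1))
        = (p * (2 / p)) * I * (y ^ (p - 2) * G 0 ^ (2 / p - 1)) := by ring
      _ = 2 * I := by rw [e3, mul_div_cancel₀ _ hp0.ne', mul_one]
  rw [e2] at h0
  linarith

theorem IsJet.integral_rpow {u : Plane → ℝ} {U : jetSpace} (h : IsJet u U.1) :
    ∫ x, |u x| ^ p ∂halfVolume = ‖lpEmb p U‖ ^ p := by
  rw [norm_lpEmb_rpow]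
  refine integral_congr_ae ?_
  filter_upwards [h.ae_eq] with x hx
  rw [hx]

theorem IsJet.lpEmb_eq_zero_iff {u : Plane → ℝ} {U : jetSpace} (h : IsJet u U.1) :
    lpEmb p U = 0 ↔ u =ᵐ[halfVolume] 0 := by
  rw [Lp.eq_zero_iff_ae_eq_zero]
  have := h.ae_eq.trans (coeFn_lpEmb (p := p) U).symm
  exact ⟨fun h0 => this.trans h0, fun h0 => this.symm.trans h0⟩

theorem IsJet.energy_eq {u : Plane → ℝ} {U : jetSpace} (h : IsJet u U.1) (lam q : ℝ) :
    energy p lam q u = 1 / 2 * jetForm lam q U.1 U.1 - 1 / p * ‖lpEmb p U‖ ^ p := by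
  rw [energy, h.form_eq h, h.integral_rpow]

/-- Solutions lie on the Nehari manifold. -/
theorem IsJet.nehari {u : Plane → ℝ} {U : jetSpace} (h : IsJet u U.1) {lam q : ℝ}
    (hu : IsWeakSolution p lam q u) : jetForm lam q U.1 U.1 = ‖lpEmb p U‖ ^ p := by
  rw [← h.form_eq h, hu.2 u hu.1, ← h.integral_rpow]
  simp only [abs_rpow_mul_self_mul_self hp.out]

/-- On the Nehari manifold the energy is (1/2 - 1/p) ‖·‖_p^p, and the Rayleigh inequality for
another solution W, whose form equals ‖W‖_p^p, forces ‖V‖_p ≤ ‖W‖_p. -/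
theorem IsMinimizer.isLeastEnergySolution {lam q : ℝ} {v : Plane → ℝ} {V : jetSpace}
    (h : IsMinimizer p lam q V) (hv : IsJet v V.1) : IsLeastEnergySolution p lam q v := by
  refine ⟨⟨⟨hv.memHPlus, fun φ hφ => ?_⟩, fun h0 => ?_⟩, fun w hw => ?_⟩
  · obtain ⟨Φ, hΦ⟩ := exists_isJet_of_memHPlus hφ
    rw [hv.form_eq hΦ, h.jetForm_eq ⟨Φ, hΦ.mem⟩]
    refine integral_congr_ae ?_
    filter_upwards [hv.ae_eq, hΦ.ae_eq] with x h1 h2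
    rw [h1, h2]
  · have := h.pos
    rw [hv.lpEmb_eq_zero_iff.2 h0, norm_zero] at this
    exact this.false
  · obtain ⟨W₀, hW₀⟩ := exists_isJet_of_memHPlus hw.1.1
    obtain ⟨W, rfl⟩ : ∃ W : jetSpace, W.1 = W₀ := ⟨⟨W₀, hW₀.mem⟩, rfl⟩
    have hWN := hW₀.nehari hw.1
    rw [hv.energy_eq, hW₀.energy_eq, hWN, h.nehari]
    have hW0 : 0 < ‖lpEmb p W‖ := norm_pos_iff.2 fun h0 => hw.2 (hW₀.lpEmb_eq_zero_iff.1 h0)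
    have hle : ‖lpEmb p V‖ ≤ ‖lpEmb p W‖ :=
      le_of_rpow_sq_le (norm_nonneg _) hW0 hp.out ((h.le W).trans hWN.le)
    have hle2 : ‖lpEmb p V‖ ^ p ≤ ‖lpEmb p W‖ ^ p :=
      Real.rpow_le_rpow (norm_nonneg _) hle (by linarith [hp.out])
    nlinarith [half_sub_one_div_pos hp.out]

/-- Some minimizer V exists and is itself a solution. Comparing energies in both directions gives U
and V the same Lᵖ norm, hence the same constant in the Rayleigh inequality. -/
theorem IsLeastEnergySolution.isMinimizer {lam q : ℝ} (hlam : lam ≠ 0) (hq : 0 ≤ q)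
    {u : Plane → ℝ} {U : jetSpace} (hu : IsLeastEnergySolution p lam q u) (hU : IsJet u U.1) :
    IsMinimizer p lam q U := by
  have hU0 : lpEmb p U ≠ 0 := fun h0 => hu.1.2 (hU.lpEmb_eq_zero_iff.1 h0)
  obtain ⟨V, hV⟩ := exists_isMinimizer hlam hq ⟨U, hU0⟩
  have hUN := hU.nehari hu.1.1
  have hUpos : 0 < ‖lpEmb p U‖ := norm_pos_iff.2 hU0
  have hle : ‖lpEmb p V‖ ≤ ‖lpEmb p U‖ :=
    le_of_rpow_sq_le (norm_nonneg _) hUpos hp.out ((hV.le U).trans hUN.le)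
  have hge : ‖lpEmb p U‖ ≤ ‖lpEmb p V‖ := by
    have hVj : IsJet (V.1 0) V.1 := isJet_self V.2
    have h1 := hu.2 _ (hV.isLeastEnergySolution hVj).1
    rw [hU.energy_eq, hVj.energy_eq, hUN, hV.nehari] at h1
    have h2 : ‖lpEmb p U‖ ^ p ≤ ‖lpEmb p V‖ ^ p := by
      nlinarith [half_sub_one_div_pos hp.out]
    exact (Real.rpow_le_rpow_iff (norm_nonneg _) (norm_nonneg _) (by linarith [hp.out])).1 h2
  have e := le_antisymm hle hge
  exact ⟨hUpos, hUN, fun W => by rw [← e]; exact hV.le W⟩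

end Variational

/-! ### Dilations -/

theorem measurableEmbedding_dilation {c : ℝ} (hc : 0 < c) :
    MeasurableEmbedding fun x : Plane => c • x := measurableEmbedding_const_smul₀ hc.ne'

theorem measurePreserving_dilation {c : ℝ} (hc : 0 < c) :
    MeasurePreserving (fun x : Plane => c • x) halfVolume (ENNReal.ofReal (c ^ 2)⁻¹ • halfVolume) := by
  refine ⟨(measurableEmbedding_dilation hc).measurable, ?_⟩
  have h1 : (fun x : Plane => c • x) ⁻¹' halfPlane = halfPlane := by
    ext x
    simp [halfPlane, hc]
  have h2 := (measurableEmbedding_dilation hc).restrict_map volume halfPlane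
  rw [h1, Measure.map_addHaar_smul _ hc.ne', Measure.restrict_smul] at h2
  rw [halfVolume, ← h2]
  simp [abs_of_pos hc]

theorem ae_dilation {c : ℝ} (hc : 0 < c) {P : Plane → Prop} (h : ∀ᵐ x ∂halfVolume, P x) :
    ∀ᵐ x ∂halfVolume, P (c • x) :=
  (measurePreserving_dilation hc).quasiMeasurePreserving.ae (Measure.ae_smul_measure h _)

theorem integral_dilation {c : ℝ} (hc : 0 < c) (f : Plane → ℝ) :
    ∫ x, f (c • x) ∂halfVolume = (c ^ 2)⁻¹ * ∫ x, f x ∂halfVolume := by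
  rw [(measurePreserving_dilation hc).integral_comp (measurableEmbedding_dilation hc),
    integral_smul_measure, ENNReal.toReal_ofReal (by positivity), smul_eq_mul]

theorem memLp_dilation {c : ℝ} (hc : 0 < c) {f : Plane → ℝ} (hf : MemLp f 2 halfVolume) :
    MemLp (fun x => f (c • x)) 2 halfVolume :=
  (hf.smul_measure ENNReal.ofReal_ne_top).comp_measurePreserving (measurePreserving_dilation hc)

theorem eLpNorm_dilation {c : ℝ} (hc : 0 < c) {f : Plane → ℝ}
    (hf : AEStronglyMeasurable f halfVolume) :
    eLpNorm (fun x => f (c • x)) 2 halfVolume =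
      ENNReal.ofReal (c ^ 2)⁻¹ ^ (1 / 2 : ℝ≥0∞).toReal * eLpNorm f 2 halfVolume := by
  have := eLpNorm_comp_measurePreserving (p := 2) (hf.smul_measure (ENNReal.ofReal (c ^ 2)⁻¹))
    (measurePreserving_dilation hc)
  rw [eLpNorm_smul_measure_of_ne_top (by simp)] at this
  simpa using! this

theorem IsTestFunction.dilation {φ : Plane → ℝ} (h : IsTestFunction φ) {c : ℝ} (hc : 0 < c) :
    IsTestFunction fun x => φ (c • x) := by
  refine ⟨h.contDiff.comp (contDiff_const_smul c), h.2.1.comp_smul hc.ne', ?_⟩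
  intro x hx
  have hsub := tsupport_comp_subset_preimage φ (continuous_const_smul c : Continuous fun x : Plane => c • x)
  have := h.2.2 (hsub hx)
  simpa [halfPlane, hc] using this

/-- The homogeneity of the components of a jet under a dilation by `c`. -/
def dilationWeight (c : ℝ) : Fin 4 → ℝ := ![1, c, c, 1]

theorem jet_dilation {φ : Plane → ℝ} (c : ℝ) (j : Fin 4) (x : Plane) :
    jet (fun x => φ (c • x)) j x = dilationWeight c j * jet φ j (c • x) := by
  fin_cases j <;> simp [jet, dilationWeight, partialDeriv_comp_smul]
  ring

/-- The dilation `U ↦ U (c ·)` acts on jets. -/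
theorem exists_dilation (U : jetSpace) {c : ℝ} (hc : 0 < c) :
    ∃ V : jetSpace, ∀ j, V.1 j =ᵐ[halfVolume] fun x => dilationWeight c j * U.1 j (c • x) := by
  obtain ⟨φ, hφ, -, hlim, -⟩ := exists_seq_of_mem_jetSpace U.2
  have hG : ∀ j, MemLp (fun x => dilationWeight c j * U.1 j (c • x)) 2 halfVolume := fun j =>
    (memLp_dilation hc (Lp.memLp (U.1 j))).const_mul _
  refine ⟨⟨_, mem_jetSpace_of_tendsto hG (fun n => (hφ n).dilation hc) fun j => ?_⟩,
    fun j => (hG j).coeFn_toLp⟩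
  have h1 : ∀ n, eLpNorm (fun x => jet (fun x => φ n (c • x)) j x - dilationWeight c j * U.1 j (c • x))
      2 halfVolume = ‖dilationWeight c j‖ₑ * (ENNReal.ofReal (c ^ 2)⁻¹ ^ (1 / 2 : ℝ≥0∞).toReal *
        eLpNorm (fun x => jet (φ n) j x - U.1 j x) 2 halfVolume) := by
    intro n
    have hm : AEStronglyMeasurable (fun x => jet (φ n) j x - U.1 j x) halfVolume :=
      (((hφ n).jet j).memLp 2).1.sub (Lp.memLp (U.1 j)).1
    rw [← eLpNorm_dilation hc hm, ← eLpNorm_const_smul]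
    congr 1
    funext x
    simp only [jet_dilation, Pi.smul_apply, smul_eq_mul]
    ring
  simp only [h1]
  have h2 := ENNReal.Tendsto.const_mul (a := ‖dilationWeight c j‖ₑ) (ENNReal.Tendsto.const_mul
    (a := ENNReal.ofReal (c ^ 2)⁻¹ ^ (1 / 2 : ℝ≥0∞).toReal) (hlim j) (Or.inr (by simp)))
    (Or.inr enorm_ne_top)
  simpa using h2

theorem norm_sq_of_dilation {F G : HalfL2} {c w : ℝ} (hc : 0 < c)
    (h : F =ᵐ[halfVolume] fun x => w * G (c • x)) : ‖F‖ ^ 2 = w ^ 2 * ((c ^ 2)⁻¹ * ‖G‖ ^ 2) := by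
  rw [← real_inner_self_eq_norm_sq, ← real_inner_self_eq_norm_sq, inner_halfL2, inner_halfL2,
    ← integral_dilation hc, ← integral_const_mul]
  refine integral_congr_ae ?_
  filter_upwards [h] with x hx
  rw [hx]; ring

/-- In the plane the Dirichlet integral is invariant under dilations, while the angular and the L²
integrals are divided by c². -/
theorem jetForm_of_dilation {U V : jetSpace} {c : ℝ} (hc : 0 < c)
    (h : ∀ j, V.1 j =ᵐ[halfVolume] fun x => dilationWeight c j * U.1 j (c • x)) (lam q : ℝ) :
    jetForm lam q V.1 V.1 = jetForm (c * lam) (q / c ^ 2) U.1 U.1 := by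
  rw [jetForm_self, jetForm_self, norm_sq_of_dilation hc (h 0), norm_sq_of_dilation hc (h 1),
    norm_sq_of_dilation hc (h 2), norm_sq_of_dilation hc (h 3)]
  simp only [dilationWeight, Matrix.cons_val, mul_pow]
  field_simp

theorem eq_rpow_mul_of_rpow_eq {p k x y : ℝ} (hp : 0 < p) (hx : 0 ≤ x) (hy : 0 ≤ y) (hk : 0 ≤ k)
    (h : x ^ p = k * y ^ p) : x = k ^ (1 / p) * y := by
  rw [← Real.rpow_left_inj hx (by positivity) hp.ne', h, Real.mul_rpow (by positivity) hy,
    ← Real.rpow_mul hk, one_div_mul_cancel hp.ne', Real.rpow_one]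

section

variable {p : ℝ} [hp : Fact (2 < p)]

theorem norm_lpEmb_of_dilation {U V : jetSpace} {c : ℝ} (hc : 0 < c)
    (h : ∀ j, V.1 j =ᵐ[halfVolume] fun x => dilationWeight c j * U.1 j (c • x)) :
    ‖lpEmb p V‖ ^ p = (c ^ 2)⁻¹ * ‖lpEmb p U‖ ^ p := by
  rw [norm_lpEmb_rpow, norm_lpEmb_rpow, ← integral_dilation hc]
  refine integral_congr_ae ?_
  filter_upwards [h 0] with x hx
  rw [hx]; simp [dilationWeight]

/-- Rescaling turns minimizers for `(lam, 1)` into minimizers for `(1, lam ^ 2)`. -/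
theorem IsMinimizer.exists_rescale {lam : ℝ} (hlam : 0 < lam) {U : jetSpace}
    (hU : IsMinimizer p lam 1 U) {u : Plane → ℝ} (hu : IsJet u U.1) :
    ∃ V : jetSpace, IsJet (rescale p lam u) V.1 ∧ IsMinimizer p 1 (lam ^ 2) V := by
  have hp0 : 0 < p := by linarith [hp.out]
  have hp2 : 0 < p - 2 := by linarith [hp.out]
  obtain ⟨V, hV⟩ := exists_dilation U hlam
  set c := lam ^ (2 / (p - 2)) with hc
  have hcpos : 0 < c := by positivity
  -- The exponent 2/(p-2) of the amplitude is chosen for this relation, which balances the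
  -- nonlinearity against the dilation.
  have hcp : c ^ (p - 2) = lam ^ 2 := by
    rw [hc, ← Real.rpow_mul hlam.le, div_mul_cancel₀ _ hp2.ne', Real.rpow_two]
  have hjet : IsJet (fun x => u (lam • x)) V.1 := by
    refine ⟨V.2, ?_⟩
    filter_upwards [hV 0, ae_dilation hlam hu.ae_eq] with x h1 h2
    rw [h1, h2]; simp [dilationWeight]
  have hsplit : ∀ z : ℝ, 0 < z → z ^ p = z ^ (p - 2) * z ^ 2 := fun z hz => by
    rw [← Real.rpow_natCast z 2, ← Real.rpow_add hz]; norm_num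
  have hTV : ‖lpEmb p (c • V)‖ ^ p = c ^ 2 * ‖lpEmb p U‖ ^ p := by
    rw [map_smul, norm_smul, Real.norm_of_nonneg hcpos.le, Real.mul_rpow hcpos.le (norm_nonneg _),
      norm_lpEmb_of_dilation hlam hV, hsplit c hcpos, hcp]
    field_simp
  have hTpos : 0 < ‖lpEmb p (c • V)‖ := by
    refine (norm_nonneg _).lt_of_ne' fun h0 => ?_
    rw [h0, Real.zero_rpow hp0.ne'] at hTV
    have := Real.rpow_pos_of_pos hU.pos p
    exact absurd hTV (by positivity)
  refine ⟨c • V, hjet.const_mul c, hTpos, ?_, fun W => ?_⟩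
  · rw [hTV, jetForm_smul_coe, jetForm_of_dilation hlam hV, mul_one, div_self (by positivity), hU.nehari]
  -- Competitors are pulled back by the inverse dilation to the original problem.
  · obtain ⟨W', hW'⟩ := exists_dilation W (inv_pos.2 hlam)
    have h1 := hU.le W'
    rw [jetForm_of_dilation (inv_pos.2 hlam) hW', inv_mul_cancel₀ hlam.ne', inv_pow, one_div, inv_inv] at h1
    refine le_trans (le_of_eq ?_) h1
    have hW2 := norm_lpEmb_of_dilation (p := p) (inv_pos.2 hlam) hW'
    rw [inv_pow, inv_inv] at hW2
    rw [eq_rpow_mul_of_rpow_eq hp0 (norm_nonneg _) (norm_nonneg _) (by positivity) hTV,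
      eq_rpow_mul_of_rpow_eq hp0 (norm_nonneg _) (norm_nonneg _) (by positivity) hW2,
      Real.mul_rpow (by positivity) (norm_nonneg _), mul_pow,
      -- The factor gained by the constant ‖V‖_p^(p-2) and the one gained by ‖W‖_p² agree because
      -- c^(p-2) = lam².
      show ((c ^ 2) ^ (1 / p)) ^ (p - 2) = ((lam ^ 2) ^ (1 / p)) ^ 2 from ?_]
    · ring
    · have e1 : (c ^ 2) ^ (p - 2) = (lam ^ 2) ^ 2 := by
        rw [← hcp, ← Real.rpow_natCast c 2, ← Real.rpow_mul hcpos.le, mul_comm, Real.rpow_mul hcpos.le,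
          Real.rpow_natCast]
      rw [← Real.rpow_mul (by positivity), mul_comm, Real.rpow_mul (by positivity), e1,
        ← Real.rpow_natCast (lam ^ 2) 2, ← Real.rpow_mul (by positivity), mul_comm,
        Real.rpow_mul (by positivity), Real.rpow_natCast]

end

/-! ### Convergence of minimizers -/

theorem jetForm_self_eq_add (lam q : ℝ) (U : Fin 4 → HalfL2) :
    jetForm lam q U U = jetForm lam 0 U U + q * ‖U 0‖ ^ 2 := by
  rw [jetForm_self, jetForm_self]; ring

section

variable {p : ℝ} [hp : Fact (2 < p)]

/-- The Lᵖ norms stay away from zero by coercivity at q = 0 and the embedding, and they stay bounded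
by comparison with the one competitor V 0, where qₖ ≤ 1 enters. So the Lᵖ limit g is nonzero. The
Rayleigh inequality passes to the limit for each fixed competitor, and
`exists_tendsto_of_minimizing` upgrades the convergence. -/
theorem exists_tendsto_isMinimizer {q : ℕ → ℝ} (hq0 : ∀ k, 0 ≤ q k) (hq1 : ∀ k, q k ≤ 1)
    (hq : Tendsto q atTop (𝓝 0)) {V : ℕ → jetSpace} (hV : ∀ k, IsMinimizer p 1 (q k) (V k)) :
    ∃ (s : ℕ → ℕ) (W : jetSpace), StrictMono s ∧ Tendsto (fun k => V (s k)) atTop (𝓝 W) ∧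
      IsMinimizer p 1 0 W := by
  have hp0 : 0 < p := by linarith [hp.out]
  have hp2 : 0 < p - 2 := by linarith [hp.out]
  obtain ⟨c, hc, hcoer⟩ := exists_coercive (lam := 1) (q := 0) one_ne_zero le_rfl
  obtain ⟨K, hK, hKT⟩ := exists_norm_lpEmb_le (p := p)
  have hsplit : ∀ z : ℝ, 0 < z → z ^ p = z ^ (p - 2) * z ^ 2 := fun z hz => by
    rw [← Real.rpow_natCast z 2, ← Real.rpow_add hz]; norm_num
  have hN : ∀ k (U : jetSpace), jetForm 1 0 U.1 U.1 ≤ jetForm 1 (q k) U.1 U.1 := fun k U => by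
    rw [jetForm_self_eq_add 1 (q k)]
    have := mul_nonneg (hq0 k) (sq_nonneg ‖U.1 0‖)
    linarith
  have hNV : ∀ k, jetForm 1 0 (V k).1 (V k).1 ≤ ‖lpEmb p (V k)‖ ^ p := fun k =>
    (hN k _).trans (hV k).nehari.le
  have hlow : ∀ k, (K ^ 2 * c)⁻¹ ≤ ‖lpEmb p (V k)‖ ^ (p - 2) := fun k => by
    have hpos := (hV k).pos
    have h1 : ‖lpEmb p (V k)‖ ^ 2 ≤ K ^ 2 * (c * ‖lpEmb p (V k)‖ ^ p) := by
      calc ‖lpEmb p (V k)‖ ^ 2 ≤ (K * ‖(V k).1‖) ^ 2 := by gcongr; exact hKT (V k)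
        _ = K ^ 2 * ‖(V k).1‖ ^ 2 := by ring
        _ ≤ K ^ 2 * (c * ‖lpEmb p (V k)‖ ^ p) := by
          gcongr
          exact (hcoer _ (V k).2).trans (by gcongr; exact hNV k)
    rw [hsplit _ hpos] at h1
    rw [inv_le_iff_one_le_mul₀ (by positivity)]
    refine le_of_mul_le_mul_right ?_ (by positivity : 0 < ‖lpEmb p (V k)‖ ^ 2)
    linarith
  have hup : ∀ k, ‖lpEmb p (V k)‖ ^ (p - 2) ≤ jetForm 1 1 (V 0).1 (V 0).1 / ‖lpEmb p (V 0)‖ ^ 2 := fun k => by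
    have hpos := (hV 0).pos
    rw [le_div_iff₀ (by positivity)]
    refine ((hV k).le (V 0)).trans ?_
    rw [jetForm_self_eq_add 1 (q k), jetForm_self_eq_add 1 1]
    have := mul_le_mul_of_nonneg_right (hq1 k) (sq_nonneg ‖(V 0).1 0‖)
    linarith
  set B := jetForm 1 1 (V 0).1 (V 0).1 / ‖lpEmb p (V 0)‖ ^ 2
  have hB : 0 ≤ B := (Real.rpow_nonneg (norm_nonneg _) _).trans (hup 0)
  have hy : ∀ k, ‖lpEmb p (V k)‖ ≤ B ^ (1 / (p - 2)) := fun k => by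
    rw [one_div]
    exact (Real.le_rpow_inv_iff_of_pos (norm_nonneg _) hB hp2).2 (hup k)
  have hbd : ∀ k, ‖V k‖ ≤ Real.sqrt (c * (B ^ (1 / (p - 2))) ^ p) := fun k => by
    refine Real.le_sqrt_of_sq_le ((hcoer _ (V k).2).trans ?_)
    gcongr
    exact (hNV k).trans (Real.rpow_le_rpow (norm_nonneg _) (hy k) hp0.le)
  obtain ⟨g, s, hs, hg⟩ := exists_subseq_tendsto_lpEmb (p := p) hbd
  have hpow : ∀ r : ℝ, 0 < r → Tendsto (fun k => ‖lpEmb p (V (s k))‖ ^ r) atTop (𝓝 (‖g‖ ^ r)) :=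
    fun r hr => hg.norm.rpow_const (Or.inr hr.le)
  have hgpos : 0 < ‖g‖ := by
    have h1 : (K ^ 2 * c)⁻¹ ≤ ‖g‖ ^ (p - 2) := ge_of_tendsto' (hpow _ hp2) fun k => hlow (s k)
    refine (norm_nonneg g).lt_of_ne' fun h0 => ?_
    rw [h0, Real.zero_rpow hp2.ne'] at h1
    exact absurd h1 (not_le.2 (by positivity))
  have hS : ∀ W : jetSpace, ‖g‖ ^ (p - 2) * ‖lpEmb p W‖ ^ 2 ≤ jetForm 1 0 W.1 W.1 := fun W => by
    have h1 := (hpow _ hp2).mul_const (‖lpEmb p W‖ ^ 2)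
    have h2 : Tendsto (fun k => jetForm 1 0 W.1 W.1 + q (s k) * ‖W.1 0‖ ^ 2) atTop
        (𝓝 (jetForm 1 0 W.1 W.1 + 0 * ‖W.1 0‖ ^ 2)) :=
      ((hq.comp hs.tendsto_atTop).mul_const _).const_add _
    have h3 := le_of_tendsto_of_tendsto' h1 h2 fun k => by
      rw [← jetForm_self_eq_add]; exact (hV (s k)).le W
    simpa using h3
  obtain ⟨W, hW, hWg, hWN⟩ := exists_tendsto_of_minimizing one_ne_zero le_rfl hS hg
    (a := fun k => ‖lpEmb p (V (s k))‖ ^ p) (by rw [← hsplit _ hgpos]; exact hpow p hp0)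
    fun k => hNV (s k)
  refine ⟨s, W, hs, hW, by rwa [hWg], ?_, fun U => by rw [hWg]; exact hS U⟩
  rw [hWN, hWg, hsplit _ hgpos]

end

/-- Convergence of jets is convergence in `H⁺`. -/
theorem tendstoHPlus_of_isJet {v : ℕ → Plane → ℝ} {w : Plane → ℝ} {V : ℕ → jetSpace} {W : jetSpace}
    (hv : ∀ k, IsJet (v k) (V k).1) (hw : IsJet w W.1) (h : Tendsto V atTop (𝓝 W)) :
    TendstoHPlus v w := by
  refine ⟨fun k => (hv k).memHPlus, hw.memHPlus, ?_⟩
  have h1 : ∀ k, formNorm 1 1 (fun x => v k x - w x) = √(jetForm 1 1 (V k - W).1 (V k - W).1) :=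
    fun k => by rw [formNorm, ((hv k).sub hw).form_eq ((hv k).sub hw)]; rfl
  simp only [h1]
  have h2 := (Real.continuous_sqrt.comp (continuous_jetForm_self 1 1)).tendsto (W - W)
  have h3 := h2.comp (h.sub_const W)
  refine h3.trans_eq ?_
  rw [Function.comp_apply, sub_self, jetForm_self]
  simp

/-! ### The strong maximum principle -/

theorem jet_comp_mul {g : ℝ → ℝ} (hg : Differentiable ℝ g) {ψ χ : Plane → ℝ}
    (hψ : Differentiable ℝ ψ) (hχ : Differentiable ℝ χ) (j : Fin 4) (x : Plane) :
    jet (fun x => g (ψ x) * χ x) j x =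
      g (ψ x) * jet χ j x + if j = 0 then 0 else χ x * deriv g (ψ x) * jet ψ j x := by
  have h := fun i => partialDeriv_mul (hg.comp hψ) hχ i x
  have h2 := fun i => partialDeriv_comp hψ i x (hg (ψ x)).hasDerivAt
  simp only [Function.comp_def, h2] at h
  fin_cases j <;> simp [jet, h] <;> ring

/-- Makes χ g(V) an admissible test element. The bounds on g and g' let the product and chain rules
pass from test functions to the limit in L². -/
theorem exists_jet_comp_mul {g : ℝ → ℝ} (hg : ContDiff ℝ ∞ g) {C : ℝ} (hC : ∀ t, |g t| ≤ C)
    (hC' : ∀ t, |deriv g t| ≤ C) {χ : Plane → ℝ} (hχ : IsTestFunction χ) {V : Fin 4 → HalfL2}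
    (hV : V ∈ jetSpace) : ∃ Φ ∈ jetSpace, ∀ j, Φ j =ᵐ[halfVolume] fun x =>
      g (V 0 x) * jet χ j x + if j = 0 then 0 else χ x * deriv g (V 0 x) * V j x := by
  obtain ⟨ψ, hψ, -, hlim, hae⟩ := exists_seq_of_mem_jetSpace hV
  have hgd : Differentiable ℝ g := hg.differentiable (by simp)
  have hg' : Continuous (deriv g) := hg.continuous_deriv (by simp)
  have hV0 : AEStronglyMeasurable (V 0) halfVolume := (Lp.memLp (V 0)).1
  have hgV : AEStronglyMeasurable (fun x => g (V 0 x)) halfVolume :=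
    hg.continuous.comp_aestronglyMeasurable hV0
  have hgV' : AEStronglyMeasurable (fun x => χ x * deriv g (V 0 x)) halfVolume :=
    hχ.continuous.aestronglyMeasurable.mul (hg'.comp_aestronglyMeasurable hV0)
  obtain ⟨D, hD⟩ := hχ.2.1.exists_bound_of_continuous hχ.continuous
  have hC0 : 0 ≤ C := (abs_nonneg _).trans (hC 0)
  have hD0 : 0 ≤ D := (norm_nonneg _).trans (hD 0)
  have hχC : ∀ x t, |χ x * deriv g t| ≤ D * C := fun x t => by
    rw [abs_mul]
    exact mul_le_mul (hD x) (hC' t) (abs_nonneg _) hD0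
  have h0 : ∀ᵐ x ∂halfVolume, Tendsto (fun n => ψ n x) atTop (𝓝 (V 0 x)) := hae 0
  have h1 : ∀ j, Tendsto (fun n => eLpNorm (fun x => g (ψ n x) * jet χ j x - g (V 0 x) * jet χ j x)
      2 halfVolume) atTop (𝓝 0) := fun j =>
    tendsto_eLpNorm_mul_sub (C := C) (g := fun _ => jet χ j)
      (fun n => (hg.continuous.comp (hψ n).continuous).aestronglyMeasurable) hgV
      (fun _ => ((hχ.jet j).memLp 2).1) ((hχ.jet j).memLp 2) (fun n => Eventually.of_forall fun x => hC _)
      (h0.mono fun x hx => (hg.continuous.tendsto _).comp hx) (by simp)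
  have h2 : ∀ j, Tendsto (fun n => eLpNorm (fun x => χ x * deriv g (ψ n x) * jet (ψ n) j x -
      χ x * deriv g (V 0 x) * V j x) 2 halfVolume) atTop (𝓝 0) := fun j =>
    tendsto_eLpNorm_mul_sub (C := D * C) (g := fun n => jet (ψ n) j)
      (fun n => (hχ.continuous.mul (hg'.comp (hψ n).continuous)).aestronglyMeasurable) hgV'
      (fun n => (((hψ n).jet j).memLp 2).1) (Lp.memLp (V j))
      (fun n => Eventually.of_forall fun x => hχC _ _)
      (h0.mono fun x hx => ((hg'.tendsto _).comp hx).const_mul _) (hlim j)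
  have hm1 : ∀ j, MemLp (fun x => g (V 0 x) * jet χ j x) 2 halfVolume := fun j =>
    ((hχ.jet j).memLp 2).of_le_mul (c := C) (hgV.mul ((hχ.jet j).memLp 2).1)
      (Eventually.of_forall fun x => by rw [norm_mul]; gcongr; exact hC _)
  have hm2 : ∀ j, MemLp (fun x => χ x * deriv g (V 0 x) * V j x) 2 halfVolume := fun j =>
    (Lp.memLp (V j)).of_le_mul (c := D * C) (hgV'.mul (Lp.memLp (V j)).1)
      (Eventually.of_forall fun x => by rw [norm_mul]; gcongr; exact hχC _ _)
  have hG : ∀ j : Fin 4, MemLp (fun x => g (V 0 x) * jet χ j x +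
      if j = 0 then 0 else χ x * deriv g (V 0 x) * V j x) 2 halfVolume := fun j => by
    split_ifs
    · simpa using hm1 j
    · exact (hm1 j).add (hm2 j)
  refine ⟨_, mem_jetSpace_of_tendsto hG (φ := fun n x => g (ψ n x) * χ x)
    (fun n => hχ.mul_left (hg.comp (hψ n).contDiff)) fun j => ?_, fun j => (hG j).coeFn_toLp⟩
  simp only [jet_comp_mul hgd (hψ _).differentiable hχ.differentiable]
  by_cases hj : j = 0
  · simpa only [hj, if_true, add_zero] using h1 0
  · simp only [hj, if_false]
    refine tendsto_eLpNorm_zero_of_le zero_le_one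
      (fun n => ((hg.continuous.comp (hψ n).continuous).aestronglyMeasurable.mul
        ((hχ.jet j).memLp 2).1).sub (hm1 j).1)
      (fun n => ((hχ.continuous.mul (hg'.comp (hψ n).continuous)).aestronglyMeasurable.mul
        (((hψ n).jet j).memLp 2).1).sub (hm2 j).1) (fun n => Eventually.of_forall fun x => ?_) (h1 j) (h2 j)
    rw [one_mul]
    refine le_trans (le_of_eq ?_) (abs_add_le _ _)
    congr 1
    simp only [Pi.sub_apply, Pi.mul_apply, Function.comp_apply]
    ring

/-- A nonnegative supersolution of `-Δv - ∂_θ² v = 0`. -/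
structure IsSupersolution (V : Fin 4 → HalfL2) : Prop where
  mem : V ∈ jetSpace
  nonneg : ∀ᵐ x ∂halfVolume, 0 ≤ V 0 x
  form_nonneg : ∀ Φ ∈ jetSpace, (∀ᵐ x ∂halfVolume, 0 ≤ Φ 0 x) → 0 ≤ jetForm 1 0 V Φ

/-- The inequality g² ≤ 4 |g'| for g = arccot, which lets the cross term be absorbed in the
Caccioppoli estimate. It follows from Jordan's inequality sin x ≥ 2x/π and π < 4. -/
theorem sq_arccot_le {t : ℝ} (ht : 0 ≤ t) :
    (Real.pi / 2 - Real.arctan t) ^ 2 ≤ 4 * (1 + t ^ 2)⁻¹ := by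
  have h0 := Real.arctan_lt_pi_div_two t
  have h1 := Real.arctan_nonneg.2 ht
  have h2 := Real.mul_le_sin (x := Real.pi / 2 - Real.arctan t) (by linarith) (by linarith)
  rw [Real.sin_pi_div_two_sub, div_mul_eq_mul_div, div_le_iff₀ Real.pi_pos] at h2
  have h3 : 0 ≤ Real.cos (Real.arctan t) := (Real.cos_arctan_pos t).le
  have h4 : Real.pi / 2 - Real.arctan t ≤ 2 * Real.cos (Real.arctan t) := by
    nlinarith [Real.pi_lt_four]
  calc (Real.pi / 2 - Real.arctan t) ^ 2 ≤ (2 * Real.cos (Real.arctan t)) ^ 2 := by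
        gcongr
    _ = 4 * (1 + t ^ 2)⁻¹ := by rw [mul_pow, Real.cos_sq_arctan]; norm_num

/-- A logarithmic Caccioppoli inequality for nonnegative supersolutions. -/
theorem exists_caccioppoli {φ : Plane → ℝ} (hφ : IsTestFunction φ) :
    ∃ C : ℝ, ∀ V, IsSupersolution V → ∀ j ≠ 0,
      ∫ x, φ x ^ 2 * ((1 + V 0 x ^ 2)⁻¹ * V j x ^ 2) ∂halfVolume ≤ C := by
  refine ⟨16 * (∫ x, jet φ 1 x ^ 2 ∂halfVolume) + 16 * (∫ x, jet φ 2 x ^ 2 ∂halfVolume)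
    + 16 * ∫ x, jet φ 3 x ^ 2 ∂halfVolume, fun V hV => ?_⟩
  -- The supersolution is tested with φ² g(V). The arccotangent is a bounded smooth substitute for
  -- the 1/V of Moser's logarithmic estimate.
  set g : ℝ → ℝ := fun t => Real.pi / 2 - Real.arctan t with hgdef
  have hg : ContDiff ℝ ∞ g := contDiff_const.sub Real.contDiff_arctan
  have hg' : ∀ t, deriv g t = -(1 + t ^ 2)⁻¹ := fun t => by
    rw [((Real.hasDerivAt_arctan t).const_sub _).deriv, one_div]
  have hκ : ∀ t : ℝ, 0 ≤ (1 + t ^ 2)⁻¹ ∧ (1 + t ^ 2)⁻¹ ≤ 1 := fun t =>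
    ⟨by positivity, inv_le_one_of_one_le₀ (by nlinarith [sq_nonneg t])⟩
  have hpos : ∀ t, 0 ≤ g t := fun t => by
    simp only [hgdef]; linarith [Real.arctan_lt_pi_div_two t]
  have hχ : IsTestFunction fun x => φ x * φ x := hφ.mul_left hφ.contDiff
  obtain ⟨Φ, hΦ, hΦj⟩ := exists_jet_comp_mul hg (C := Real.pi)
    (fun t => by
      rw [abs_of_nonneg (hpos t)]
      simp only [hgdef]; linarith [Real.neg_pi_div_two_lt_arctan t])
    (fun t => by
      rw [hg', abs_neg, abs_of_nonneg (hκ t).1]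
      exact (hκ t).2.trans (by linarith [Real.pi_gt_three])) hχ hV.mem
  have hΦ0 : ∀ᵐ x ∂halfVolume, 0 ≤ Φ 0 x := by
    filter_upwards [hΦj 0] with x hx
    rw [hx, if_pos rfl, add_zero]
    exact mul_nonneg (hpos _) (mul_self_nonneg _)
  have hform := hV.form_nonneg Φ hΦ hΦ0
  have hχj : ∀ j ≠ 0, ∀ x, jet (fun x => φ x * φ x) j x = 2 * φ x * jet φ j x := by
    intro j hj x
    have := jet_comp_mul differentiable_id hφ.differentiable hφ.differentiable j x
    simp only [id, deriv_id, if_neg hj] at this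
    rw [this]; ring
  obtain ⟨D, hD⟩ := hφ.2.1.exists_bound_of_continuous hφ.continuous
  have hint1 : ∀ j, Integrable (fun x => jet φ j x ^ 2) halfVolume := fun j =>
    ((hφ.jet j).memLp 2).integrable_sq
  have hint2 : ∀ j, Integrable (fun x => φ x ^ 2 * ((1 + V 0 x ^ 2)⁻¹ * V j x ^ 2)) halfVolume := by
    intro j
    have hVj := (Lp.memLp (V j)).integrable_sq
    have hm : AEStronglyMeasurable (fun x => φ x ^ 2 * ((1 + V 0 x ^ 2)⁻¹ * V j x ^ 2)) halfVolume := by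
      have h1 : Continuous fun t : ℝ => (1 + t ^ 2)⁻¹ :=
        Continuous.inv₀ (by fun_prop) fun t => by positivity
      exact (hφ.continuous.pow 2).aestronglyMeasurable.mul
        ((h1.comp_aestronglyMeasurable (Lp.memLp (V 0)).1).mul hVj.1)
    refine (hVj.const_mul (D ^ 2)).mono' hm (Eventually.of_forall fun x => ?_)
    rw [Real.norm_of_nonneg (by have := (hκ (V 0 x)).1; positivity)]
    have h2 : φ x ^ 2 ≤ D ^ 2 := by
      rw [← sq_abs]; exact pow_le_pow_left₀ (abs_nonneg _) (hD x) 2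
    exact mul_le_mul h2 (mul_le_of_le_one_left (sq_nonneg _) (hκ _).2)
      (mul_nonneg (hκ _).1 (sq_nonneg _)) (sq_nonneg _)
  have hterm : ∀ j ≠ 0, inner ℝ (V j) (Φ j) ≤ 8 * (∫ x, jet φ j x ^ 2 ∂halfVolume)
      - 1 / 2 * ∫ x, φ x ^ 2 * ((1 + V 0 x ^ 2)⁻¹ * V j x ^ 2) ∂halfVolume := by
    intro j hj
    rw [inner_halfL2, ← integral_const_mul, ← integral_const_mul,
      ← integral_sub ((hint1 j).const_mul _) ((hint2 j).const_mul _)]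
    refine integral_mono_ae (integrable_mul_halfL2 _ _)
      (((hint1 j).const_mul _).sub ((hint2 j).const_mul _)) ?_
    filter_upwards [hΦj j, hV.nonneg] with x hx h0
    rw [hx, if_neg hj, hχj j hj, hg']
    have h1 : g (V 0 x) ^ 2 ≤ 4 * (1 + V 0 x ^ 2)⁻¹ := sq_arccot_le h0
    have h2 := mul_le_mul_of_nonneg_left h1 (mul_nonneg (sq_nonneg (φ x)) (sq_nonneg (V j x)))
    -- Young's inequality bounds the cross term by 8 (∂ⱼφ)² + φ² g² (∂ⱼV)²/8. By `sq_arccot_le` the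
    -- last summand costs only half of the good term.
    have h3 := sq_nonneg (φ x * g (V 0 x) * V j x - 8 * jet φ j x)
    nlinarith
  have hnn : ∀ j, 0 ≤ ∫ x, φ x ^ 2 * ((1 + V 0 x ^ 2)⁻¹ * V j x ^ 2) ∂halfVolume := fun j =>
    integral_nonneg fun x => by
      have := (hκ (V 0 x)).1
      positivity
  have t1 := hterm 1 (by decide)
  have t2 := hterm 2 (by decide)
  have t3 := hterm 3 (by decide)
  have n1 := hnn 1
  have n2 := hnn 2
  have n3 := hnn 3
  simp only [jetForm, one_pow, div_one, one_mul, zero_mul, add_zero] at hform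
  intro j hj
  fin_cases j
  · exact absurd rfl hj
  all_goals simp only [Fin.mk_one, Fin.reduceFinMk]; linarith

theorem lintegral_lintegral_le_of_tendsto {f : ℕ → Plane → ℝ} {f₀ : Plane → ℝ} {μ : Measure Plane}
    [SFinite μ] (hf : ∀ n, Continuous (f n)) (hlim : ∀ᵐ x ∂μ, Tendsto (fun n => f n x) atTop (𝓝 (f₀ x)))
    {R : ℕ → ℝ≥0∞} {K : ℝ≥0∞} (hR : Tendsto R atTop (𝓝 K))
    (h : ∀ n, ∫⁻ x, ∫⁻ y, ‖f n x - f n y‖ₑ ^ 2 ∂μ ∂μ ≤ R n) :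
    ∫⁻ x, ∫⁻ y, ‖f₀ x - f₀ y‖ₑ ^ 2 ∂μ ∂μ ≤ K := by
  have hm : ∀ n x, Measurable fun y => ‖f n x - f n y‖ₑ ^ 2 := fun n x =>
    ((continuous_const.sub (hf n)).measurable.enorm).pow_const 2
  have hm2 : ∀ n, Measurable fun x => ∫⁻ y, ‖f n x - f n y‖ₑ ^ 2 ∂μ := fun n =>
    Measurable.lintegral_prod_right' (measurable_sub_prod (hf n))
  calc ∫⁻ x, ∫⁻ y, ‖f₀ x - f₀ y‖ₑ ^ 2 ∂μ ∂μ
      = ∫⁻ x, ∫⁻ y, liminf (fun n => ‖f n x - f n y‖ₑ ^ 2) atTop ∂μ ∂μ := by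
        refine lintegral_congr_ae ?_
        filter_upwards [hlim] with x hx
        refine lintegral_congr_ae ?_
        filter_upwards [hlim] with y hy
        exact (Tendsto.liminf_eq ((ENNReal.continuous_pow 2).continuousAt.tendsto.comp
          (hx.sub hy).enorm)).symm
    _ ≤ ∫⁻ x, liminf (fun n => ∫⁻ y, ‖f n x - f n y‖ₑ ^ 2 ∂μ) atTop ∂μ :=
        lintegral_mono fun x => lintegral_liminf_le fun n => hm n x
    _ ≤ liminf (fun n => ∫⁻ x, ∫⁻ y, ‖f n x - f n y‖ₑ ^ 2 ∂μ ∂μ) atTop := lintegral_liminf_le hm2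
    _ ≤ liminf R atTop := liminf_le_liminf (Eventually.of_forall h)
    _ = K := hR.liminf_eq

/-- The derivative of arsinh is (1 + t²)^(-1/2), so the Caccioppoli inequality bounds exactly the
gradient of arsinh V. Poincaré is applied to the smooth arsinh ψₙ, and Fatou's lemma passes to V.
What matters is that K does not depend on V. -/
theorem exists_lintegral_arsinh_le {a b : Fin 2 → ℝ} (hQ : rectangle a b ⊆ halfPlane)
    {φ : Plane → ℝ} (hφ : IsTestFunction φ) (hφ1 : ∀ x ∈ rectangle a b, φ x = 1) :
    ∃ K : ℝ≥0∞, K ≠ ⊤ ∧ ∀ V, IsSupersolution V → ∫⁻ x in rectangle a b, ∫⁻ y in rectangle a b,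
      ‖Real.arsinh (V 0 x) - Real.arsinh (V 0 y)‖ₑ ^ 2 ≤ K := by
  obtain ⟨C, hC⟩ := exists_caccioppoli hφ
  refine ⟨2 * ENNReal.ofReal (b 0) * ENNReal.ofReal (b 1) * (ENNReal.ofReal (b 0) ^ 2 * ENNReal.ofReal C
    + ENNReal.ofReal (b 1) ^ 2 * ENNReal.ofReal C), by finiteness, fun V hV => ?_⟩
  obtain ⟨ψ, hψ, -, hlim, hae⟩ := exists_seq_of_mem_jetSpace hV.mem
  set Q := rectangle a b
  have hle : volume.restrict Q ≤ halfVolume := Measure.restrict_mono hQ le_rfl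
  have hκc : Continuous fun t : ℝ => (√(1 + t ^ 2))⁻¹ :=
    Continuous.inv₀ (by fun_prop) fun t => by positivity
  have hκ1 : ∀ t : ℝ, |(√(1 + t ^ 2))⁻¹| ≤ 1 := fun t => by
    rw [abs_of_nonneg (by positivity)]
    exact inv_le_one_of_one_le₀ (Real.one_le_sqrt.2 (by nlinarith [sq_nonneg t]))
  have hmV : AEStronglyMeasurable (fun x => (√(1 + V 0 x ^ 2))⁻¹) halfVolume :=
    hκc.comp_aestronglyMeasurable (Lp.memLp (V 0)).1
  set D : Fin 2 → Plane → ℝ := fun i x => (√(1 + V 0 x ^ 2))⁻¹ * V (gradIdx i) x with hD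
  have hDm : ∀ i, AEStronglyMeasurable (D i) halfVolume := fun i => hmV.mul (Lp.memLp (V (gradIdx i))).1
  have hDC : ∀ i, eLpNorm (D i) 2 (volume.restrict Q) ^ 2 ≤ ENNReal.ofReal C := by
    intro i
    have hI : MemLp (fun x => φ x * D i x) 2 halfVolume := by
      obtain ⟨B, hB⟩ := hφ.2.1.exists_bound_of_continuous hφ.continuous
      refine (Lp.memLp (V (gradIdx i))).of_le_mul (c := B * 1)
        (hφ.continuous.aestronglyMeasurable.mul (hDm i)) (Eventually.of_forall fun x => ?_)
      rw [norm_mul, hD, norm_mul, ← mul_assoc]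
      gcongr
      · exact (norm_nonneg _).trans (hB x)
      · exact hB x
      · exact hκ1 _
    have h1 : ∀ x, (φ x * D i x) ^ 2 = φ x ^ 2 * ((1 + V 0 x ^ 2)⁻¹ * V (gradIdx i) x ^ 2) := fun x => by
      rw [hD, mul_pow, mul_pow, inv_pow, Real.sq_sqrt (by positivity)]
    have h2 : ∫⁻ x, ‖φ x * D i x‖ₑ ^ 2 ∂halfVolume
        = ENNReal.ofReal (∫ x, φ x ^ 2 * ((1 + V 0 x ^ 2)⁻¹ * V (gradIdx i) x ^ 2) ∂halfVolume) := by
      simp only [← h1]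
      rw [ofReal_integral_eq_lintegral_ofReal hI.integrable_sq (Eventually.of_forall fun x => sq_nonneg _)]
      refine lintegral_congr fun x => ?_
      rw [← Real.enorm_eq_ofReal (sq_nonneg _), enorm_pow]
    calc eLpNorm (D i) 2 (volume.restrict Q) ^ 2 = ∫⁻ x in Q, ‖φ x * D i x‖ₑ ^ 2 := by
          rw [eLpNorm_two_sq]
          refine setLIntegral_congr_fun (measurableSet_rectangle a b) fun x hx => ?_
          simp only [hφ1 x hx, one_mul]
      _ ≤ ∫⁻ x, ‖φ x * D i x‖ₑ ^ 2 ∂halfVolume := lintegral_mono' hle le_rfl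
      _ ≤ ENNReal.ofReal C := by
          rw [h2]
          exact ENNReal.ofReal_le_ofReal (hC V hV _ (by fin_cases i <;> decide))
  have hpd : ∀ n i x, partialDeriv i (fun x => Real.arsinh (ψ n x)) x
      = (√(1 + ψ n x ^ 2))⁻¹ * jet (ψ n) (gradIdx i) x := fun n i x => by
    rw [partialDeriv_comp (hψ n).differentiable i x (Real.hasDerivAt_arsinh _), jet_gradIdx]
  have hconv : ∀ i, Tendsto (fun n => eLpNorm (fun x => (√(1 + ψ n x ^ 2))⁻¹ * jet (ψ n) (gradIdx i) x
      - D i x) 2 halfVolume) atTop (𝓝 0) := fun i =>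
    tendsto_eLpNorm_mul_sub (C := 1) (g := fun n => jet (ψ n) (gradIdx i))
      (fun n => (hκc.comp (hψ n).continuous).aestronglyMeasurable) hmV
      (fun n => (((hψ n).jet _).memLp 2).1) (Lp.memLp _) (fun n => Eventually.of_forall fun x => hκ1 _)
      ((hae 0).mono fun x hx => (hκc.tendsto _).comp hx) (hlim _)
  have hbd : ∀ i n, ∫⁻ x in Q, ‖partialDeriv i (fun x => Real.arsinh (ψ n x)) x‖ₑ ^ 2
      ≤ (eLpNorm (fun x => (√(1 + ψ n x ^ 2))⁻¹ * jet (ψ n) (gradIdx i) x - D i x) 2 halfVolume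
        + eLpNorm (D i) 2 (volume.restrict Q)) ^ 2 := by
    intro i n
    rw [← eLpNorm_two_sq]
    gcongr
    have hm : AEStronglyMeasurable (fun x => (√(1 + ψ n x ^ 2))⁻¹ * jet (ψ n) (gradIdx i) x - D i x)
        halfVolume :=
      ((hκc.comp (hψ n).continuous).aestronglyMeasurable.mul (((hψ n).jet _).memLp 2).1).sub (hDm i)
    have e : partialDeriv i (fun x => Real.arsinh (ψ n x)) =
        (fun x => (√(1 + ψ n x ^ 2))⁻¹ * jet (ψ n) (gradIdx i) x - D i x) + D i := by
      funext x
      simp [hpd]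
    rw [e]
    refine (eLpNorm_add_le (hm.mono_measure hle) ((hDm i).mono_measure hle) (by norm_num)).trans ?_
    gcongr
  have hlimR : ∀ i, Tendsto (fun n => (eLpNorm (fun x => (√(1 + ψ n x ^ 2))⁻¹ * jet (ψ n) (gradIdx i) x
      - D i x) 2 halfVolume + eLpNorm (D i) 2 (volume.restrict Q)) ^ 2) atTop
      (𝓝 (eLpNorm (D i) 2 (volume.restrict Q) ^ 2)) := fun i => by
    have := (ENNReal.continuous_pow 2).continuousAt.tendsto.comp ((hconv i).add_const
      (eLpNorm (D i) 2 (volume.restrict Q)))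
    simpa only [zero_add] using! this
  refine (lintegral_lintegral_le_of_tendsto (f := fun n x => Real.arsinh (ψ n x))
    (f₀ := fun x => Real.arsinh (V 0 x)) (μ := volume.restrict Q)
    (fun n => Real.continuous_arsinh.comp (hψ n).continuous)
    (Eventually.mono (ae_mono hle (hae 0)) fun x hx => (Real.continuous_arsinh.tendsto _).comp hx)
    (ENNReal.Tendsto.const_mul (a := 2 * ENNReal.ofReal (b 0) * ENNReal.ofReal (b 1))
      ((ENNReal.Tendsto.const_mul (a := ENNReal.ofReal (b 0) ^ 2) (hlimR 0) (Or.inr (by finiteness))).add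
        (ENNReal.Tendsto.const_mul (a := ENNReal.ofReal (b 1) ^ 2) (hlimR 1) (Or.inr (by finiteness))))
      (Or.inr (by finiteness))) fun n => ?_).trans ?_
  · refine (poincare_rectangle (Real.contDiff_arsinh.comp ((hψ n).contDiff.of_le (by simp)))).trans ?_
    gcongr
    · exact hbd 0 n
    · exact hbd 1 n
  · gcongr
    · exact hDC 0
    · exact hDC 1

theorem IsSupersolution.smul {V : Fin 4 → HalfL2} (hV : IsSupersolution V) {c : ℝ} (hc : 0 ≤ c) :
    IsSupersolution (c • V) := by
  refine ⟨jetSpace.smul_mem c hV.mem, ?_, fun Φ hΦ h0 => ?_⟩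
  · filter_upwards [hV.nonneg, Lp.coeFn_smul c (V 0)] with x h1 h2
    rw [Pi.smul_apply, h2]
    exact mul_nonneg hc h1
  · rw [jetForm_comm, jetForm_smul_right, jetForm_comm]
    exact mul_nonneg hc (hV.form_nonneg Φ hΦ h0)

/-- A nonnegative supersolution cannot vanish on part of a rectangle without vanishing on all of
it. -/
theorem IsSupersolution.measure_mul_eq_zero {V : Fin 4 → HalfL2} (hV : IsSupersolution V)
    {a b : Fin 2 → ℝ} (hQ : rectangle a b ⊆ halfPlane)
    {φ : Plane → ℝ} (hφ : IsTestFunction φ) (hφ1 : ∀ x ∈ rectangle a b, φ x = 1) {δ : ℝ} (hδ : 0 < δ) :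
    volume ({x | V 0 x = 0} ∩ rectangle a b) * volume ({x | δ ≤ V 0 x} ∩ rectangle a b) = 0 := by
  obtain ⟨K, hK, hKV⟩ := exists_lintegral_arsinh_le hQ hφ hφ1
  set Q := rectangle a b
  have hle : volume.restrict Q ≤ halfVolume := Measure.restrict_mono hQ le_rfl
  have hVm : Measurable (V 0) := (Lp.stronglyMeasurable (V 0)).measurable
  have hZm : MeasurableSet {x | V 0 x = 0} := hVm (measurableSet_singleton 0)
  have hPm : MeasurableSet {x | δ ≤ V 0 x} := hVm measurableSet_Ici
  set Z := {x | V 0 x = 0}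
  set P := {x | δ ≤ V 0 x}
  -- Multiples of V are supersolutions with the same K. For s = sinh n / δ, arsinh(sV) is at least n
  -- on P and zero on Z, so n² |Z ∩ Q| |P ∩ Q| ≤ K for every n.
  have key : ∀ n : ℕ, (n : ℝ≥0∞) ^ 2 * (volume (Z ∩ Q) * volume (P ∩ Q)) ≤ K := by
    intro n
    have hs : 0 ≤ Real.sinh n / δ := div_nonneg (Real.sinh_nonneg_iff.2 n.cast_nonneg) hδ.le
    set s := Real.sinh n / δ
    have hco : ∀ᵐ x ∂volume.restrict Q, (s • V) 0 x = s * V 0 x := by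
      filter_upwards [ae_mono hle (Lp.coeFn_smul s (V 0))] with x hx
      rw [Pi.smul_apply, hx]; rfl
    refine le_trans ?_ (hKV _ (hV.smul hs))
    have hin : ∀ᵐ x ∂volume.restrict Q, P.indicator (fun _ => (n : ℝ≥0∞) ^ 2 * volume (Z ∩ Q)) x ≤
        ∫⁻ y in Q, ‖Real.arsinh ((s • V) 0 x) - Real.arsinh ((s • V) 0 y)‖ₑ ^ 2 := by
      filter_upwards [hco] with x hx
      by_cases hxP : x ∈ P
      · rw [Set.indicator_of_mem hxP, ← Measure.restrict_apply hZm, ← lintegral_indicator_const hZm]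
        refine lintegral_mono_ae ?_
        filter_upwards [hco] with y hy
        by_cases hyZ : y ∈ Z
        · have hy0 : V 0 y = 0 := hyZ
          have hx0 : δ ≤ V 0 x := hxP
          rw [Set.indicator_of_mem hyZ, hx, hy, hy0, mul_zero, Real.arsinh_zero, sub_zero]
          gcongr
          have h1 : (n : ℝ) ≤ Real.arsinh (s * V 0 x) := by
            rw [← Real.arsinh_sinh n, Real.arsinh_le_arsinh]
            calc Real.sinh n = s * δ := (div_mul_cancel₀ _ hδ.ne').symm
              _ ≤ s * V 0 x := by gcongr
          rw [Real.enorm_eq_ofReal (n.cast_nonneg.trans h1), ← ENNReal.ofReal_natCast]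
          exact ENNReal.ofReal_le_ofReal h1
        · rw [Set.indicator_of_notMem hyZ]; exact bot_le
      · rw [Set.indicator_of_notMem hxP]; exact bot_le
    refine le_trans (le_of_eq ?_) (lintegral_mono_ae hin)
    rw [lintegral_indicator_const hPm, Measure.restrict_apply hPm, mul_assoc]
  by_contra h0
  have hlim : Tendsto (fun n : ℕ => (n : ℝ≥0∞) ^ 2 * (volume (Z ∩ Q) * volume (P ∩ Q))) atTop
      (𝓝 (⊤ * (volume (Z ∩ Q) * volume (P ∩ Q)))) := by
    refine ENNReal.Tendsto.mul_const ?_ (Or.inl ENNReal.top_ne_zero)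
    have := (ENNReal.continuous_pow 2).continuousAt.tendsto.comp ENNReal.tendsto_nat_nhds_top
    simpa using! this
  have := le_of_tendsto' hlim key
  rw [ENNReal.top_mul h0, top_le_iff] at this
  exact hK this

/-! #### Exhaustion of the half-plane -/

/-- An increasing sequence of rectangles exhausting the half-plane. -/
def exhaustion (N : ℕ) : Set Plane :=
  rectangle ![1 / (N + 1), -(N + 1)] ![(N + 1) - 1 / (N + 1), 2 * (N + 1)]

theorem mem_exhaustion {N : ℕ} {x : Plane} : x ∈ exhaustion N ↔
    (1 / (N + 1) ≤ x 0 ∧ x 0 < N + 1) ∧ (-(N + 1) ≤ x 1 ∧ x 1 < (N + 1 : ℝ)) := by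
  have e0 : 1 / ((N : ℝ) + 1) + (N + 1 - 1 / (N + 1)) = N + 1 := by ring
  have e1 : -((N : ℝ) + 1) + 2 * (N + 1) = N + 1 := by ring
  simp only [exhaustion, rectangle, Set.mem_ofPred_eq, Fin.forall_fin_two, Set.mem_Ico,
    Matrix.cons_val_zero, Matrix.cons_val_one, e0, e1]

theorem exhaustion_subset (N : ℕ) : exhaustion N ⊆ halfPlane := fun x hx =>
  lt_of_lt_of_le (by positivity) (mem_exhaustion.1 hx).1.1

theorem monotone_exhaustion : Monotone exhaustion := by
  intro N M h x hx
  rw [mem_exhaustion] at hx ⊢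
  have h1 : (N : ℝ) ≤ M := by exact_mod_cast h
  have h2 : 1 / ((M : ℝ) + 1) ≤ 1 / (N + 1) := by gcongr
  refine ⟨⟨?_, ?_⟩, ?_, ?_⟩ <;> linarith [hx.1.1, hx.1.2, hx.2.1, hx.2.2]

theorem iUnion_exhaustion : ⋃ N, exhaustion N = halfPlane := by
  refine Set.Subset.antisymm (Set.iUnion_subset exhaustion_subset) fun x hx => ?_
  have hx0 : 0 < x 0 := hx
  obtain ⟨N, hN⟩ := exists_nat_ge (max (1 / x 0) ‖x‖)
  have h1 : 1 / x 0 ≤ N := (le_max_left _ _).trans hN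
  have h2 : ‖x‖ ≤ N := (le_max_right _ _).trans hN
  have h3 := abs_le.1 ((abs_coord_le_norm x 0).trans h2)
  have h4 := abs_le.1 ((abs_coord_le_norm x 1).trans h2)
  refine Set.mem_iUnion.2 ⟨N, mem_exhaustion.2 ⟨⟨?_, ?_⟩, ?_, ?_⟩⟩
  · rw [one_div_le (by positivity) hx0]; linarith
  all_goals linarith [h3.1, h3.2, h4.1, h4.2]

theorem exists_cutoff_exhaustion (N : ℕ) :
    ∃ φ, IsTestFunction φ ∧ ∀ x ∈ exhaustion N, φ x = 1 := by
  have hN : (0 : ℝ) < N + 1 := by positivity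
  -- The first factor vanishes for x₁ ≤ 1/(2(N+1)) and is 1 for x₁ ≥ 1/(N+1); the second is 1 on the
  -- ball of radius 2(N+1), which contains the rectangle.
  refine ⟨fun x => Real.smoothTransition (2 * (N + 1) * x 0 - 1) * scaledCutoff (2 * (N + 1)) x,
    ⟨?_, ?_, ?_⟩, fun x hx => ?_⟩
  · exact (Real.smoothTransition.contDiff.comp
      ((contDiff_const.mul (contDiff_coord 0)).sub contDiff_const)).mul (contDiff_scaledCutoff _)
  · refine HasCompactSupport.mul_left ?_
    exact hasCompactSupport_radialCutoff.comp_smul (by positivity)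
  · have hcl : IsClosed {x : Plane | 1 ≤ 2 * ((N : ℝ) + 1) * x 0} :=
      isClosed_le continuous_const (continuous_const.mul (contDiff_coord 0).continuous)
    have hsub : tsupport (fun x : Plane => Real.smoothTransition (2 * (N + 1) * x 0 - 1)
        * scaledCutoff (2 * (N + 1)) x) ⊆ {x : Plane | 1 ≤ 2 * ((N : ℝ) + 1) * x 0} := by
      refine closure_minimal (fun x hx => ?_) hcl
      by_contra h
      rw [Set.mem_ofPred_eq, not_le] at h
      exact hx (by simp only [Real.smoothTransition.zero_of_nonpos (by linarith :
        2 * ((N : ℝ) + 1) * x 0 - 1 ≤ 0), zero_mul])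
    intro x hx
    have h1 : 1 ≤ 2 * ((N : ℝ) + 1) * x 0 := hsub hx
    by_contra h
    have h2 : x 0 ≤ 0 := not_lt.1 h
    nlinarith
  · obtain ⟨⟨h1, h2⟩, h3, h4⟩ := mem_exhaustion.1 hx
    have h5 : 1 ≤ ((N : ℝ) + 1) * x 0 := by rwa [div_le_iff₀' hN] at h1
    have h6 : ‖x‖ ≤ 2 * (N + 1) := by
      refine abs_le_of_sq_le_sq' ?_ (by positivity) |>.2
      rw [EuclideanSpace.real_norm_sq_eq, Fin.sum_univ_two]
      have h7 : 0 < x 0 := exhaustion_subset N hx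
      nlinarith
    change Real.smoothTransition _ * scaledCutoff _ x = 1
    rw [Real.smoothTransition.one_of_one_le (by linarith), one_mul]
    refine radialCutoff_eq_one ?_
    rw [norm_smul, norm_inv, Real.norm_of_nonneg (by positivity), inv_mul_eq_div,
      div_le_one (by positivity)]
    exact h6

/-- If the zero set had positive measure in one rectangle of the exhaustion, then every set {V ≥
1/(k+1)} would be null in all larger ones, so V would vanish. The nested rectangles play the role of
connectedness. -/
theorem IsSupersolution.pos {V : Fin 4 → HalfL2} (hV : IsSupersolution V)
    (hne : ¬ V 0 =ᵐ[halfVolume] 0) : ∀ᵐ x ∂halfVolume, 0 < V 0 x := by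
  have hnull : ∀ {s : Set Plane}, (∀ N, volume (s ∩ exhaustion N) = 0) → halfVolume s = 0 := by
    intro s hs
    rw [halfVolume, Measure.restrict_apply' measurableSet_halfPlane, ← iUnion_exhaustion,
      Set.inter_iUnion]
    exact measure_iUnion_null hs
  have hZ : halfVolume {x | V 0 x = 0} = 0 := by
    by_contra hZ
    obtain ⟨N, hN⟩ : ∃ N, volume ({x | V 0 x = 0} ∩ exhaustion N) ≠ 0 := by
      by_contra! h; exact hZ (hnull h)
    refine hne ?_
    have hP : ∀ k : ℕ, halfVolume {x | 1 / ((k : ℝ) + 1) ≤ V 0 x} = 0 := by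
      refine fun k => hnull fun M => ?_
      obtain ⟨φ, hφ, hφ1⟩ := exists_cutoff_exhaustion (max N M)
      have h := hV.measure_mul_eq_zero (exhaustion_subset (max N M)) hφ hφ1
        (δ := 1 / ((k : ℝ) + 1)) (by positivity)
      rcases mul_eq_zero.1 h with h | h
      · exact absurd (measure_mono_null (Set.inter_subset_inter_right _
          (monotone_exhaustion (le_max_left N M))) h) hN
      · exact measure_mono_null (Set.inter_subset_inter_right _
          (monotone_exhaustion (le_max_right N M))) h
    have hP' : ∀ᵐ x ∂halfVolume, ∀ k : ℕ, ¬ 1 / ((k : ℝ) + 1) ≤ V 0 x :=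
      ae_all_iff.2 fun k => measure_eq_zero_iff_ae_notMem.1 (hP k)
    filter_upwards [hP', hV.nonneg] with x h1 h2
    refine le_antisymm (not_lt.1 fun h3 => ?_) h2
    obtain ⟨k, hk⟩ := exists_nat_one_div_lt h3
    exact h1 k hk.le
  filter_upwards [hV.nonneg, measure_eq_zero_iff_ae_notMem.1 hZ] with x h1 h2
  exact h1.lt_of_ne' h2

/-- A nonnegative minimizer is positive. -/
theorem IsMinimizer.pos_of_nonneg {p : ℝ} [hp : Fact (2 < p)] {V : jetSpace}
    (h : IsMinimizer p 1 0 V) (h0 : ∀ᵐ x ∂halfVolume, 0 ≤ V.1 0 x) :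
    ∀ᵐ x ∂halfVolume, 0 < V.1 0 x := by
  -- For V ≥ 0 the right-hand side of the equation is nonnegative against nonnegative Φ, so V is a
  -- supersolution.
  refine IsSupersolution.pos ⟨V.2, h0, fun Φ hΦ hΦ0 => ?_⟩
    (h.isLeastEnergySolution (isJet_self V.2)).1.2
  have e := h.jetForm_eq ⟨Φ, hΦ⟩
  refine le_of_le_of_eq (integral_nonneg_of_ae ?_) e.symm
  filter_upwards [h0, hΦ0] with x h1 h2
  exact mul_nonneg (mul_nonneg (by positivity) h1) h2

theorem ae_nonneg_of_tendsto {V : ℕ → jetSpace} {W : jetSpace} (h : Tendsto V atTop (𝓝 W))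
    (hV : ∀ k, ∀ᵐ x ∂halfVolume, 0 ≤ (V k).1 0 x) : ∀ᵐ x ∂halfVolume, 0 ≤ W.1 0 x := by
  have h1 : Tendsto (fun k => (V k).1 0) atTop (𝓝 (W.1 0)) :=
    (((continuous_apply 0).comp continuous_subtype_val).tendsto W).comp h
  obtain ⟨ns, -, hns⟩ := (tendstoInMeasure_of_tendsto_Lp h1).exists_seq_tendsto_ae
  filter_upwards [hns, ae_all_iff.2 hV] with x h2 h3
  exact ge_of_tendsto' h2 fun k => h3 (ns k)

end HalfPlaneNLS

/-! ### The main theorem -/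

theorem theorem1p5 (p : ℝ) (hp : 2 < p) (lam : ℕ → ℝ)
    (hlam_pos : ∀ k, 0 < lam k) (hlam_le : ∀ k, lam k ≤ 1) (hlam : Tendsto lam atTop (𝓝 0))
    (u : ℕ → Plane → ℝ)
    (hu : ∀ k, IsPositiveLeastEnergySolution p (lam k) 1 (u k)) :
    (∀ k, MemHPlus (rescale p (lam k) (u k))) ∧
      ∃ (s : ℕ → ℕ) (vstar : Plane → ℝ), StrictMono s ∧
        TendstoHPlus (fun k => rescale p (lam (s k)) (u (s k))) vstar ∧
        IsPositiveLeastEnergySolution p 1 0 vstar := by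
  have : Fact (2 < p) := ⟨hp⟩
  have hV : ∀ k, ∃ V : jetSpace, IsJet (rescale p (lam k) (u k)) V.1 ∧
      IsMinimizer p 1 (lam k ^ 2) V := fun k => by
    obtain ⟨U, hU⟩ := exists_isJet_of_memHPlus (hu k).1.1.1.1
    exact ((hu k).1.isMinimizer (hlam_pos k).ne' zero_le_one (U := ⟨U, hU.mem⟩) hU).exists_rescale
      (hlam_pos k) hU
  choose V hVj hVm using hV
  -- After rescaling, q = λₖ² lies in [0, 1] and tends to 0.
  obtain ⟨s, W, hs, hW, hWm⟩ := exists_tendsto_isMinimizer (fun k => sq_nonneg (lam k))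
    (fun k => pow_le_one₀ (hlam_pos k).le (hlam_le k)) (by simpa using hlam.pow 2) hVm
  have hWj : IsJet (W.1 0) W.1 := isJet_self W.2
  refine ⟨fun k => (hVj k).memHPlus, s, W.1 0, hs,
    tendstoHPlus_of_isJet (fun k => hVj (s k)) hWj hW, hWm.isLeastEnergySolution hWj,
    hWm.pos_of_nonneg (ae_nonneg_of_tendsto hW fun k => ?_)⟩
  filter_upwards [(hVj (s k)).ae_eq, ae_dilation (hlam_pos (s k)) (hu (s k)).2] with x h1 h2
  rw [← h1]
  exact mul_nonneg (Real.rpow_nonneg (hlam_pos _).le _) h2.le
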